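/- Let $f:\mathbb R\to\mathbb R$ be real-analytic and $2\pi$-periodic with average $\alpha=\frac1{2\pi}\int_0^{2\pi}f(\psi)\,d\psi>0$, let $a=\sqrt\alpha$ and let $\omega\in\mathbb R\setminus\{0\}$. Consider $$\varepsilon\ddot x+\dot x+\varepsilon x^2=\varepsilon f(\omega t).\qquad(1)$$ There is a formal solution $\sum_{k\ge0}\varepsilon^k x^{(k)}(t)$ of (1) with real-analytic $2\pi/\omega$-periodic coefficients and $x^{(0)}\equiv a$, and there are $\varepsilon_0,\delta>0$ such that, for every real $\varepsilon$ with $0<|\varepsilon|<\varepsilon_0$, equation (1) has exactly one periodic solution $x(t;\varepsilon)$ (among the periodic functions of any period) with $|x(t;\varepsilon)-a|<\delta$ for all $t$. This solution is real, has period $2\pi/\omega$, and admits the formal solution as an asymptotic expansion: for every $N$ one has $x(t;\varepsilon)=\sum_{k<N}\varepsilon^kx^{(k)}(t)+O(|\varepsilon|^N)$ uniformly in $t$. The solution $x(t;\varepsilon)$ is Borel-summable in $\varepsilon$ at the origin. That is, there are $R,b>0$ and $K$ (independent of $t$) for which the following holds. (i) For every $t\in\mathbb R$ the Borel transform $\mathcal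 B(t;s)=\sum_{k\ge0}\frac{s^k}{k!}x^{(k)}(t)$ converges for $|s|<b$ and continues analytically to the strip $\{s\in\mathbb C:|\mathrm{Im}\,s|<b\}$ around the real axis (so in particular to the $b$-neighbourhood of $\mathbb R_+$), with $|\mathcal B(t;s)|\le K e^{|s|/R}$ there. (ii) The solution $x(t;\varepsilon)$ extends to all $\varepsilon$ in the pair of discs $\mathcal C_R=\{\varepsilon\ne0:|\mathrm{Re}\,\varepsilon^{-1}|>R^{-1}\}$ as a function that is analytic in $\varepsilon$ and that is, for each $\varepsilon\in\mathcal C_R$, a $2\pi/\omega$-periodic (complex-valued) solution of (1). (iii) For all $t\in\mathbb R$ and $\varepsilon\in\mathcal C_R$, $$x(t;\varepsilon)=\frac1\varepsilon\int_0^{\sigma\infty}e^{-s/\varepsilon}\,\mathcal B(t;s)\,ds,\qquad \sigma=\mathrm{sign}(\mathrm{Re}\,\varepsilon),$$ where the integral is absolutely convergent; it runs along the positive half-axis for $\varepsilon$ in the right disc and along the negative half-axis for $\varepsilon$ in the left disc. -/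

import Mathlib

/-- The average over one period of a `2π`-periodic function. -/
noncomputable def forcingMean (f : ℝ → ℝ) : ℝ :=
  (2 * Real.pi)⁻¹ * ∫ ψ in (0 : ℝ)..(2 * Real.pi), f ψ

/-- `x` is a `T`-periodic solution, defined for all real times and possibly complex-valued, of
`ε ẍ + ẋ + ε x² = ε f(ω t)`. -/
structure IsPeriodicSolution (f : ℝ → ℝ) (ω T : ℝ) (ε : ℂ) (x : ℝ → ℂ) : Prop where
  differentiable : Differentiable ℝ x
  differentiable_deriv : Differentiable ℝ (deriv x)
  equation : ∀ t : ℝ, ε * deriv (deriv x) t + deriv x t + ε * x t ^ 2 = ε * (f (ω * t) : ℂ)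
  periodic : Function.Periodic x T

/-- The formal power series `∑ ε ^ k X k t`, with analytic `2π/ω`-periodic coefficients and
constant term `a`, solves `ε ẍ + ẋ + ε x² = ε f(ω t)` order by order in `ε`. -/
structure IsFormalPeriodicSolution (f : ℝ → ℝ) (ω a : ℝ) (X : ℕ → ℝ → ℝ) : Prop where
  analytic : ∀ k, AnalyticOnNhd ℝ (X k) Set.univ
  periodic : ∀ k, Function.Periodic (X k) (2 * Real.pi / ω)
  order_zero : ∀ t, X 0 t = a
  order_succ : ∀ k t, deriv (X (k + 1)) t =
    (if k = 0 then f (ω * t) else 0) - deriv (deriv (X k)) t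
      - ∑ j ∈ Finset.range (k + 1), X j t * X (k - j) t

/-- The two open discs of diameter `R` that are tangent to the imaginary axis at the origin, with
centres `R / 2` and `- R / 2`. -/
def twoDiscs (R : ℝ) : Set ℂ := {ε | R⁻¹ < |(ε⁻¹).re|}

/-- `φ`, a function on `twoDiscs R`, is the Borel sum of the formal power series `∑ c k ε ^ k`,
with Borel transform `B`, which is analytic in the strip of half-width `b` around the real axis.
On the left disc the Laplace integral runs along the negative half-axis, from `0` to `-∞`. -/
structure IsBorelSum (R b K : ℝ) (c : ℕ → ℂ) (B φ : ℂ → ℂ) : Prop where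
  hasSum : ∀ s : ℂ, ‖s‖ < b → HasSum (fun k : ℕ => s ^ k / (k.factorial : ℂ) * c k) (B s)
  analytic : AnalyticOnNhd ℂ B {s : ℂ | |s.im| < b}
  bound : ∀ s : ℂ, |s.im| < b → ‖B s‖ ≤ K * Real.exp (‖s‖ / R)
  analytic_sum : AnalyticOnNhd ℂ φ (twoDiscs R)
  integrable_right : ∀ ε : ℂ, R⁻¹ < (ε⁻¹).re →
    MeasureTheory.IntegrableOn (fun s : ℝ => Complex.exp (-((s : ℂ) / ε)) * B s) (Set.Ioi 0)
  laplace_right : ∀ ε : ℂ, R⁻¹ < (ε⁻¹).re →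
    φ ε = 1 / ε * ∫ s : ℝ in Set.Ioi 0, Complex.exp (-((s : ℂ) / ε)) * B s
  integrable_left : ∀ ε : ℂ, (ε⁻¹).re < -R⁻¹ →
    MeasureTheory.IntegrableOn (fun s : ℝ => Complex.exp (-((s : ℂ) / ε)) * B s) (Set.Iio 0)
  laplace_left : ∀ ε : ℂ, (ε⁻¹).re < -R⁻¹ →
    φ ε = 1 / ε * -∫ s : ℝ in Set.Iio 0, Complex.exp (-((s : ℂ) / ε)) * B s

/-- `x ε`, for real `ε` with `0 < |ε| < ε₀`, is the real periodic solution of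
`ε ẍ + ẋ + ε x² = ε f(ω t)` that has the formal solution `∑ ε ^ k X k` as asymptotic expansion;
it has the period of the forcing term, and it is the only periodic solution, of whatever period,
in the `δ`-neighbourhood of the constant `a`. -/
structure IsForcedResponse (f : ℝ → ℝ) (ω a ε₀ δ : ℝ) (X : ℕ → ℝ → ℝ) (x : ℂ → ℝ → ℂ) :
    Prop where
  solution : ∀ ε : ℝ, 0 < |ε| → |ε| < ε₀ → IsPeriodicSolution f ω (2 * Real.pi / ω) ε (x ε)
  real : ∀ ε : ℝ, 0 < |ε| → |ε| < ε₀ → ∀ t, (x ε t).im = 0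
  near : ∀ ε : ℝ, 0 < |ε| → |ε| < ε₀ → ∀ t, ‖x ε t - (a : ℂ)‖ < δ
  unique : ∀ ε : ℝ, 0 < |ε| → |ε| < ε₀ → ∀ (T : ℝ) (y : ℝ → ℂ), 0 < T →
    IsPeriodicSolution f ω T ε y → (∀ t, ‖y t - (a : ℂ)‖ < δ) → y = x ε
  expansion : ∀ N : ℕ, ∃ C : ℝ, ∀ ε : ℝ, 0 < |ε| → |ε| < ε₀ → ∀ t : ℝ,
    ‖x ε t - ∑ k ∈ Finset.range N, (ε : ℂ) ^ k * (X k t : ℂ)‖ ≤ C * |ε| ^ N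

/-! Divide the equation by ε and write x = a + y and g(t) = f(ωt) - α, so that ÿ + ẏ/ε + 2a y + y² =
g. Look for y as a Laplace integral ∫ e^{-s/ε} U(t,s) ds. Products become convolutions in s, and
multiplication by 1/ε becomes ∂ₛ plus a boundary term at s = 0. The equation turns into (∂ₜ + ∂ₛ)∂ₜU
+ 2aU + U∗U = 0 with ∂ₜU(t,0) = g(t), and the Borel transform of x is a + ∫₀ˢ U.

The characteristics t - s = const have real direction, so integration J along them never leaves the
domain |Im t| + |Im s| < b, and ∂ₜU = g(t-s) - J(2aU + U∗U). To recover U from ∂ₜU, apply the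
mean-free primitive P over one period; it is bounded, since with a single frequency no small
divisors occur. The mean of U is fixed by requiring that 2aU + U∗U have mean zero, which can be
solved because a > 0. This gives the fixed-point equation U = P g(t-s) - J P(2aU + U∗U) -
(2a)⁻¹⟨U∗U⟩ of `borelMap`. For the weight e^{κ|s|}/(1+κ|s|)² both J and ∗ gain a factor 1/κ
(`norm_charIntegral_le`, `norm_sndConv_le`), so the map is a contraction for large κ
(`exists_borelMap_fixedPoint`). The fixed point is holomorphic and exponentially bounded around the
whole real s-axis, and `exists_isBorelSolution` returns from it to the differential equation for U.

The rest is read off from U. Its Laplace integral along either half-axis solves the original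
equation (`IsBorelSolution.hasDerivAt_borelSum`). Its Taylor coefficients at s = 0 form the formal
solution (`IsBorelSolution.deriv_formalCoeff`). Repeated integration by parts gives the asymptotic
expansion with a uniform remainder (`borelLaplace_sub_sum`).

Uniqueness does not use the Borel transform. The difference of two periodic solutions near a solves
a linear damped equation with coefficient close to 2a. In suitable variables its squared norm decays
exponentially in the time t/ε, and being bounded on all of ℝ it vanishes
(`IsPeriodicSolution.eq_of_near`). -/

section

open Set Filter Topology MeasureTheory Metric

/-! ### Holomorphic dependence on parameters: integrals, series and Taylor coefficients. -/

/-- Cauchy's estimate for the Fréchet derivative. -/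
theorem norm_fderiv_le_of_norm_le_ball {E : Type*} [NormedAddCommGroup E] [NormedSpace ℂ E]
    {f : E → ℂ} {p : E} {r M : ℝ} (hr : 0 < r) (hf : DifferentiableOn ℂ f (ball p r))
    (hM : ∀ q ∈ ball p r, ‖f q‖ ≤ M) : ‖fderiv ℂ f p‖ ≤ 2 * M / r := by
  refine Complex.norm_fderiv_le_div_of_mapsTo_ball hf (fun q hq => ?_) hr
  rw [mem_closedBall, dist_eq_norm]
  linarith [norm_sub_le (f q) (f p), hM q hq, hM p (mem_ball_self hr)]

/-- Holomorphic dependence on a parameter of an integral over a compact interval. -/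
theorem hasFDerivAt_intervalIntegral_of_differentiableOn {E : Type*} [NormedAddCommGroup E]
    [NormedSpace ℂ E] [ProperSpace E] {Ω : Set E} (hΩ : IsOpen Ω) {F : E → ℝ → ℂ} {a b : ℝ}
    (hab : a ≤ b) (hc : ContinuousOn (fun q : E × ℝ => F q.1 q.2) (Ω ×ˢ Icc a b))
    (hd : ∀ r ∈ Icc a b, DifferentiableOn ℂ (fun p => F p r) Ω) {p : E} (hp : p ∈ Ω) :
    ContinuousOn (fun r => fderiv ℂ (fun q => F q r) p) (Icc a b) ∧
    HasFDerivAt (fun q => ∫ r in a..b, F q r) (∫ r in a..b, fderiv ℂ (fun q => F q r) p) p := by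
  obtain ⟨ρ, hρ, hball⟩ := nhds_basis_closedBall.mem_iff.1 (hΩ.mem_nhds hp)
  have hK : IsCompact (closedBall p ρ ×ˢ Icc a b) := (isCompact_closedBall p ρ).prod isCompact_Icc
  have hcK := hc.mono (prod_mono hball (le_refl (Icc a b)))
  obtain ⟨M, hM⟩ := hK.exists_bound_of_continuousOn hcK
  have huc := hK.uniformContinuousOn_of_continuous hcK
  have hcont : ContinuousOn (fun r => fderiv ℂ (fun q => F q r) p) (Icc a b) := by
    intro r₀ hr₀
    rw [Metric.continuousWithinAt_iff]
    intro η hη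
    rw [Metric.uniformContinuousOn_iff] at huc
    obtain ⟨δ, hδ, h⟩ := huc (η * ρ / 4) (by positivity)
    refine ⟨δ, hδ, fun {r} hr hrr => ?_⟩
    have hd1 : DifferentiableAt ℂ (fun q => F q r) p := (hd r hr).differentiableAt (hΩ.mem_nhds hp)
    have hd2 : DifferentiableAt ℂ (fun q => F q r₀) p :=
      (hd r₀ hr₀).differentiableAt (hΩ.mem_nhds hp)
    rw [dist_eq_norm, ← fderiv_fun_sub hd1 hd2]
    -- Cauchy's estimate for the difference of two slices turns uniform continuity of F into
    -- continuity of its derivative in r.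
    have := norm_fderiv_le_of_norm_le_ball (f := fun q => F q r - F q r₀) (M := η * ρ / 4) hρ
      (((hd r hr).sub (hd r₀ hr₀)).mono (ball_subset_closedBall.trans hball)) (fun q hq => by
        have := h (q, r) ⟨ball_subset_closedBall hq, hr⟩ (q, r₀) ⟨ball_subset_closedBall hq, hr₀⟩
          (by simpa [Prod.dist_eq] using hrr)
        rw [dist_eq_norm] at this
        exact this.le)
    calc _ ≤ _ := this
      _ = η / 2 := by field_simp; ring
      _ < η := by linarith
  refine ⟨hcont, ?_⟩
  have hint : ∀ q ∈ Ω, ContinuousOn (F q) (Icc a b) := fun q hq =>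
    hc.comp (f := fun r => (q, r)) (by fun_prop) (fun r hr => ⟨hq, hr⟩)
  refine intervalIntegral.hasFDerivAt_integral_of_dominated_of_fderiv_le (s := ball p (ρ / 2))
    (F' := fun q r => fderiv ℂ (fun q => F q r) q) (bound := fun _ => 2 * M / (ρ / 2))
    (ball_mem_nhds _ (by positivity)) ?_ ?_ ?_ ?_ ?_ ?_
  · filter_upwards [hΩ.mem_nhds hp] with q hq
    rw [uIoc_of_le hab]
    exact ((hint q hq).mono Ioc_subset_Icc_self).aestronglyMeasurable measurableSet_Ioc
  · exact (hint p hp).intervalIntegrable_of_Icc hab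
  · rw [uIoc_of_le hab]
    exact (hcont.mono Ioc_subset_Icc_self).aestronglyMeasurable measurableSet_Ioc
  · refine Eventually.of_forall fun r hr q hq => ?_
    rw [uIoc_of_le hab] at hr
    have hsub : ball q (ρ / 2) ⊆ closedBall p ρ := fun z hz => by
      rw [mem_closedBall]; rw [mem_ball] at hz hq
      linarith [dist_triangle z q p]
    exact norm_fderiv_le_of_norm_le_ball (by positivity)
      ((hd r (Ioc_subset_Icc_self hr)).mono (hsub.trans hball))
      (fun z hz => hM (z, r) ⟨hsub hz, Ioc_subset_Icc_self hr⟩)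
  · simp
  · refine Eventually.of_forall fun r hr q hq => ?_
    rw [uIoc_of_le hab] at hr
    have hq' : q ∈ Ω := hball (ball_subset_closedBall (ball_subset_ball (by linarith) hq))
    exact ((hd r (Ioc_subset_Icc_self hr)).differentiableAt (hΩ.mem_nhds hq')).hasFDerivAt

theorem differentiableOn_intervalIntegral {E : Type*} [NormedAddCommGroup E]
    [NormedSpace ℂ E] [ProperSpace E] {Ω : Set E} (hΩ : IsOpen Ω) {F : E → ℝ → ℂ} {a b : ℝ}
    (hab : a ≤ b) (hc : ContinuousOn (fun q : E × ℝ => F q.1 q.2) (Ω ×ˢ Icc a b))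
    (hd : ∀ r ∈ Icc a b, DifferentiableOn ℂ (fun p => F p r) Ω) :
    DifferentiableOn ℂ (fun q => ∫ r in a..b, F q r) Ω := fun _ hp =>
  ((hasFDerivAt_intervalIntegral_of_differentiableOn hΩ hab hc hd hp).2.differentiableAt
    ).differentiableWithinAt

/-- Directional derivative of a parametric integral. -/
theorem fderiv_intervalIntegral_apply {E : Type*} [NormedAddCommGroup E]
    [NormedSpace ℂ E] [ProperSpace E] {Ω : Set E} (hΩ : IsOpen Ω) {F : E → ℝ → ℂ} {a b : ℝ}
    (hab : a ≤ b) (hc : ContinuousOn (fun q : E × ℝ => F q.1 q.2) (Ω ×ˢ Icc a b))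
    (hd : ∀ r ∈ Icc a b, DifferentiableOn ℂ (fun p => F p r) Ω) {p : E} (hp : p ∈ Ω) (v : E) :
    fderiv ℂ (fun q => ∫ r in a..b, F q r) p v
      = ∫ r in a..b, fderiv ℂ (fun q => F q r) p v := by
  obtain ⟨h1, h2⟩ := hasFDerivAt_intervalIntegral_of_differentiableOn hΩ hab hc hd hp
  rw [h2.fderiv, ContinuousLinearMap.intervalIntegral_apply (h1.intervalIntegrable_of_Icc hab)]

/-- A series of holomorphic functions with a locally uniform summable bound is holomorphic. -/
theorem differentiableOn_tsum_of_norm_le {E : Type*} [NormedAddCommGroup E]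
    [NormedSpace ℂ E] {Ω : Set E} (hΩ : IsOpen Ω) {F : ℕ → E → ℂ} {u : ℕ → ℝ}
    (hu : Summable u) {w : E → ℝ} (hw : ContinuousOn w Ω)
    (hd : ∀ m, DifferentiableOn ℂ (F m) Ω) (hb : ∀ m, ∀ p ∈ Ω, ‖F m p‖ ≤ u m * w p) :
    DifferentiableOn ℂ (fun p => ∑' m, F m p) Ω := by
  intro p hp
  have hu0 : ∀ m, u m ≤ |u m| := fun m => le_abs_self _
  have h1 : ∀ᶠ q in 𝓝 p, |w q| < |w p| + 1 :=
    ((hw.continuousAt (hΩ.mem_nhds hp)).abs).eventually_lt continuousAt_const (by linarith)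
  obtain ⟨r, hr, hball⟩ := Metric.mem_nhds_iff.1 (inter_mem h1 (hΩ.mem_nhds hp))
  have hb' : ∀ m, ∀ q ∈ ball p r, ‖F m q‖ ≤ |u m| * (|w p| + 1) := fun m q hq => by
    refine (hb m q (hball hq).2).trans ((le_abs_self _).trans ?_)
    rw [abs_mul]
    exact mul_le_mul_of_nonneg_left (hball hq).1.le (abs_nonneg _)
  have hb2 : ∀ m, ∀ q ∈ ball p (r / 2),
      ‖fderiv ℂ (F m) q‖ ≤ 2 * (|u m| * (|w p| + 1)) / (r / 2) := fun m q hq => by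
    have hsub : ball q (r / 2) ⊆ ball p r := fun z hz => by
      rw [mem_ball] at *
      linarith [dist_triangle z q p]
    exact norm_fderiv_le_of_norm_le_ball (by positivity)
      ((hd m).mono (fun z hz => (hball (hsub hz)).2)) (fun z hz => hb' m z (hsub hz))
  have hs : Summable fun m => 2 * (|u m| * (|w p| + 1)) / (r / 2) :=
    ((hu.abs.mul_right _).mul_left 2).div_const _
  have hpm : p ∈ ball p (r / 2) := mem_ball_self (by positivity)
  refine (hasFDerivAt_tsum_of_isPreconnected (𝕜 := ℂ) (f := F) (f' := fun m q => fderiv ℂ (F m) q)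
    hs isOpen_ball
    (convex_ball p (r / 2)).isPreconnected (fun m q hq => ?_) hb2 hpm ?_
    hpm).differentiableAt.differentiableWithinAt
  · exact ((hd m).differentiableAt (hΩ.mem_nhds
      (hball (ball_subset_ball (by linarith) hq)).2)).hasFDerivAt
  · exact Summable.of_norm_bounded (hu.abs.mul_right _)
      (fun m => hb' m p (mem_ball_self hr))

/-- Cauchy's integral formula for iterated derivatives. -/
theorem iteratedDeriv_eq_circleIntegral {h : ℂ → ℂ} {c : ℂ} {r R : ℝ} (hr : 0 < r) (hrR : r < R)
    (hh : DifferentiableOn ℂ h (ball c R)) (k : ℕ) :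
    iteratedDeriv k h c = (k.factorial / (2 * Real.pi * Complex.I)) *
      ∮ z in C(c, r), (z - c)⁻¹ ^ (k + 1) * h z := by
  have h1 : DiffContOnCl ℂ h (ball c r) :=
    (hh.mono (closedBall_subset_ball hrR)).diffContOnCl_ball le_rfl
  have h2 := DiffContOnCl.circleIntegral_one_div_sub_center_pow_smul hr k h1
  have hk : (k.factorial : ℂ) ≠ 0 := by exact_mod_cast k.factorial_ne_zero
  simp only [smul_eq_mul, one_div, ← inv_pow] at h2
  rw [h2]
  field_simp [Complex.two_pi_I_ne_zero]

/-- A directional derivative is a Cauchy integral of f over a small circle in the complex line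
through the point in direction v, and such an integral depends holomorphically on the base point. -/
theorem differentiableOn_fderiv_apply {E : Type*} [NormedAddCommGroup E]
    [NormedSpace ℂ E] [ProperSpace E] {Ω : Set E} (hΩ : IsOpen Ω) {f : E → ℂ}
    (hf : DifferentiableOn ℂ f Ω) (v : E) :
    DifferentiableOn ℂ (fun p => fderiv ℂ f p v) Ω := by
  intro p hp
  obtain ⟨δ, hδ, hball⟩ := Metric.mem_nhds_iff.1 (hΩ.mem_nhds hp)
  -- Displacements z • v with |z| < 2r have norm at most δ/2, so the disc stays in the ball of
  -- radius δ around p for every base point within δ/2.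
  set r := δ / (4 * (‖v‖ + 1)) with hr
  have hv : 0 < ‖v‖ + 1 := by positivity
  have hr0 : 0 < r := by positivity
  have hrv : ∀ z : ℂ, ‖z‖ < 2 * r → ∀ q ∈ ball p (δ / 2), q + z • v ∈ ball p δ := by
    intro z hz q hq
    rw [mem_ball, dist_eq_norm] at *
    have h1 : ‖z • v‖ ≤ δ / 2 := by
      rw [norm_smul]
      calc ‖z‖ * ‖v‖ ≤ (2 * r) * (‖v‖ + 1) := by gcongr; linarith
        _ = δ / 2 := by rw [hr]; field_simp; norm_num
    calc ‖q + z • v - p‖ = ‖(q - p) + z • v‖ := by congr 1; abel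
      _ ≤ _ := norm_add_le _ _
      _ < δ := by linarith
  have hline : ∀ q ∈ ball p (δ / 2), ∀ z : ℂ, ‖z‖ < 2 * r →
      HasDerivAt (fun z : ℂ => f (q + z • v)) (fderiv ℂ f (q + z • v) v) z := by
    intro q hq z hz
    have h1 := ((hf.differentiableAt (hΩ.mem_nhds (hball (hrv z hz q hq)))).hasFDerivAt)
    have h2 : HasDerivAt (fun z : ℂ => q + z • v) v z := by
      simpa using ((hasDerivAt_id z).smul_const v).const_add q
    exact h1.comp_hasDerivAt z h2
  have hformula : ∀ q ∈ ball p (δ / 2), fderiv ℂ f q v = (1 / (2 * Real.pi * Complex.I)) *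
      ∫ θ in (0 : ℝ)..(2 * Real.pi), deriv (circleMap 0 r) θ •
        ((circleMap 0 r θ)⁻¹ ^ 2 * f (q + circleMap 0 r θ • v)) := by
    intro q hq
    have h1 := iteratedDeriv_eq_circleIntegral (h := fun z : ℂ => f (q + z • v)) (c := 0)
      (R := 2 * r) hr0 (by linarith) (fun z hz => ((hline q hq z (by simpa using hz)
        ).differentiableAt).differentiableWithinAt) 1
    rw [iteratedDeriv_one, (hline q hq 0 (by simpa using hr0)).deriv] at h1
    simpa [circleIntegral] using h1
  have hcirc : ∀ θ, circleMap 0 r θ ≠ 0 := fun θ => circleMap_ne_center hr0.ne'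
  have hnorm : ∀ θ, ‖circleMap 0 r θ‖ < 2 * r := fun θ => by
    simp [circleMap, abs_of_pos hr0]; linarith
  have hC : Continuous (circleMap 0 r) := continuous_circleMap 0 r
  have hd := differentiableOn_intervalIntegral (Ω := ball p (δ / 2)) isOpen_ball
    (F := fun q θ => deriv (circleMap 0 r) θ •
        ((circleMap 0 r θ)⁻¹ ^ 2 * f (q + circleMap 0 r θ • v)))
    (a := 0) (b := 2 * Real.pi) (by positivity) ?_ ?_
  · have hd2 := (hd p (mem_ball_self (by positivity))).differentiableAt
      (ball_mem_nhds p (by positivity : 0 < δ / 2))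
    have hd3 := hd2.const_mul (1 / (2 * Real.pi * Complex.I))
    refine (hd3.congr_of_eventuallyEq ?_).differentiableWithinAt
    filter_upwards [ball_mem_nhds p (by positivity : 0 < δ / 2)] with q hq using hformula q hq
  · have h1 : ContinuousOn (fun q : E × ℝ => f (q.1 + circleMap 0 r q.2 • v))
        (ball p (δ / 2) ×ˢ Icc 0 (2 * Real.pi)) :=
      hf.continuousOn.comp (by fun_prop) (fun q hq => hball (hrv _ (hnorm _) _ hq.1))
    simp only [deriv_circleMap, smul_eq_mul]
    refine ContinuousOn.mul (by fun_prop) (ContinuousOn.mul ?_ h1)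
    exact ((hC.comp continuous_snd).inv₀ (fun q => hcirc q.2)).pow 2 |>.continuousOn
  · intro θ _ q hq
    have h1 := (hf.differentiableAt (hΩ.mem_nhds (hball (hrv _ (hnorm θ) q hq))))
    have h2 : DifferentiableAt ℂ (fun q : E => q + circleMap 0 r θ • v) q := by fun_prop
    have h3 : DifferentiableAt ℂ (fun q : E => f (q + circleMap 0 r θ • v)) q := h1.comp q h2
    exact ((h3.const_mul _).const_smul (deriv (circleMap 0 r) θ)).differentiableWithinAt

/-- Taylor coefficients in the second variable depend holomorphically on the first one, and can be
differentiated termwise. -/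
theorem hasDerivAt_iteratedDeriv_snd {Ω : Set (ℂ × ℂ)} (hΩ : IsOpen Ω) {f : ℂ × ℂ → ℂ}
    (hf : DifferentiableOn ℂ f Ω) {t c : ℂ} (ht : (t, c) ∈ Ω) (k : ℕ) :
    HasDerivAt (fun t => iteratedDeriv k (fun s => f (t, s)) c)
      (iteratedDeriv k (fun s => fderiv ℂ f (t, s) (1, 0)) c) t := by
  obtain ⟨δ, hδ, hball⟩ := Metric.mem_nhds_iff.1 (hΩ.mem_nhds ht)
  have hmem : ∀ q ∈ ball t δ, ∀ z ∈ ball c δ, (q, z) ∈ Ω := fun q hq z hz =>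
    hball (by rw [← ball_prod_same]; exact ⟨hq, hz⟩)
  have hfor : ∀ g : ℂ × ℂ → ℂ, DifferentiableOn ℂ g Ω → ∀ q ∈ ball t δ,
      iteratedDeriv k (fun s => g (q, s)) c = (k.factorial / (2 * Real.pi * Complex.I)) *
        ∫ θ in (0 : ℝ)..(2 * Real.pi), deriv (circleMap c (δ / 2)) θ *
        ((circleMap c (δ / 2) θ - c)⁻¹ ^ (k + 1) * g (q, circleMap c (δ / 2) θ)) := by
    intro g hg q hq
    have := iteratedDeriv_eq_circleIntegral (h := fun s => g (q, s)) (c := c) (r := δ / 2) (R := δ)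
      (by linarith) (by linarith) (hg.comp (by fun_prop) (fun z hz => hmem q hq z hz)) k
    simpa [circleIntegral] using this
  have hg := differentiableOn_fderiv_apply hΩ hf (1, 0)
  have hc : ∀ θ, circleMap c (δ / 2) θ ∈ ball c δ := fun θ => by
    rw [mem_ball, dist_eq_norm]; simp [circleMap, abs_of_pos hδ]; linarith
  have hne : ∀ θ, circleMap c (δ / 2) θ - c ≠ 0 := fun θ =>
    sub_ne_zero.2 (circleMap_ne_center (by positivity))
  have hC : Continuous (circleMap c (δ / 2)) := continuous_circleMap _ _
  have hdt : ∀ q ∈ ball t δ, ∀ θ, HasDerivAt (fun q => f (q, circleMap c (δ / 2) θ))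
      (fderiv ℂ f (q, circleMap c (δ / 2) θ) (1, 0)) q := fun q hq θ => by
    have h1 := (hf.differentiableAt (hΩ.mem_nhds (hmem q hq _ (hc θ)))).hasFDerivAt
    exact h1.comp_hasDerivAt q ((hasDerivAt_id q).prodMk (hasDerivAt_const q _))
  have hF := (hasFDerivAt_intervalIntegral_of_differentiableOn (Ω := ball t δ) isOpen_ball
    (F := fun q θ => deriv (circleMap c (δ / 2)) θ *
        ((circleMap c (δ / 2) θ - c)⁻¹ ^ (k + 1) * f (q, circleMap c (δ / 2) θ)))
    (a := 0) (b := 2 * Real.pi) (by positivity) ?_ ?_ (mem_ball_self hδ))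
  · have h3 := hF.2.hasDerivAt
    have hint := hF.1.intervalIntegrable_of_Icc (μ := volume) (by positivity : 0 ≤ 2 * Real.pi)
    rw [ContinuousLinearMap.intervalIntegral_apply hint] at h3
    have h4 := h3.const_mul ((k.factorial : ℂ) / (2 * Real.pi * Complex.I))
    rw [hfor _ hg t (mem_ball_self hδ)]
    refine (h4.congr_of_eventuallyEq ?_).congr_deriv ?_
    swap
    · congr 1
      refine intervalIntegral.integral_congr fun θ _ => ?_
      have := ((hdt t (mem_ball_self hδ) θ).const_mul
        ((circleMap c (δ / 2) θ - c)⁻¹ ^ (k + 1))).const_mul (deriv (circleMap c (δ / 2)) θ)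
      simp only [this.hasFDerivAt.fderiv]
      simp
    · filter_upwards [ball_mem_nhds t hδ] with q hq using hfor f hf q hq
  · simp only [deriv_circleMap]
    refine ContinuousOn.mul (by fun_prop) (ContinuousOn.mul ?_ ?_)
    · exact ((((hC.comp continuous_snd).sub continuous_const).inv₀
        (fun q => hne q.2)).pow (k + 1)).continuousOn
    · exact hf.continuousOn.comp (by fun_prop) (fun q hq => hmem _ hq.1 _ (hc _))
  · intro θ _ q hq
    exact (((hdt q hq θ).const_mul _).const_mul _).differentiableAt.differentiableWithinAt

/-! ### Primitives and convolutions in one complex variable. -/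

/-- The primitive of a holomorphic function on a star-shaped open set. -/
theorem hasDerivAt_mul_integral_smul {S : Set ℂ} (hS : IsOpen S) (hstar : StarConvex ℝ 0 S)
    {h : ℂ → ℂ} (hh : DifferentiableOn ℂ h S) {s : ℂ} (hs : s ∈ S) :
    HasDerivAt (fun s => s * ∫ r in (0 : ℝ)..1, h (r * s)) (h s) s := by
  have hmem : ∀ z ∈ S, ∀ r ∈ Icc (0 : ℝ) 1, (r : ℂ) * z ∈ S := fun z hz r hr => by
    have := hstar.smul_mem hz hr.1 hr.2
    rwa [Complex.real_smul] at this
  have hd : ∀ z ∈ S, ∀ r ∈ Icc (0 : ℝ) 1, HasDerivAt h (deriv h (r * z)) (r * z) :=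
    fun z hz r hr => (hh.differentiableAt (hS.mem_nhds (hmem z hz r hr))).hasDerivAt
  have hd1 : ∀ z ∈ S, ∀ r ∈ Icc (0 : ℝ) 1,
      HasDerivAt (fun s => h (r * s)) (deriv h (r * z) * r) z :=
    fun z hz r hr => (hd z hz r hr).comp z (by simpa using (hasDerivAt_id z).const_mul (r : ℂ))
  have hF := hasFDerivAt_intervalIntegral_of_differentiableOn hS (F := fun s (r : ℝ) => h (r * s))
    zero_le_one (hh.continuousOn.comp (by fun_prop) (fun q hq => hmem _ hq.1 _ hq.2))
    (fun r hr z hz => (hd1 z hz r hr).differentiableAt.differentiableWithinAt) hs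
  have hint := hF.1.intervalIntegrable_of_Icc (μ := volume) zero_le_one
  have h3 := hF.2.hasDerivAt
  rw [ContinuousLinearMap.intervalIntegral_apply hint] at h3
  have hcd : ContinuousOn (fun r : ℝ => deriv h (r * s)) (Icc 0 1) :=
    ((hh.deriv hS).continuousOn.comp (by fun_prop) (fun r hr => hmem s hs r hr))
  have hch : ContinuousOn (fun r : ℝ => h (r * s)) (Icc 0 1) :=
    (hh.continuousOn.comp (by fun_prop) (fun r hr => hmem s hs r hr))
  have h4 : (∫ r in (0 : ℝ)..1, fderiv ℂ (fun s => h (r * s)) s 1)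
      = ∫ r in (0 : ℝ)..1, deriv h (r * s) * r := by
    refine intervalIntegral.integral_congr fun r hr => ?_
    rw [uIcc_of_le zero_le_one] at hr
    simp only [(hd1 s hs r hr).hasFDerivAt.fderiv]
    simp
  rw [h4] at h3
  -- Integrating d/dr (r h(rs)) over [0,1] expresses h(s) by the two terms that the product rule
  -- produces.
  have h5 : ∫ r in (0 : ℝ)..1, (h (r * s) + r * (deriv h (r * s) * s)) = 1 * h (1 * s) - 0 := by
    have := intervalIntegral.integral_eq_sub_of_hasDerivAt (a := 0) (b := 1)
      (f := fun r : ℝ => (r : ℂ) * h (r * s))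
      (f' := fun r : ℝ => h (r * s) + r * (deriv h (r * s) * s)) (fun r hr => ?_) ?_
    · simpa using this
    · rw [uIcc_of_le zero_le_one] at hr
      have e1 : HasDerivAt (fun r : ℝ => (r : ℂ)) 1 r := Complex.ofRealCLM.hasDerivAt
      have e2 : HasDerivAt (fun r : ℝ => h (r * s)) (deriv h (r * s) * s) r := by
        exact ((hd s hs r hr).comp r (e1.mul_const s)).congr_deriv (by simp)
      exact (e1.mul e2).congr_deriv (by simp)
    · refine ContinuousOn.intervalIntegrable_of_Icc zero_le_one ?_
      exact hch.add (ContinuousOn.mul (by fun_prop) (hcd.mul (by fun_prop)))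
  have h6 := (hasDerivAt_id s).mul h3
  refine h6.congr_deriv (Eq.symm ?_)
  have hi2 : IntervalIntegrable (fun r : ℝ => (r : ℂ) * (deriv h (r * s) * s)) volume 0 1 :=
    ContinuousOn.intervalIntegrable_of_Icc zero_le_one
      (ContinuousOn.mul (by fun_prop) (hcd.mul (by fun_prop)))
  rw [intervalIntegral.integral_add (hch.intervalIntegrable_of_Icc zero_le_one) hi2] at h5
  simp only [one_mul, sub_zero] at h5
  rw [← h5]
  simp only [id, one_mul]
  congr 1
  rw [← intervalIntegral.integral_const_mul]
  refine intervalIntegral.integral_congr fun r _ => ?_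
  ring

/-- The derivative of a Laplace-type convolution of holomorphic functions. -/
theorem hasDerivAt_mul_integral_mul {S : Set ℂ} (hS : IsOpen S) (hstar : StarConvex ℝ 0 S)
    {u v : ℂ → ℂ} (hu : DifferentiableOn ℂ u S) (hv : DifferentiableOn ℂ v S) {s : ℂ}
    (hs : s ∈ S) :
    HasDerivAt (fun s => s * ∫ r in (0 : ℝ)..1, u (r * s) * v ((1 - r) * s))
      (u s * v 0 + s * ∫ r in (0 : ℝ)..1, u (r * s) * deriv v ((1 - r) * s)) s := by
  have hmem : ∀ z ∈ S, ∀ r ∈ Icc (0 : ℝ) 1, (r : ℂ) * z ∈ S := fun z hz r hr => by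
    have := hstar.smul_mem hz hr.1 hr.2
    rwa [Complex.real_smul] at this
  have hmem' : ∀ z ∈ S, ∀ r ∈ Icc (0 : ℝ) 1, (1 - r : ℂ) * z ∈ S := fun z hz r hr => by
    have := hmem z hz (1 - r) ⟨by linarith [hr.2], by linarith [hr.1]⟩
    push_cast at this; exact this
  have hdu : ∀ z ∈ S, ∀ r ∈ Icc (0 : ℝ) 1, HasDerivAt u (deriv u (r * z)) (r * z) :=
    fun z hz r hr => (hu.differentiableAt (hS.mem_nhds (hmem z hz r hr))).hasDerivAt
  have hdv : ∀ z ∈ S, ∀ r ∈ Icc (0 : ℝ) 1, HasDerivAt v (deriv v ((1 - r) * z)) ((1 - r) * z) :=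
    fun z hz r hr => (hv.differentiableAt (hS.mem_nhds (hmem' z hz r hr))).hasDerivAt
  have hd1 : ∀ z ∈ S, ∀ r ∈ Icc (0 : ℝ) 1, HasDerivAt (fun s => u (r * s) * v ((1 - r) * s))
      (deriv u (r * z) * r * v ((1 - r) * z) + u (r * z) * (deriv v ((1 - r) * z) * (1 - r))) z :=
    fun z hz r hr =>
    ((hdu z hz r hr).comp z (by simpa using (hasDerivAt_id z).const_mul (r : ℂ))).mul
    ((hdv z hz r hr).comp z (by simpa using (hasDerivAt_id z).const_mul (1 - r : ℂ)))
  have cu : ContinuousOn (fun r : ℝ => u (r * s)) (Icc 0 1) :=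
    (hu.continuousOn.comp (by fun_prop) (fun r hr => hmem s hs r hr))
  have cv : ContinuousOn (fun r : ℝ => v ((1 - r) * s)) (Icc 0 1) :=
    (hv.continuousOn.comp (by fun_prop) (fun r hr => hmem' s hs r hr))
  have cu' : ContinuousOn (fun r : ℝ => deriv u (r * s)) (Icc 0 1) :=
    ((hu.deriv hS).continuousOn.comp (by fun_prop) (fun r hr => hmem s hs r hr))
  have cv' : ContinuousOn (fun r : ℝ => deriv v ((1 - r) * s)) (Icc 0 1) :=
    ((hv.deriv hS).continuousOn.comp (by fun_prop) (fun r hr => hmem' s hs r hr))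
  have cr : ContinuousOn (fun r : ℝ => (r : ℂ)) (Icc 0 1) := by fun_prop
  have cr' : ContinuousOn (fun r : ℝ => (1 - r : ℂ)) (Icc 0 1) := by fun_prop
  have cs : ContinuousOn (fun _ : ℝ => s) (Icc 0 1) := continuousOn_const
  have hF := hasFDerivAt_intervalIntegral_of_differentiableOn hS
    (F := fun s (r : ℝ) => u (r * s) * v ((1 - r) * s))
    zero_le_one ((hu.continuousOn.comp (by fun_prop) (fun q hq => hmem _ hq.1 _ hq.2)).mul
      (hv.continuousOn.comp (by fun_prop) (fun q hq => hmem' _ hq.1 _ hq.2)))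
    (fun r hr z hz => (hd1 z hz r hr).differentiableAt.differentiableWithinAt) hs
  have hint := hF.1.intervalIntegrable_of_Icc (μ := volume) zero_le_one
  have h3 := hF.2.hasDerivAt
  rw [ContinuousLinearMap.intervalIntegral_apply hint] at h3
  have h4 : (∫ r in (0 : ℝ)..1, fderiv ℂ (fun s => u (r * s) * v ((1 - r) * s)) s 1)
      = ∫ r in (0 : ℝ)..1,
        (deriv u (r * s) * r * v ((1 - r) * s) + u (r * s) * (deriv v ((1 - r) * s) * (1 - r))) := by
    refine intervalIntegral.integral_congr fun r hr => ?_
    rw [uIcc_of_le zero_le_one] at hr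
    simp only [(hd1 s hs r hr).hasFDerivAt.fderiv]
    simp
  rw [h4] at h3
  -- The derivative of r u(rs) v((1-r)s) in r integrates to the boundary value u(s) v(0). This
  -- identity moves every derivative from u to v.
  have h5 : ∫ r in (0 : ℝ)..1, (u (r * s) * v ((1 - r) * s)
      + r * (deriv u (r * s) * s * v ((1 - r) * s)
        + u (r * s) * (deriv v ((1 - r) * s) * (-s)))) = u s * v 0 := by
    have := intervalIntegral.integral_eq_sub_of_hasDerivAt (a := 0) (b := 1)
      (f := fun r : ℝ => (r : ℂ) * (u (r * s) * v ((1 - r) * s)))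
      (f' := fun r : ℝ => u (r * s) * v ((1 - r) * s)
        + r * (deriv u (r * s) * s * v ((1 - r) * s)
        + u (r * s) * (deriv v ((1 - r) * s) * (-s)))) (fun r hr => ?_) ?_
    · simpa using this
    · rw [uIcc_of_le zero_le_one] at hr
      have e1 : HasDerivAt (fun r : ℝ => (r : ℂ)) 1 r := Complex.ofRealCLM.hasDerivAt
      have e2 : HasDerivAt (fun r : ℝ => u (r * s)) (deriv u (r * s) * s) r := by
        exact ((hdu s hs r hr).comp r (e1.mul_const s)).congr_deriv (by simp)
      have e3 : HasDerivAt (fun r : ℝ => v ((1 - r) * s)) (deriv v ((1 - r) * s) * (-s)) r := by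
        exact ((hdv s hs r hr).comp r ((e1.const_sub 1).mul_const s)).congr_deriv (by simp)
      exact (e1.mul (e2.mul e3)).congr_deriv (by simp)
    · exact ContinuousOn.intervalIntegrable_of_Icc zero_le_one ((cu.mul cv).add
        (cr.mul (((cu'.mul cs).mul cv).add (cu.mul (cv'.mul cs.neg)))))
  have h6 := (hasDerivAt_id s).mul h3
  refine h6.congr_deriv (Eq.symm ?_)
  simp only [id, one_mul]
  rw [← h5, ← intervalIntegral.integral_const_mul, ← intervalIntegral.integral_const_mul,
    ← intervalIntegral.integral_add, ← intervalIntegral.integral_add]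
  · refine intervalIntegral.integral_congr fun r _ => ?_
    ring
  · exact ContinuousOn.intervalIntegrable_of_Icc zero_le_one (cu.mul cv)
  · exact ContinuousOn.intervalIntegrable_of_Icc zero_le_one (cs.mul
      (((cu'.mul cr).mul cv).add (cu.mul (cv'.mul cr'))))
  · exact ContinuousOn.intervalIntegrable_of_Icc zero_le_one ((cu.mul cv).add
        (cr.mul (((cu'.mul cs).mul cv).add (cu.mul (cv'.mul cs.neg)))))
  · exact ContinuousOn.intervalIntegrable_of_Icc zero_le_one (cs.mul (cu.mul cv'))

/-! ### Extension of periodic real-analytic functions to a complex strip. -/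

/-- Identity theorem for holomorphic functions that agree at the real points. -/
theorem eqOn_of_eq_on_reals {U : Set ℂ} (hU : IsOpen U) (hc : IsPreconnected U) {f g : ℂ → ℂ}
    (hf : DifferentiableOn ℂ f U) (hg : DifferentiableOn ℂ g U) {x : ℝ} (hx : (x : ℂ) ∈ U)
    (h : ∀ y : ℝ, (y : ℂ) ∈ U → f y = g y) : EqOn f g U := by
  refine (hf.analyticOnNhd hU).eqOn_of_preconnected_of_frequently_eq (hg.analyticOnNhd hU) hc hx ?_
  have ht : Tendsto (fun y : ℝ => (y : ℂ)) (𝓝[≠] x) (𝓝[≠] (x : ℂ)) := by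
    refine tendsto_nhdsWithin_of_tendsto_nhds_of_eventually_within _
      (Complex.continuous_ofReal.continuousAt.mono_left nhdsWithin_le_nhds) ?_
    filter_upwards [self_mem_nhdsWithin] with y hy
    simpa using hy
  refine ht.frequently (Eventually.frequently ?_)
  have : ∀ᶠ y : ℝ in 𝓝 x, (y : ℂ) ∈ U :=
    Complex.continuous_ofReal.continuousAt.eventually (hU.mem_nhds hx)
  filter_upwards [nhdsWithin_le_nhds this] with y hy using h y hy

/-- The real Taylor series, summed at complex points, converges on the complex disc of any radius
smaller than the real radius of convergence. -/
theorem AnalyticAt.exists_holomorphic_extension {f : ℝ → ℝ} {x : ℝ} (hf : AnalyticAt ℝ f x) :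
    ∃ r > 0, ∃ h : ℂ → ℂ, DifferentiableOn ℂ h (ball (x : ℂ) r) ∧
      ∀ y : ℝ, (y : ℂ) ∈ ball (x : ℂ) r → h y = f y := by
  obtain ⟨p, R, hp⟩ := hf
  obtain ⟨r, hr0, hrR⟩ := ENNReal.lt_iff_exists_nnreal_btwn.1 hp.r_pos
  have hr : (0 : ℝ) < r := by exact_mod_cast hr0
  have hsum := p.summable_norm_mul_pow (hrR.trans_le hp.r_le)
  refine ⟨r, hr, fun z => ∑' k, (z - x) ^ k * (p.coeff k : ℂ), ?_, fun y hy => ?_⟩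
  · refine Complex.differentiableOn_tsum_of_summable_norm hsum (fun k => by fun_prop) isOpen_ball
      fun k z hz => ?_
    rw [mem_ball, dist_eq_norm] at hz
    rw [norm_mul, norm_pow, Complex.norm_real, FormalMultilinearSeries.norm_apply_eq_norm_coef,
      mul_comm]
    gcongr
  · have hy' : y - x ∈ Metric.eball (0 : ℝ) R := by
      have : (y : ℂ) - x = ((y - x : ℝ) : ℂ) := by push_cast; rfl
      rw [mem_ball, dist_eq_norm, this, Complex.norm_real] at hy
      rw [Metric.mem_eball, edist_zero_right]
      refine lt_trans ?_ hrR
      rw [← ofReal_norm, ← ENNReal.ofReal_coe_nnreal, ENNReal.ofReal_lt_ofReal_iff hr]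
      exact hy
    have h1 := hp.hasSum hy'
    simp only [FormalMultilinearSeries.apply_eq_pow_smul_coeff, smul_eq_mul, add_sub_cancel] at h1
    rw [← h1.tsum_eq, Complex.ofReal_tsum]
    push_cast
    rfl

theorem isPreconnected_strip (b : ℝ) : IsPreconnected {z : ℂ | |z.im| < b} := by
  have : {z : ℂ | |z.im| < b} = Complex.imLm ⁻¹' (Ioo (-b) b) := by
    ext z; simp [abs_lt]
  rw [this]
  exact ((convex_Ioo (-b) b).linear_preimage Complex.imLm).isPreconnected

theorem isOpen_strip (b : ℝ) : IsOpen {z : ℂ | |z.im| < b} :=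
  isOpen_lt (Complex.continuous_im.abs) continuous_const

/-- A periodic real-analytic function extends holomorphically to a strip. -/
theorem exists_periodic_holomorphic_extension {f : ℝ → ℝ} (hf : AnalyticOnNhd ℝ f univ) {P : ℝ}
    (hP : 0 < P) (hper : Function.Periodic f P) :
    ∃ b > 0, ∃ g : ℂ → ℂ, DifferentiableOn ℂ g {z | |z.im| < b} ∧ (∀ x : ℝ, g x = f x) ∧
      (∀ z : ℂ, |z.im| < b → g (z + P) = g z) ∧
      (∀ z : ℂ, |z.im| < b → g (starRingEnd ℂ z) = starRingEnd ℂ (g z)) ∧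
      ∃ M, ∀ z : ℂ, |z.im| < b → ‖g z‖ ≤ M := by
  have hloc : ∀ x : ℝ, ∃ r > 0, ∃ h : ℂ → ℂ, DifferentiableOn ℂ h (ball (x : ℂ) r) ∧
      ∀ y : ℝ, (y : ℂ) ∈ ball (x : ℂ) r → h y = f y :=
    fun x => (hf x (mem_univ x)).exists_holomorphic_extension
  choose r hr h hh hhf using hloc
  have hK : IsCompact ((fun x : ℝ => (x : ℂ)) '' Icc 0 P) :=
    isCompact_Icc.image Complex.continuous_ofReal
  -- A Lebesgue number of the cover of one period gives a radius valid at every real point, after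
  -- translation by multiples of P.
  obtain ⟨δ, hδ, hcov⟩ := lebesgue_number_lemma_of_metric (c := fun x : ℝ => ball (x : ℂ) (r x)) hK
    (fun x => isOpen_ball) (fun z hz => by
      obtain ⟨x, _, rfl⟩ := hz
      exact mem_iUnion.2 ⟨x, mem_ball_self (hr x)⟩)
  have hunif : ∀ x : ℝ, ∃ h : ℂ → ℂ, DifferentiableOn ℂ h (ball (x : ℂ) δ) ∧
      ∀ y : ℝ, (y : ℂ) ∈ ball (x : ℂ) δ → h y = f y := by
    intro x
    set n := toIcoDiv hP 0 x with hn
    have hx0 : x - n * P ∈ Icc 0 P := by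
      have := sub_toIcoDiv_zsmul_mem_Ico hP 0 x
      simp only [zsmul_eq_mul, zero_add] at this
      exact ⟨this.1, this.2.le⟩
    obtain ⟨i, hi⟩ := hcov _ (mem_image_of_mem _ hx0)
    have hmap : ∀ z ∈ ball (x : ℂ) δ, z - n * P ∈ ball (i : ℂ) (r i) := fun z hz => hi (by
      rw [mem_ball, dist_eq_norm] at *
      push_cast
      convert hz using 2
      ring)
    refine ⟨fun z => h i (z - n * P), (hh i).comp (by fun_prop) hmap, fun y hy => ?_⟩
    have h1 := hhf i (y - n * P) (by push_cast; exact hmap y hy)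
    push_cast at h1
    simp only [h1]
    have := hper.sub_int_mul_eq (x := y) n
    rw [this]
  choose H hH hHf using hunif
  have hagree : ∀ (x y : ℝ) (z : ℂ), z ∈ ball (x : ℂ) δ → z ∈ ball (y : ℂ) δ → H x z = H y z := by
    intro x y z hx hy
    -- Overlapping discs with real centres share the real point Re z, from which the identity
    -- theorem spreads over their convex intersection.
    have hre : ∀ w : ℝ, z ∈ ball (w : ℂ) δ → ((z.re : ℝ) : ℂ) ∈ ball (w : ℂ) δ := fun w hw => by
      rw [mem_ball, dist_eq_norm] at *
      refine lt_of_le_of_lt ?_ hw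
      have : ((z.re : ℝ) : ℂ) - w = (((z - w).re : ℝ) : ℂ) := by simp
      rw [this, Complex.norm_real]
      exact Complex.abs_re_le_norm _
    exact eqOn_of_eq_on_reals (isOpen_ball.inter isOpen_ball)
      ((convex_ball _ _).inter (convex_ball _ _)).isPreconnected
      ((hH x).mono inter_subset_left) ((hH y).mono inter_subset_right)
      (x := z.re) ⟨hre x hx, hre y hy⟩
      (fun w hw => (hHf x w hw.1).trans (hHf y w hw.2).symm) ⟨hx, hy⟩
  have hself : ∀ z : ℂ, |z.im| < δ → z ∈ ball (z.re : ℂ) δ := fun z hz => by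
    rw [mem_ball, dist_eq_norm]
    have : z - (z.re : ℂ) = z.im * Complex.I := by
      rw [sub_eq_iff_eq_add']
      exact (Complex.re_add_im z).symm
    rw [this]; simpa using hz
  set g : ℂ → ℂ := fun z => H z.re z with hg
  have hgd : DifferentiableOn ℂ g {z | |z.im| < δ} := by
    intro z hz
    have h1 := (hH z.re).differentiableAt (isOpen_ball.mem_nhds (hself z hz))
    refine (h1.congr_of_eventuallyEq ?_).differentiableWithinAt
    filter_upwards [isOpen_ball.mem_nhds (hself z hz), (isOpen_strip δ).mem_nhds hz] with w hw hw'
    exact hagree _ _ _ (hself w hw') hw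
  have hgf : ∀ x : ℝ, g x = f x := fun x => by
    simp only [hg, Complex.ofReal_re]
    exact hHf x x (mem_ball_self hδ)
  have hzero : ((0 : ℝ) : ℂ) ∈ {z : ℂ | |z.im| < δ} := by simpa using hδ
  have hgper : ∀ z : ℂ, |z.im| < δ → g (z + P) = g z := fun z hz => by
    refine eqOn_of_eq_on_reals (isOpen_strip δ) (isPreconnected_strip δ) (f := fun z => g (z + P))
      (hgd.comp (by fun_prop) (fun w hw => ?_)) hgd hzero (fun y _ => ?_) hz
    · simpa using hw
    · have := hgf (y + P)
      push_cast at this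
      rw [this, hgf, hper y]
  have hgconj : ∀ z : ℂ, |z.im| < δ → g (starRingEnd ℂ z) = starRingEnd ℂ (g z) := fun z hz => by
    have hd : DifferentiableOn ℂ (fun z => starRingEnd ℂ (g (starRingEnd ℂ z)))
        {z | |z.im| < δ} := fun w hw => by
      have h1 : DifferentiableAt ℂ g (starRingEnd ℂ w) :=
        hgd.differentiableAt ((isOpen_strip δ).mem_nhds (by simpa using hw))
      have := h1.conj_conj
      simp only [Complex.conj_conj] at this
      exact this.differentiableWithinAt
    have := eqOn_of_eq_on_reals (isOpen_strip δ) (isPreconnected_strip δ) hd hgd hzero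
      (fun y _ => by simp [hgf]) hz
    simp only at this
    rw [← this, Complex.conj_conj]
  -- Halving the strip makes one period of its closure a compact subset of the domain, which yields
  -- the global bound M.
  refine ⟨δ / 2, by positivity, g, hgd.mono (fun z hz => ?_), hgf,
    fun z hz => hgper z (by linarith), fun z hz => hgconj z (by linarith), ?_⟩
  · have : |z.im| < δ / 2 := hz
    show |z.im| < δ
    linarith
  · have hKc : IsCompact (Icc 0 P ×ℂ Icc (-(δ / 2)) (δ / 2)) := isCompact_Icc.reProdIm isCompact_Icc
    obtain ⟨M, hM⟩ := hKc.exists_bound_of_continuousOn (hgd.continuousOn.mono (fun z hz => by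
      have h1 : |z.im| ≤ δ / 2 := abs_le.2 (Complex.mem_reProdIm.1 hz).2
      show |z.im| < δ
      linarith))
    have hpern : ∀ n : ℕ, ∀ z : ℂ, |z.im| < δ → g (z + n * P) = g z := by
      intro n
      induction n with
      | zero => simp
      | succ n ih =>
        intro z hz
        rw [← ih z hz, ← hgper (z + n * P) (by simpa using hz)]
        push_cast; congr 1; ring
    have hpernZ : ∀ n : ℤ, ∀ z : ℂ, |z.im| < δ → g (z + n * P) = g z := by
      intro n z hz
      obtain ⟨m, rfl | rfl⟩ := n.eq_nat_or_neg
      · exact_mod_cast hpern m z hz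
      · rw [← hpern m _ (by simpa using hz)]
        congr 1; push_cast; ring
    refine ⟨M, fun z hz => ?_⟩
    have := sub_toIcoDiv_zsmul_mem_Ico hP 0 z.re
    simp only [zsmul_eq_mul, zero_add] at this
    rw [← hpernZ (-toIcoDiv hP 0 z.re) z (by linarith)]
    refine hM _ (Complex.mem_reProdIm.2 ⟨?_, ?_⟩)
    · simp only [Complex.add_re, Complex.mul_re]
      simp
      exact ⟨by linarith [this.1], by linarith [this.2.le]⟩
    · simpa using ⟨(abs_lt.1 hz).1.le, (abs_lt.1 hz).2.le⟩

/-! ### The two-variable domain and the integral operators acting on it. -/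

/-- The domain `|Im t| + |Im s| < b` of `ℂ × ℂ`. -/
def biStrip (b : ℝ) : Set (ℂ × ℂ) := {p | |p.1.im| + |p.2.im| < b}

theorem isOpen_biStrip (b : ℝ) : IsOpen (biStrip b) :=
  isOpen_lt (((Complex.continuous_im.comp continuous_fst).abs).add
    ((Complex.continuous_im.comp continuous_snd).abs)) continuous_const

theorem mem_biStrip {b : ℝ} {p : ℂ × ℂ} : p ∈ biStrip b ↔ |p.1.im| + |p.2.im| < b := Iff.rfl

theorem biStrip_add_real {b : ℝ} {p : ℂ × ℂ} (hp : p ∈ biStrip b) (τ : ℝ) :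
    (p.1 + τ, p.2) ∈ biStrip b := by
  simpa [mem_biStrip] using hp

theorem biStrip_conj {b : ℝ} {p : ℂ × ℂ} (hp : p ∈ biStrip b) :
    (starRingEnd ℂ p.1, starRingEnd ℂ p.2) ∈ biStrip b := by
  simpa [mem_biStrip] using hp

/-- This is the reason for bounding the sum of the imaginary parts. Going back along a
characteristic raises |Im t| by at most (1-r)|Im s|, exactly what the contraction of s to rs
releases. -/
theorem biStrip_char {b : ℝ} {p : ℂ × ℂ} (hp : p ∈ biStrip b) {r : ℝ} (hr : r ∈ Icc (0 : ℝ) 1) :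
    (p.1 - (1 - r) * p.2, r * p.2) ∈ biStrip b := by
  have h1 : (p.1 - (1 - r : ℂ) * p.2).im = p.1.im - (1 - r) * p.2.im := by simp
  have h2 : ((r : ℂ) * p.2).im = r * p.2.im := by simp
  rw [mem_biStrip] at *
  simp only [h1, h2, abs_mul, abs_of_nonneg hr.1]
  have h3 := abs_sub p.1.im ((1 - r) * p.2.im)
  rw [abs_mul, abs_of_nonneg (by linarith [hr.2] : 0 ≤ 1 - r)] at h3
  linarith

theorem biStrip_snd {b : ℝ} {p : ℂ × ℂ} (hp : p ∈ biStrip b) {r : ℝ} (hr : r ∈ Icc (0 : ℝ) 1) :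
    (p.1, r * p.2) ∈ biStrip b := by
  have h2 : ((r : ℂ) * p.2).im = r * p.2.im := by simp
  rw [mem_biStrip] at *
  simp only [h2, abs_mul, abs_of_nonneg hr.1]
  nlinarith [abs_nonneg p.2.im, hr.2]

theorem biStrip_snd' {b : ℝ} {p : ℂ × ℂ} (hp : p ∈ biStrip b) {r : ℝ} (hr : r ∈ Icc (0 : ℝ) 1) :
    (p.1, (1 - r) * p.2) ∈ biStrip b := by
  have := biStrip_snd hp (r := 1 - r) ⟨by linarith [hr.2], by linarith [hr.1]⟩
  push_cast at this
  exact this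

/-- Convolution in the second variable. -/
noncomputable def sndConv (u v : ℂ × ℂ → ℂ) (p : ℂ × ℂ) : ℂ :=
  p.2 * ∫ r in (0 : ℝ)..1, u (p.1, r * p.2) * v (p.1, (1 - r) * p.2)

/-- Integration along the characteristics of `∂ₜ + ∂ₛ`, starting at `s = 0`. -/
noncomputable def charIntegral (F : ℂ × ℂ → ℂ) (p : ℂ × ℂ) : ℂ :=
  p.2 * ∫ r in (0 : ℝ)..1, F (p.1 - (1 - r) * p.2, r * p.2)

/-- Integration over the real translations of the first variable against a kernel on `[0, T]`. -/
noncomputable def shiftIntegral (T : ℝ) (k : ℝ → ℝ) (F : ℂ × ℂ → ℂ) (p : ℂ × ℂ) : ℂ :=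
  ∫ τ in (0 : ℝ)..T, k τ * F (p.1 + τ, p.2)

/-- Functions that are holomorphic on `biStrip b`, `T`-periodic in the first variable, and real at
real points. -/
structure Admissible (b T : ℝ) (F : ℂ × ℂ → ℂ) : Prop where
  holo : DifferentiableOn ℂ F (biStrip b)
  per : ∀ p ∈ biStrip b, F (p.1 + T, p.2) = F p
  conj : ∀ p ∈ biStrip b, F (starRingEnd ℂ p.1, starRingEnd ℂ p.2) = starRingEnd ℂ (F p)

namespace Admissible

variable {b T : ℝ} {F G : ℂ × ℂ → ℂ}

theorem zero : Admissible b T (fun _ => 0) :=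
  ⟨differentiableOn_const 0, fun _ _ => rfl, fun _ _ => by simp⟩

theorem add (hF : Admissible b T F) (hG : Admissible b T G) :
    Admissible b T (fun p => F p + G p) :=
  ⟨hF.holo.add hG.holo, fun p hp => by rw [hF.per p hp, hG.per p hp],
    fun p hp => by rw [hF.conj p hp, hG.conj p hp, map_add]⟩

theorem sub (hF : Admissible b T F) (hG : Admissible b T G) :
    Admissible b T (fun p => F p - G p) :=
  ⟨hF.holo.sub hG.holo, fun p hp => by rw [hF.per p hp, hG.per p hp],
    fun p hp => by rw [hF.conj p hp, hG.conj p hp, map_sub]⟩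

theorem const_mul (c : ℝ) (hF : Admissible b T F) : Admissible b T (fun p => c * F p) :=
  ⟨hF.holo.const_mul _, fun p hp => by rw [hF.per p hp],
    fun p hp => by rw [hF.conj p hp, map_mul, Complex.conj_ofReal]⟩

end Admissible

section Continuity

variable {b T : ℝ} {F G : ℂ × ℂ → ℂ}

theorem continuousOn_biStrip_char (hF : ContinuousOn F (biStrip b)) :
    ContinuousOn (fun q : (ℂ × ℂ) × ℝ => F (q.1.1 - (1 - q.2) * q.1.2, q.2 * q.1.2))
      (biStrip b ×ˢ Icc 0 1) :=
  hF.comp (f := fun q : (ℂ × ℂ) × ℝ => ((q.1.1 - (1 - q.2) * q.1.2, q.2 * q.1.2) : ℂ × ℂ))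
    (by fun_prop) (fun q hq => biStrip_char hq.1 hq.2)

theorem continuousOn_biStrip_snd (hF : ContinuousOn F (biStrip b)) :
    ContinuousOn (fun q : (ℂ × ℂ) × ℝ => F (q.1.1, q.2 * q.1.2)) (biStrip b ×ˢ Icc 0 1) :=
  hF.comp (f := fun q : (ℂ × ℂ) × ℝ => ((q.1.1, q.2 * q.1.2) : ℂ × ℂ))
    (by fun_prop) (fun q hq => biStrip_snd hq.1 hq.2)

theorem continuousOn_biStrip_snd' (hF : ContinuousOn F (biStrip b)) :
    ContinuousOn (fun q : (ℂ × ℂ) × ℝ => F (q.1.1, (1 - q.2) * q.1.2)) (biStrip b ×ˢ Icc 0 1) :=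
  hF.comp (f := fun q : (ℂ × ℂ) × ℝ => ((q.1.1, (1 - q.2) * q.1.2) : ℂ × ℂ))
    (by fun_prop) (fun q hq => biStrip_snd' hq.1 hq.2)

theorem continuousOn_biStrip_shift (hF : ContinuousOn F (biStrip b)) (S : Set ℝ) :
    ContinuousOn (fun q : (ℂ × ℂ) × ℝ => F (q.1.1 + q.2, q.1.2)) (biStrip b ×ˢ S) :=
  hF.comp (f := fun q : (ℂ × ℂ) × ℝ => ((q.1.1 + q.2, q.1.2) : ℂ × ℂ))
    (by fun_prop) (fun q hq => biStrip_add_real hq.1 _)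

theorem continuousOn_slice {X : Type*} [TopologicalSpace X] {f : X × ℝ → ℂ} {S : Set X} {I : Set ℝ}
    (hf : ContinuousOn f (S ×ˢ I)) {p : X} (hp : p ∈ S) : ContinuousOn (fun r => f (p, r)) I :=
  hf.comp (by fun_prop) (fun _ hr => ⟨hp, hr⟩)

theorem differentiableOn_biStrip_char (hF : DifferentiableOn ℂ F (biStrip b)) {r : ℝ}
    (hr : r ∈ Icc (0 : ℝ) 1) :
    DifferentiableOn ℂ (fun p : ℂ × ℂ => F (p.1 - (1 - r) * p.2, r * p.2)) (biStrip b) :=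
  hF.comp (f := fun p : ℂ × ℂ => ((p.1 - (1 - r) * p.2, r * p.2) : ℂ × ℂ))
    (by fun_prop) (fun p hp => biStrip_char hp hr)

theorem differentiableOn_biStrip_snd (hF : DifferentiableOn ℂ F (biStrip b)) {r : ℝ}
    (hr : r ∈ Icc (0 : ℝ) 1) :
    DifferentiableOn ℂ (fun p : ℂ × ℂ => F (p.1, r * p.2)) (biStrip b) :=
  hF.comp (f := fun p : ℂ × ℂ => ((p.1, r * p.2) : ℂ × ℂ))
    (by fun_prop) (fun p hp => biStrip_snd hp hr)

theorem differentiableOn_biStrip_snd' (hF : DifferentiableOn ℂ F (biStrip b)) {r : ℝ}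
    (hr : r ∈ Icc (0 : ℝ) 1) :
    DifferentiableOn ℂ (fun p : ℂ × ℂ => F (p.1, (1 - r) * p.2)) (biStrip b) :=
  hF.comp (f := fun p : ℂ × ℂ => ((p.1, (1 - r) * p.2) : ℂ × ℂ))
    (by fun_prop) (fun p hp => biStrip_snd' hp hr)

theorem differentiableOn_biStrip_shift (hF : DifferentiableOn ℂ F (biStrip b)) (τ : ℝ) :
    DifferentiableOn ℂ (fun p : ℂ × ℂ => F (p.1 + τ, p.2)) (biStrip b) :=
  hF.comp (f := fun p : ℂ × ℂ => ((p.1 + τ, p.2) : ℂ × ℂ))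
    (by fun_prop) (fun p hp => biStrip_add_real hp τ)

end Continuity

theorem conj_intervalIntegral (f : ℝ → ℂ) (a b : ℝ) :
    starRingEnd ℂ (∫ r in a..b, f r) = ∫ r in a..b, starRingEnd ℂ (f r) := by
  simp only [intervalIntegral, map_sub, integral_conj]

namespace Admissible

variable {b T : ℝ} {F G : ℂ × ℂ → ℂ}

theorem sndConv (hF : Admissible b T F) (hG : Admissible b T G) :
    Admissible b T (sndConv F G) := by
  refine ⟨?_, fun p hp => ?_, fun p hp => ?_⟩
  · have h1 : DifferentiableOn ℂ (fun p : ℂ × ℂ => p.2) (biStrip b) := by fun_prop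
    exact h1.mul (differentiableOn_intervalIntegral (isOpen_biStrip b) zero_le_one
      ((continuousOn_biStrip_snd hF.holo.continuousOn).mul
        (continuousOn_biStrip_snd' hG.holo.continuousOn))
      (fun _ hr => (differentiableOn_biStrip_snd hF.holo hr).mul
        (differentiableOn_biStrip_snd' hG.holo hr)))
  · simp only [_root_.sndConv]
    congr 1
    refine intervalIntegral.integral_congr fun r hr => ?_
    rw [uIcc_of_le zero_le_one] at hr
    have h1 := hF.per _ (biStrip_snd hp hr)
    have h2 := hG.per _ (biStrip_snd' hp hr)
    simp only at h1 h2
    simp only [h1, h2]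
  · simp only [_root_.sndConv]
    rw [map_mul, conj_intervalIntegral]
    congr 1
    refine intervalIntegral.integral_congr fun r hr => ?_
    rw [uIcc_of_le zero_le_one] at hr
    have h1 := hF.conj _ (biStrip_snd hp hr)
    have h2 := hG.conj _ (biStrip_snd' hp hr)
    simp only [map_mul, map_sub, map_one, Complex.conj_ofReal] at h1 h2
    simp only [map_mul, h1, h2]

theorem charIntegral (hF : Admissible b T F) : Admissible b T (charIntegral F) := by
  refine ⟨?_, fun p hp => ?_, fun p hp => ?_⟩
  · have h1 : DifferentiableOn ℂ (fun p : ℂ × ℂ => p.2) (biStrip b) := by fun_prop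
    exact h1.mul (differentiableOn_intervalIntegral (isOpen_biStrip b) zero_le_one
      (continuousOn_biStrip_char hF.holo.continuousOn) (fun _ hr => differentiableOn_biStrip_char hF.holo hr))
  · simp only [_root_.charIntegral]
    congr 1
    refine intervalIntegral.integral_congr fun r hr => ?_
    rw [uIcc_of_le zero_le_one] at hr
    have h1 := hF.per _ (biStrip_char hp hr)
    simp only at h1
    simp only [← h1]
    congr 2; ring
  · simp only [_root_.charIntegral]
    rw [map_mul, conj_intervalIntegral]
    congr 1
    refine intervalIntegral.integral_congr fun r hr => ?_
    rw [uIcc_of_le zero_le_one] at hr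
    have h1 := hF.conj _ (biStrip_char hp hr)
    simp only [map_mul, map_sub, map_one, Complex.conj_ofReal] at h1
    simp only [h1]

theorem shiftIntegral (hT : 0 ≤ T) {k : ℝ → ℝ} (hk : Continuous k) (hF : Admissible b T F) :
    Admissible b T (shiftIntegral T k F) := by
  refine ⟨?_, fun p hp => ?_, fun p hp => ?_⟩
  · refine differentiableOn_intervalIntegral (isOpen_biStrip b) hT
      (ContinuousOn.mul (by fun_prop) (continuousOn_biStrip_shift hF.holo.continuousOn _))
      (fun r _ => (differentiableOn_biStrip_shift hF.holo r).const_mul _)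
  · simp only [_root_.shiftIntegral]
    refine intervalIntegral.integral_congr fun r _ => ?_
    have h1 := hF.per _ (biStrip_add_real hp r)
    simp only at h1
    simp only [← h1]
    congr 3; ring
  · simp only [_root_.shiftIntegral]
    rw [conj_intervalIntegral]
    refine intervalIntegral.integral_congr fun r _ => ?_
    have h1 := hF.conj _ (biStrip_add_real hp r)
    simp only [map_add, Complex.conj_ofReal] at h1
    simp only [map_mul, h1, Complex.conj_ofReal]

end Admissible

/-! ### The exponential weight and the operator bounds it gives. -/

section Weight

/-- The weight for which convolution is a contraction as `κ → ∞`. -/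
noncomputable def expWeight (κ : ℝ) (s : ℂ) : ℝ := Real.exp (κ * ‖s‖) / (1 + κ * ‖s‖) ^ 2

theorem expWeight_pos {κ : ℝ} (hκ : 0 ≤ κ) (s : ℂ) : 0 < expWeight κ s := by
  unfold expWeight; positivity

theorem expWeight_le {κ : ℝ} (hκ : 0 ≤ κ) (s : ℂ) : expWeight κ s ≤ Real.exp (κ * ‖s‖) := by
  unfold expWeight
  have : 0 ≤ κ * ‖s‖ := by positivity
  exact div_le_self (Real.exp_pos _).le (by nlinarith)

theorem one_add_sq_le_exp {x : ℝ} (hx : 0 ≤ x) : (1 + x) ^ 2 ≤ 4 * Real.exp x := by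
  have h1 : 1 + x ≤ 2 * Real.exp (x / 2) := by
    have := Real.add_one_le_exp (x / 2)
    linarith
  calc (1 + x) ^ 2 ≤ (2 * Real.exp (x / 2)) ^ 2 := by gcongr
    _ = 4 * Real.exp x := by
      rw [mul_pow, ← Real.exp_nat_mul]; norm_num; ring_nf

theorem one_le_expWeight {κ : ℝ} (hκ : 0 ≤ κ) (s : ℂ) : 1 ≤ 4 * expWeight κ s := by
  unfold expWeight
  have h := one_add_sq_le_exp (x := κ * ‖s‖) (by positivity)
  rw [← mul_div_assoc, le_div_iff₀ (by positivity)]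
  linarith

theorem continuous_expWeight {κ : ℝ} (hκ : 0 ≤ κ) : Continuous (expWeight κ) := by
  unfold expWeight
  refine Continuous.div (by fun_prop) (by fun_prop) (fun s => ?_)
  positivity

/-- With A and B the two bases, A + B = 2 + x, and (A+B)² ≤ 2(A²+B²) gives 1/(A²B²) ≤ 2(A+B)⁻²(A⁻² +
B⁻²). After multiplication by x each summand integrates to at most 1. Thus the inverse-square factor
of the weight is reproduced by convolution up to a constant. -/
theorem integral_inv_sq_mul_inv_sq_le {x : ℝ} (hx : 0 ≤ x) :
    x * ∫ r in (0 : ℝ)..1, ((1 + r * x) ^ 2)⁻¹ * ((1 + (1 - r) * x) ^ 2)⁻¹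
      ≤ 4 * ((1 + x) ^ 2)⁻¹ := by
  have p1 : ∀ r ∈ Icc (0 : ℝ) 1, 0 < 1 + r * x := fun r hr => by
    have := mul_nonneg hr.1 hx; linarith
  have p2 : ∀ r ∈ Icc (0 : ℝ) 1, 0 < 1 + (1 - r) * x := fun r hr => by
    have := mul_nonneg (sub_nonneg.2 hr.2) hx; linarith
  have c1 : ContinuousOn (fun r : ℝ => ((1 + r * x) ^ 2)⁻¹) (Icc 0 1) :=
    ContinuousOn.inv₀ (by fun_prop) (fun r hr => (pow_pos (p1 r hr) 2).ne')
  have c2 : ContinuousOn (fun r : ℝ => ((1 + (1 - r) * x) ^ 2)⁻¹) (Icc 0 1) :=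
    ContinuousOn.inv₀ (by fun_prop) (fun r hr => (pow_pos (p2 r hr) 2).ne')
  have i1 := c1.intervalIntegrable_of_Icc (μ := volume) zero_le_one
  have i2 := c2.intervalIntegrable_of_Icc (μ := volume) zero_le_one
  have e1 : x * ∫ r in (0 : ℝ)..1, ((1 + r * x) ^ 2)⁻¹ ≤ 1 := by
    rw [← intervalIntegral.integral_const_mul]
    have := intervalIntegral.integral_eq_sub_of_hasDerivAt (a := 0) (b := 1)
      (f := fun r : ℝ => -(1 + r * x)⁻¹) (f' := fun r : ℝ => x * ((1 + r * x) ^ 2)⁻¹)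
      (fun r hr => ?_) (i1.const_mul x)
    · rw [this]
      simp only [one_mul, zero_mul, add_zero, inv_one]
      have : 0 < (1 + x)⁻¹ := by positivity
      linarith
    · rw [uIcc_of_le zero_le_one] at hr
      have h0 : HasDerivAt (fun r : ℝ => 1 + r * x) x r := by
        simpa using ((hasDerivAt_id r).mul_const x).const_add 1
      exact ((h0.inv (p1 r hr).ne').neg).congr_deriv (by rw [neg_div, neg_neg, div_eq_mul_inv])
  have e2 : ∫ r in (0 : ℝ)..1, ((1 + (1 - r) * x) ^ 2)⁻¹ = ∫ r in (0 : ℝ)..1, ((1 + r * x) ^ 2)⁻¹ := by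
    have := intervalIntegral.integral_comp_sub_left (a := 0) (b := 1)
      (fun r : ℝ => ((1 + r * x) ^ 2)⁻¹) 1
    simpa using this
  have hpt : ∫ r in (0 : ℝ)..1, ((1 + r * x) ^ 2)⁻¹ * ((1 + (1 - r) * x) ^ 2)⁻¹
      ≤ ∫ r in (0 : ℝ)..1, 2 * ((2 + x) ^ 2)⁻¹ *
        (((1 + r * x) ^ 2)⁻¹ + ((1 + (1 - r) * x) ^ 2)⁻¹) := by
    refine intervalIntegral.integral_mono_on zero_le_one
      ((c1.mul c2).intervalIntegrable_of_Icc zero_le_one) ((i1.add i2).const_mul _) fun r hr => ?_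
    set A := 1 + r * x with hA
    set B := 1 + (1 - r) * x with hB
    have hA0 : 0 < A := p1 r hr
    have hB0 : 0 < B := p2 r hr
    have hs : 2 + x = A + B := by rw [hA, hB]; ring
    rw [hs]
    have : 2 * ((A + B) ^ 2)⁻¹ * ((A ^ 2)⁻¹ + (B ^ 2)⁻¹)
        = (2 * (A ^ 2 + B ^ 2) / (A + B) ^ 2) * ((A ^ 2)⁻¹ * (B ^ 2)⁻¹) := by
      field_simp
      ring
    rw [this]
    refine le_mul_of_one_le_left (by positivity) ?_
    rw [le_div_iff₀ (by positivity)]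
    nlinarith [sq_nonneg (A - B)]
  calc x * ∫ r in (0 : ℝ)..1, ((1 + r * x) ^ 2)⁻¹ * ((1 + (1 - r) * x) ^ 2)⁻¹
      ≤ x * ∫ r in (0 : ℝ)..1, 2 * ((2 + x) ^ 2)⁻¹ *
        (((1 + r * x) ^ 2)⁻¹ + ((1 + (1 - r) * x) ^ 2)⁻¹) := by gcongr
    _ = 4 * ((2 + x) ^ 2)⁻¹ * (x * ∫ r in (0 : ℝ)..1, ((1 + r * x) ^ 2)⁻¹) := by
      rw [intervalIntegral.integral_const_mul, intervalIntegral.integral_add i1 i2, e2]; ring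
    _ ≤ 4 * ((2 + x) ^ 2)⁻¹ * 1 := by gcongr
    _ ≤ 4 * ((1 + x) ^ 2)⁻¹ := by
      rw [mul_one]; gcongr; norm_num

end Weight

section Bounds

variable {b T κ A B : ℝ} {F G : ℂ × ℂ → ℂ}

/-- The source of the gain 1/κ: the length |s| of the path equals (κ|s|)/κ, and the factor κ|s| is
absorbed by the integral of the two inverse squares. -/
theorem norm_integral_le_of_weight {φ : ℝ → ℂ} {κ C : ℝ} (hκ : 0 < κ) (hC : 0 ≤ C) (s : ℂ)
    (h : ∀ r ∈ Icc (0 : ℝ) 1, ‖φ r‖ ≤ C * (Real.exp (κ * ‖s‖) *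
      (((1 + r * (κ * ‖s‖)) ^ 2)⁻¹ * ((1 + (1 - r) * (κ * ‖s‖)) ^ 2)⁻¹))) :
    ‖s * ∫ r in (0 : ℝ)..1, φ r‖ ≤ 4 / κ * C * expWeight κ s := by
  set x := κ * ‖s‖ with hx
  have hx0 : 0 ≤ x := by positivity
  have p1 : ∀ r ∈ Icc (0 : ℝ) 1, 0 < 1 + r * x := fun r hr => by
    have := mul_nonneg hr.1 hx0; linarith
  have p2 : ∀ r ∈ Icc (0 : ℝ) 1, 0 < 1 + (1 - r) * x := fun r hr => by
    have := mul_nonneg (sub_nonneg.2 hr.2) hx0; linarith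
  have c1 : ContinuousOn (fun r : ℝ => ((1 + r * x) ^ 2)⁻¹) (Icc 0 1) :=
    ContinuousOn.inv₀ (by fun_prop) (fun r hr => (pow_pos (p1 r hr) 2).ne')
  have c2 : ContinuousOn (fun r : ℝ => ((1 + (1 - r) * x) ^ 2)⁻¹) (Icc 0 1) :=
    ContinuousOn.inv₀ (by fun_prop) (fun r hr => (pow_pos (p2 r hr) 2).ne')
  have i := ((c1.mul c2).intervalIntegrable_of_Icc (μ := volume) zero_le_one)
  have h1 := intervalIntegral.norm_integral_le_of_norm_le (μ := volume) (zero_le_one' ℝ)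
    (Eventually.of_forall fun r (hr : r ∈ Ioc 0 1) => h r (Ioc_subset_Icc_self hr))
    ((i.const_mul (Real.exp x)).const_mul C)
  simp only [intervalIntegral.integral_const_mul] at h1
  have h2 := integral_inv_sq_mul_inv_sq_le hx0
  have hs : ‖s‖ = x / κ := by rw [hx]; field_simp
  rw [norm_mul, hs]
  have hE : expWeight κ s = Real.exp x * ((1 + x) ^ 2)⁻¹ := by
    rw [expWeight, ← hx, div_eq_mul_inv]
  rw [hE]
  calc x / κ * ‖∫ r in (0 : ℝ)..1, φ r‖ ≤ x / κ * (C * (Real.exp x *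
        ∫ r in (0 : ℝ)..1, ((1 + r * x) ^ 2)⁻¹ * ((1 + (1 - r) * x) ^ 2)⁻¹)) := by gcongr
    _ = 1 / κ * C * Real.exp x * (x *
        ∫ r in (0 : ℝ)..1, ((1 + r * x) ^ 2)⁻¹ * ((1 + (1 - r) * x) ^ 2)⁻¹) := by ring
    _ ≤ 1 / κ * C * Real.exp x * (4 * ((1 + x) ^ 2)⁻¹) := by gcongr
    _ = _ := by ring

theorem norm_sndConv_le (hκ : 0 < κ) (hA : 0 ≤ A) (hB : 0 ≤ B)
    (hFb : ∀ p ∈ biStrip b, ‖F p‖ ≤ A * expWeight κ p.2)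
    (hGb : ∀ p ∈ biStrip b, ‖G p‖ ≤ B * expWeight κ p.2) {p : ℂ × ℂ} (hp : p ∈ biStrip b) :
    ‖sndConv F G p‖ ≤ 4 / κ * (A * B) * expWeight κ p.2 := by
  refine norm_integral_le_of_weight hκ (by positivity) p.2 fun r hr => ?_
  rw [norm_mul]
  have h1 := hFb _ (biStrip_snd hp hr)
  have h2 := hGb _ (biStrip_snd' hp hr)
  have n1 : ‖(r : ℂ) * p.2‖ = r * ‖p.2‖ := by
    rw [norm_mul, Complex.norm_real, Real.norm_of_nonneg hr.1]
  have n2 : ‖(1 - r : ℂ) * p.2‖ = (1 - r) * ‖p.2‖ := by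
    rw [norm_mul, ← Complex.ofReal_one, ← Complex.ofReal_sub, Complex.norm_real,
      Real.norm_of_nonneg (sub_nonneg.2 hr.2)]
  simp only [expWeight, n1, n2] at h1 h2
  refine (mul_le_mul h1 h2 (norm_nonneg _) (by positivity)).trans_eq ?_
  have : Real.exp (κ * ‖p.2‖) = Real.exp (κ * (r * ‖p.2‖)) * Real.exp (κ * ((1 - r) * ‖p.2‖)) := by
    rw [← Real.exp_add]; ring_nf
  rw [this, div_eq_mul_inv, div_eq_mul_inv]
  ring_nf

/-- Only one weight is present here, at rs. The second inverse square is bought with the unused part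
of the exponential, through (1+y)² ≤ 4eʸ at y = (1-r)κ|s|, which costs the extra factor 4. -/
theorem norm_charIntegral_le (hκ : 0 < κ) (hA : 0 ≤ A)
    (hFb : ∀ p ∈ biStrip b, ‖F p‖ ≤ A * expWeight κ p.2) {p : ℂ × ℂ} (hp : p ∈ biStrip b) :
    ‖charIntegral F p‖ ≤ 16 / κ * A * expWeight κ p.2 := by
  have : 16 / κ * A * expWeight κ p.2 = 4 / κ * (4 * A) * expWeight κ p.2 := by ring
  rw [this]
  refine norm_integral_le_of_weight hκ (by positivity) p.2 fun r hr => ?_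
  have h1 := hFb _ (biStrip_char hp hr)
  have n1 : ‖(r : ℂ) * p.2‖ = r * ‖p.2‖ := by
    rw [norm_mul, Complex.norm_real, Real.norm_of_nonneg hr.1]
  simp only [expWeight, n1] at h1
  refine h1.trans ?_
  have h2 := one_add_sq_le_exp (x := (1 - r) * (κ * ‖p.2‖))
    (mul_nonneg (sub_nonneg.2 hr.2) (by positivity))
  have h3 : Real.exp (κ * (r * ‖p.2‖)) ≤ 4 * Real.exp (κ * ‖p.2‖) *
      ((1 + (1 - r) * (κ * ‖p.2‖)) ^ 2)⁻¹ := by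
    have hpos : 0 < 1 + (1 - r) * (κ * ‖p.2‖) := by
      have := mul_nonneg (sub_nonneg.2 hr.2) (by positivity : 0 ≤ κ * ‖p.2‖)
      linarith
    rw [← div_eq_mul_inv, le_div_iff₀ (by positivity)]
    have : Real.exp (κ * ‖p.2‖)
        = Real.exp (κ * (r * ‖p.2‖)) * Real.exp ((1 - r) * (κ * ‖p.2‖)) := by
      rw [← Real.exp_add]; ring_nf
    rw [this]
    nlinarith [Real.exp_pos (κ * (r * ‖p.2‖))]
  rw [div_eq_mul_inv]
  calc A * (Real.exp (κ * (r * ‖p.2‖)) * ((1 + κ * (r * ‖p.2‖)) ^ 2)⁻¹)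
      ≤ A * ((4 * Real.exp (κ * ‖p.2‖) * ((1 + (1 - r) * (κ * ‖p.2‖)) ^ 2)⁻¹)
        * ((1 + κ * (r * ‖p.2‖)) ^ 2)⁻¹) := by gcongr
    _ = _ := by ring_nf

theorem norm_shiftIntegral_le {k : ℝ → ℝ} {c : ℝ} (hT : 0 ≤ T)
    (hc : ∀ τ ∈ Icc 0 T, |k τ| ≤ c)
    (hFb : ∀ p ∈ biStrip b, ‖F p‖ ≤ A * expWeight κ p.2) {p : ℂ × ℂ} (hp : p ∈ biStrip b) :
    ‖shiftIntegral T k F p‖ ≤ c * T * A * expWeight κ p.2 := by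
  have := intervalIntegral.norm_integral_le_of_norm_le_const (a := 0) (b := T)
    (f := fun τ : ℝ => k τ * F (p.1 + τ, p.2)) (C := c * (A * expWeight κ p.2)) fun τ hτ => ?_
  · rw [sub_zero, abs_of_nonneg hT] at this
    exact this.trans_eq (by ring)
  · rw [uIoc_of_le hT] at hτ
    have h1 := hc τ (Ioc_subset_Icc_self hτ)
    rw [norm_mul, Complex.norm_real, Real.norm_eq_abs]
    exact mul_le_mul h1 (hFb _ (biStrip_add_real hp τ)) (norm_nonneg _) ((abs_nonneg _).trans h1)

end Bounds

/-! ### Linearity of the integral operators. -/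

section Linearity

variable {b T : ℝ} {F G U V : ℂ × ℂ → ℂ} {p : ℂ × ℂ}

theorem intervalIntegrable_biStrip_char (hF : ContinuousOn F (biStrip b)) (hp : p ∈ biStrip b) :
    IntervalIntegrable (fun r : ℝ => F (p.1 - (1 - r) * p.2, r * p.2)) volume 0 1 :=
  (continuousOn_slice (continuousOn_biStrip_char hF) hp).intervalIntegrable_of_Icc zero_le_one

theorem continuousOn_shift_slice (hF : ContinuousOn F (biStrip b)) (hp : p ∈ biStrip b) :
    Continuous (fun τ : ℝ => F (p.1 + τ, p.2)) :=
  continuousOn_univ.1 (continuousOn_slice (continuousOn_biStrip_shift hF univ) hp)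

theorem intervalIntegrable_biStrip_shift {k : ℝ → ℝ} (hk : Continuous k)
    (hF : ContinuousOn F (biStrip b)) (hp : p ∈ biStrip b) (c d : ℝ) :
    IntervalIntegrable (fun τ : ℝ => (k τ : ℂ) * F (p.1 + τ, p.2)) volume c d :=
  ((Complex.continuous_ofReal.comp hk).mul (continuousOn_shift_slice hF hp)).intervalIntegrable _ _

theorem intervalIntegrable_biStrip_conv (hF : ContinuousOn F (biStrip b))
    (hG : ContinuousOn G (biStrip b)) (hp : p ∈ biStrip b) :
    IntervalIntegrable (fun r : ℝ => F (p.1, r * p.2) * G (p.1, (1 - r) * p.2)) volume 0 1 :=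
  ((continuousOn_slice (continuousOn_biStrip_snd hF) hp).mul
    (continuousOn_slice (continuousOn_biStrip_snd' hG) hp)).intervalIntegrable_of_Icc zero_le_one

theorem charIntegral_sub (hF : ContinuousOn F (biStrip b)) (hG : ContinuousOn G (biStrip b))
    (hp : p ∈ biStrip b) :
    charIntegral (fun q => F q - G q) p = charIntegral F p - charIntegral G p := by
  simp only [charIntegral]
  rw [intervalIntegral.integral_sub (intervalIntegrable_biStrip_char hF hp)
    (intervalIntegrable_biStrip_char hG hp), mul_sub]

theorem charIntegral_congr (h : ∀ q ∈ biStrip b, F q = G q) (hp : p ∈ biStrip b) :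
    charIntegral F p = charIntegral G p := by
  simp only [charIntegral]
  congr 1
  refine intervalIntegral.integral_congr fun r hr => ?_
  rw [uIcc_of_le zero_le_one] at hr
  exact h _ (biStrip_char hp hr)

theorem shiftIntegral_congr {k : ℝ → ℝ} (h : ∀ q ∈ biStrip b, F q = G q) (hp : p ∈ biStrip b) :
    shiftIntegral T k F p = shiftIntegral T k G p := by
  simp only [shiftIntegral]
  refine intervalIntegral.integral_congr fun r _ => ?_
  simp only [h _ (biStrip_add_real hp r)]

theorem shiftIntegral_sub {k : ℝ → ℝ} (hk : Continuous k) (hF : ContinuousOn F (biStrip b))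
    (hG : ContinuousOn G (biStrip b)) (hp : p ∈ biStrip b) :
    shiftIntegral T k (fun q => F q - G q) p = shiftIntegral T k F p - shiftIntegral T k G p := by
  simp only [shiftIntegral]
  rw [← intervalIntegral.integral_sub (intervalIntegrable_biStrip_shift hk hF hp _ _)
    (intervalIntegrable_biStrip_shift hk hG hp _ _)]
  simp only [mul_sub]

theorem shiftIntegral_add {k : ℝ → ℝ} (hk : Continuous k) (hF : ContinuousOn F (biStrip b))
    (hG : ContinuousOn G (biStrip b)) (hp : p ∈ biStrip b) :
    shiftIntegral T k (fun q => F q + G q) p = shiftIntegral T k F p + shiftIntegral T k G p := by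
  simp only [shiftIntegral]
  rw [← intervalIntegral.integral_add (intervalIntegrable_biStrip_shift hk hF hp _ _)
    (intervalIntegrable_biStrip_shift hk hG hp _ _)]
  simp only [mul_add]

theorem shiftIntegral_const_mul {k : ℝ → ℝ} (c : ℂ) :
    shiftIntegral T k (fun q => c * F q) p = c * shiftIntegral T k F p := by
  simp only [shiftIntegral]
  rw [← intervalIntegral.integral_const_mul]
  refine intervalIntegral.integral_congr fun r _ => ?_
  ring

theorem sndConv_self_sub (hU : ContinuousOn U (biStrip b)) (hV : ContinuousOn V (biStrip b))
    (hp : p ∈ biStrip b) :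
    sndConv U U p - sndConv V V p
      = sndConv (fun q => U q - V q) U p + sndConv V (fun q => U q - V q) p := by
  simp only [sndConv]
  rw [← mul_sub, ← mul_add, ← intervalIntegral.integral_sub
    (intervalIntegrable_biStrip_conv hU hU hp) (intervalIntegrable_biStrip_conv hV hV hp),
    ← intervalIntegral.integral_add (intervalIntegrable_biStrip_conv (F := fun q => U q - V q) (hU.sub hV) hU hp)
    (intervalIntegrable_biStrip_conv (G := fun q => U q - V q) hV (hU.sub hV) hp)]
  congr 1
  refine intervalIntegral.integral_congr fun r _ => ?_
  ring

end Linearity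

/-! ### The integral equation and its solution by contraction. -/

/-- The kernel of the mean-free primitive of `T`-periodic functions. -/
noncomputable def primKernel (T : ℝ) (τ : ℝ) : ℝ := τ / T - 1 / 2

theorem continuous_primKernel (T : ℝ) : Continuous (primKernel T) := by
  unfold primKernel; fun_prop

theorem abs_primKernel_le {T : ℝ} (hT : 0 < T) {τ : ℝ} (hτ : τ ∈ Icc 0 T) :
    |primKernel T τ| ≤ 1 / 2 := by
  unfold primKernel
  have h1 : 0 ≤ τ / T := div_nonneg hτ.1 hT.le
  have h2 : τ / T ≤ 1 := (div_le_one hT).2 hτ.2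
  rw [abs_le]; constructor <;> linarith

/-- The quadratic nonlinearity of the Borel-transformed equation. -/
noncomputable def borelForce (a : ℝ) (U : ℂ × ℂ → ℂ) (p : ℂ × ℂ) : ℂ :=
  ((2 * a : ℝ) : ℂ) * U p + sndConv U U p

/-- The integral operator whose fixed point is the Borel transform of the formal solution. -/
noncomputable def borelMap (a T : ℝ) (U₀ U : ℂ × ℂ → ℂ) (p : ℂ × ℂ) : ℂ :=
  U₀ p - charIntegral (shiftIntegral T (primKernel T) (borelForce a U)) p
    - (((2 * a)⁻¹ : ℝ) : ℂ) * shiftIntegral T (fun _ => T⁻¹) (sndConv U U) p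

section FixedPoint

variable {a b T κ ρ A d : ℝ} {U V U₀ : ℂ × ℂ → ℂ}

theorem Admissible.borelForce (hU : Admissible b T U) : Admissible b T (borelForce a U) :=
  (hU.const_mul _).add (hU.sndConv hU)

theorem Admissible.borelMap (hT : 0 ≤ T) (hU₀ : Admissible b T U₀) (hU : Admissible b T U) :
    Admissible b T (borelMap a T U₀ U) :=
  (hU₀.sub (hU.borelForce.shiftIntegral hT (continuous_primKernel T)).charIntegral).sub
    (((hU.sndConv hU).shiftIntegral hT continuous_const).const_mul _)

/-- A bound for the Lipschitz constant of `borelMap`, up to the factor `κ⁻¹`. -/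
noncomputable def borelConst (a T ρ : ℝ) : ℝ := 8 * T * (2 * a + 8 * ρ) + 4 * ρ / a

/-- Every occurrence of U passes through a characteristic integral or a convolution, and either
gains 1/κ. The linear term 2aU gains only from the former, the mean of U∗U only from the latter.
Inside the characteristic integral κ ≥ 1 suffices to drop the extra gain of the convolution. -/
theorem norm_borelMap_sub_le (ha : 0 < a) (hT : 0 < T) (hκ : 1 ≤ κ) (hρ : 0 ≤ ρ) (hd : 0 ≤ d)
    (hU : Admissible b T U) (hV : Admissible b T V)
    (hUb : ∀ p ∈ biStrip b, ‖U p‖ ≤ ρ * expWeight κ p.2)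
    (hVb : ∀ p ∈ biStrip b, ‖V p‖ ≤ ρ * expWeight κ p.2)
    (hUV : ∀ p ∈ biStrip b, ‖U p - V p‖ ≤ d * expWeight κ p.2) {p : ℂ × ℂ} (hp : p ∈ biStrip b) :
    ‖borelMap a T U₀ U p - borelMap a T U₀ V p‖
      ≤ borelConst a T ρ / κ * d * expWeight κ p.2 := by
  have hκ0 : 0 < κ := by linarith
  have cU := hU.holo.continuousOn
  have cV := hV.holo.continuousOn
  have hconv : ∀ q ∈ biStrip b, ‖sndConv U U q - sndConv V V q‖
      ≤ 8 * ρ * d / κ * expWeight κ q.2 := fun q hq => by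
    rw [sndConv_self_sub cU cV hq]
    have h1 := norm_sndConv_le (F := fun q => U q - V q) hκ0 hd hρ hUV hUb hq
    have h2 := norm_sndConv_le (G := fun q => U q - V q) hκ0 hρ hd hVb hUV hq
    refine (norm_add_le _ _).trans ((add_le_add h1 h2).trans_eq ?_)
    ring
  have hW : ∀ q : ℂ × ℂ, 0 < expWeight κ q.2 := fun q => expWeight_pos hκ0.le _
  have hforce : ∀ q ∈ biStrip b, ‖borelForce a U q - borelForce a V q‖
      ≤ (2 * a + 8 * ρ) * d * expWeight κ q.2 := fun q hq => by
    have h1 : borelForce a U q - borelForce a V q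
        = ((2 * a : ℝ) : ℂ) * (U q - V q) + (sndConv U U q - sndConv V V q) := by
      simp only [borelForce]; ring
    rw [h1]
    have h2 : ‖((2 * a : ℝ) : ℂ) * (U q - V q)‖ ≤ 2 * a * (d * expWeight κ q.2) := by
      rw [norm_mul, Complex.norm_real, Real.norm_of_nonneg (by positivity)]
      exact mul_le_mul_of_nonneg_left (hUV q hq) (by positivity)
    have h3 : 8 * ρ * d / κ * expWeight κ q.2 ≤ 8 * ρ * d * expWeight κ q.2 := by
      have := hW q
      gcongr
      exact div_le_self (by positivity) hκ
    calc _ ≤ _ := norm_add_le _ _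
      _ ≤ 2 * a * (d * expWeight κ q.2) + 8 * ρ * d * expWeight κ q.2 :=
        add_le_add h2 ((hconv q hq).trans h3)
      _ = _ := by ring
  have hFU := hU.borelForce (a := a)
  have hFV := hV.borelForce (a := a)
  have hprim : ∀ q ∈ biStrip b, ‖shiftIntegral T (primKernel T) (borelForce a U) q
      - shiftIntegral T (primKernel T) (borelForce a V) q‖
      ≤ 1 / 2 * T * ((2 * a + 8 * ρ) * d) * expWeight κ q.2 := fun q hq => by
    rw [← shiftIntegral_sub (continuous_primKernel T) hFU.holo.continuousOn
      hFV.holo.continuousOn hq]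
    exact norm_shiftIntegral_le hT.le (fun τ hτ => abs_primKernel_le hT hτ) hforce hq
  have hchar := norm_charIntegral_le (F := fun q =>
    shiftIntegral T (primKernel T) (borelForce a U) q
      - shiftIntegral T (primKernel T) (borelForce a V) q) hκ0 (by positivity) hprim hp
  rw [charIntegral_sub (hFU.shiftIntegral hT.le (continuous_primKernel T)).holo.continuousOn
    (hFV.shiftIntegral hT.le (continuous_primKernel T)).holo.continuousOn hp] at hchar
  have hmean := norm_shiftIntegral_le (F := fun q => sndConv U U q - sndConv V V q)
    (k := fun _ => T⁻¹) (c := T⁻¹) hT.le (fun τ _ => (abs_of_pos (inv_pos.2 hT)).le) hconv hp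
  rw [shiftIntegral_sub continuous_const (hU.sndConv hU).holo.continuousOn
    (hV.sndConv hV).holo.continuousOn hp] at hmean
  have hmean2 : ‖(((2 * a)⁻¹ : ℝ) : ℂ) * (shiftIntegral T (fun _ => T⁻¹) (sndConv U U) p -
      shiftIntegral T (fun _ => T⁻¹) (sndConv V V) p)‖
      ≤ (2 * a)⁻¹ * (T⁻¹ * T * (8 * ρ * d / κ) * expWeight κ p.2) := by
    rw [norm_mul, Complex.norm_real, Real.norm_of_nonneg (by positivity)]
    exact mul_le_mul_of_nonneg_left hmean (by positivity)
  have hsplit : borelMap a T U₀ U p - borelMap a T U₀ V p =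
      -(charIntegral (shiftIntegral T (primKernel T) (borelForce a U)) p
        - charIntegral (shiftIntegral T (primKernel T) (borelForce a V)) p)
      - (((2 * a)⁻¹ : ℝ) : ℂ) * (shiftIntegral T (fun _ => T⁻¹) (sndConv U U) p -
      shiftIntegral T (fun _ => T⁻¹) (sndConv V V) p) := by
    simp only [borelMap]; ring
  rw [hsplit]
  calc _ ≤ _ := norm_sub_le _ _
    _ ≤ 16 / κ * (1 / 2 * T * ((2 * a + 8 * ρ) * d)) * expWeight κ p.2
        + (2 * a)⁻¹ * (T⁻¹ * T * (8 * ρ * d / κ) * expWeight κ p.2) := by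
      rw [norm_neg]; exact add_le_add hchar hmean2
    _ = _ := by rw [borelConst]; field_simp; ring

theorem borelMap_zero (p : ℂ × ℂ) : borelMap a T U₀ (fun _ => 0) p = U₀ p := by
  have h1 : sndConv (fun _ => 0) (fun _ => 0) = fun _ => (0 : ℂ) := by
    ext q; simp [sndConv]
  have h2 : borelForce a (fun _ => 0) = fun _ => (0 : ℂ) := by
    ext q; simp [borelForce, h1]
  simp [borelMap, h1, h2, shiftIntegral, charIntegral]

/-- Existence of the Borel transform as a fixed point of `borelMap`. -/
theorem exists_borelMap_fixedPoint (ha : 0 < a) (hT : 0 < T) (hU₀ : Admissible b T U₀)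
    (hA : 0 ≤ A) (hU₀b : ∀ p ∈ biStrip b, ‖U₀ p‖ ≤ A) :
    ∃ κ > 0, ∃ ρ > 0, ∃ U, Admissible b T U ∧
      (∀ p ∈ biStrip b, ‖U p‖ ≤ ρ * Real.exp (κ * ‖p.2‖)) ∧
      ∀ p ∈ biStrip b, borelMap a T U₀ U p = U p := by
  -- Since the weight is at least 1/4, the bound A on U₀ is at most ρ/2 times the weight. The
  -- contraction contributes the other half, so the ball of radius ρ is preserved.
  set ρ : ℝ := 8 * A + 1 with hρ
  have hρ0 : 0 < ρ := by positivity
  set C := borelConst a T ρ with hC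
  have hC0 : 0 < C := by rw [hC, borelConst]; positivity
  -- This makes the Lipschitz constant C/κ at most 1/2.
  set κ : ℝ := 2 * C + 1 with hκ
  have hκ1 : 1 ≤ κ := by linarith
  have hκ0 : 0 < κ := by linarith
  have hCκ : C / κ ≤ 1 / 2 := by rw [div_le_iff₀ hκ0]; linarith
  have hW : ∀ q : ℂ × ℂ, 0 < expWeight κ q.2 := fun q => expWeight_pos hκ0.le _
  set Φ := borelMap a T U₀ with hΦ
  have hΦsub : ∀ {U V : ℂ × ℂ → ℂ} {d : ℝ}, 0 ≤ d → Admissible b T U → Admissible b T V →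
      (∀ p ∈ biStrip b, ‖U p‖ ≤ ρ * expWeight κ p.2) →
      (∀ p ∈ biStrip b, ‖V p‖ ≤ ρ * expWeight κ p.2) →
      (∀ p ∈ biStrip b, ‖U p - V p‖ ≤ d * expWeight κ p.2) →
      ∀ p ∈ biStrip b, ‖Φ U p - Φ V p‖ ≤ d / 2 * expWeight κ p.2 := by
    intro U V d hd hU hV hUb hVb hUV p hp
    refine (norm_borelMap_sub_le ha hT hκ1 hρ0.le hd hU hV hUb hVb hUV hp).trans ?_
    have := hW p
    calc C / κ * d * expWeight κ p.2 ≤ 1 / 2 * d * expWeight κ p.2 := by gcongr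
      _ = _ := by ring
  have hz : ∀ p ∈ biStrip b, ‖(fun _ => 0 : ℂ × ℂ → ℂ) p‖ ≤ ρ * expWeight κ p.2 := fun p _ => by
    have := hW p
    simp only [norm_zero]; positivity
  have hΦb : ∀ {U : ℂ × ℂ → ℂ}, Admissible b T U →
      (∀ p ∈ biStrip b, ‖U p‖ ≤ ρ * expWeight κ p.2) →
      ∀ p ∈ biStrip b, ‖Φ U p‖ ≤ ρ * expWeight κ p.2 := by
    intro U hU hUb p hp
    have h1 := hΦsub hρ0.le hU Admissible.zero hUb hz (by simpa using hUb) p hp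
    have h2 : Φ (fun _ => 0) p = U₀ p := borelMap_zero p
    rw [h2] at h1
    have h3 : ‖U₀ p‖ ≤ ρ / 2 * expWeight κ p.2 := by
      have h4 := one_le_expWeight hκ0.le p.2
      have h5 := hU₀b p hp
      have : A * 1 ≤ A * (4 * expWeight κ p.2) := by gcongr
      nlinarith [hW p]
    calc ‖Φ U p‖ = ‖(Φ U p - U₀ p) + U₀ p‖ := by rw [sub_add_cancel]
      _ ≤ _ := norm_add_le _ _
      _ ≤ ρ / 2 * expWeight κ p.2 + ρ / 2 * expWeight κ p.2 := add_le_add h1 h3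
      _ = _ := by ring
  set u : ℕ → ℂ × ℂ → ℂ := fun m => Φ^[m] (fun _ => 0) with hu
  have hus : ∀ m, u (m + 1) = Φ (u m) := fun m => Function.iterate_succ_apply' Φ m _
  have huA : ∀ m, Admissible b T (u m) := by
    intro m
    induction m with
    | zero => exact Admissible.zero
    | succ m ih => rw [hus]; exact Admissible.borelMap hT.le hU₀ ih
  have hub : ∀ m, ∀ p ∈ biStrip b, ‖u m p‖ ≤ ρ * expWeight κ p.2 := by
    intro m
    induction m with
    | zero => exact hz
    | succ m ih => rw [hus]; exact hΦb (huA m) ih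
  have hud : ∀ m, ∀ p ∈ biStrip b, ‖u (m + 1) p - u m p‖ ≤ ρ * (1 / 2) ^ m * expWeight κ p.2 := by
    intro m
    induction m with
    | zero =>
      intro p hp
      have : u 0 p = 0 := rfl
      rw [this, sub_zero]
      simpa using hub 1 p hp
    | succ m ih =>
      intro p hp
      have : u (m + 1 + 1) p - u (m + 1) p = Φ (u (m + 1)) p - Φ (u m) p := by
        rw [← hus, ← hus]
      rw [this]
      refine (hΦsub (by positivity) (huA _) (huA _) (hub _) (hub _) ih p hp).trans_eq ?_
      rw [pow_succ]; ring
  -- The limit of the iterates is written as a telescoping series so that holomorphy follows from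
  -- the geometric bound on the increments.
  set U : ℂ × ℂ → ℂ := fun p => ∑' m, (u (m + 1) p - u m p) with hU
  have hgeo : Summable fun m : ℕ => ρ * (1 / 2 : ℝ) ^ m :=
    (summable_geometric_two).mul_left ρ
  have hlim : ∀ p ∈ biStrip b, Tendsto (fun m => u m p) atTop (𝓝 (U p)) := by
    intro p hp
    have hs : Summable fun m => u (m + 1) p - u m p :=
      Summable.of_norm_bounded (hgeo.mul_right (expWeight κ p.2)) (fun m => hud m p hp)
    have := hs.hasSum.tendsto_sum_nat
    simp only [Finset.sum_range_sub (fun m => u m p)] at this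
    have h0 : u 0 p = 0 := rfl
    simpa [h0] using this
  have hUA : Admissible b T U := by
    refine ⟨?_, fun p hp => ?_, fun p hp => ?_⟩
    · exact differentiableOn_tsum_of_norm_le (isOpen_biStrip b) hgeo
        (w := fun p => expWeight κ p.2)
        ((continuous_expWeight hκ0.le).comp continuous_snd).continuousOn
        (fun m => (huA (m + 1)).holo.sub (huA m).holo) hud
    · refine tendsto_nhds_unique (hlim _ (biStrip_add_real hp T)) ?_
      exact (hlim p hp).congr fun m => ((huA m).per p hp).symm
    · refine tendsto_nhds_unique (hlim _ (biStrip_conj hp)) ?_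
      exact ((Complex.continuous_conj.tendsto _).comp (hlim p hp)).congr
        fun m => ((huA m).conj p hp).symm
  have hUb : ∀ p ∈ biStrip b, ‖U p‖ ≤ ρ * expWeight κ p.2 := fun p hp =>
    le_of_tendsto (hlim p hp).norm (Eventually.of_forall fun m => hub m p hp)
  have hUd : ∀ m, ∀ p ∈ biStrip b, ‖u m p - U p‖ ≤ 2 * ρ * (1 / 2) ^ m * expWeight κ p.2 := by
    intro m p hp
    have := dist_le_of_le_geometric_of_tendsto (1 / 2) (ρ * expWeight κ p.2) (by norm_num)
      (f := fun m => u m p) (fun n => ?_) (hlim p hp) m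
    · rw [dist_eq_norm] at this
      refine this.trans_eq ?_
      ring
    · rw [dist_eq_norm, norm_sub_rev]
      refine (hud n p hp).trans_eq (by ring)
  refine ⟨κ, hκ0, ρ, hρ0, U, hUA, fun p hp => (hUb p hp).trans ?_, fun p hp => ?_⟩
  · exact mul_le_mul_of_nonneg_left (expWeight_le hκ0.le _) hρ0.le
  · have h1 : Tendsto (fun m => Φ (u m) p) atTop (𝓝 (U p)) := by
      simp only [← hus]
      exact (tendsto_add_atTop_iff_nat 1).2 (hlim p hp)
    have h2 : Tendsto (fun m => Φ (u m) p) atTop (𝓝 (Φ U p)) := by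
      rw [tendsto_iff_norm_sub_tendsto_zero]
      refine squeeze_zero (fun _ => norm_nonneg _) (fun m => hΦsub (by positivity) (huA m) hUA
        (hub m) hUb (hUd m) p hp) ?_
      have : Tendsto (fun m : ℕ => 2 * ρ * (1 / 2 : ℝ) ^ m / 2 * expWeight κ p.2) atTop
          (𝓝 (2 * ρ * 0 / 2 * expWeight κ p.2)) :=
        (((tendsto_pow_atTop_nhds_zero_of_lt_one (by norm_num) (by norm_num)).const_mul
          (2 * ρ)).div_const 2).mul_const _
      simpa using this
    exact tendsto_nhds_unique h2 h1

end FixedPoint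

/-! ### Means, primitives and derivatives of the integral operators. -/

/-- The partial derivative in the first variable. -/
noncomputable def fstDeriv (F : ℂ × ℂ → ℂ) (p : ℂ × ℂ) : ℂ := fderiv ℂ F p (1, 0)

theorem intervalIntegral_swap_of_continuousOn {F : ℝ → ℝ → ℂ} {a b c d : ℝ} (hab : a ≤ b)
    (hcd : c ≤ d) (h : ContinuousOn (Function.uncurry F) (Icc a b ×ˢ Icc c d)) :
    ∫ x in a..b, ∫ y in c..d, F x y = ∫ y in c..d, ∫ x in a..b, F x y := by
  refine intervalIntegral_intervalIntegral_swap ?_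
  rw [uIoc_of_le hab, uIoc_of_le hcd]
  exact (h.integrableOn_compact (isCompact_Icc.prod isCompact_Icc)).mono_set
    (prod_mono Ioc_subset_Icc_self Ioc_subset_Icc_self)

section Mean

variable {b T : ℝ} {F : ℂ × ℂ → ℂ} {p : ℂ × ℂ}

/-- An integral over a full period does not depend on its starting point. -/
theorem shiftIntegral_const_shift (hF : Admissible b T F) (c : ℝ) (hp : p ∈ biStrip b) (τ : ℝ) :
    shiftIntegral T (fun _ => c) F (p.1 + τ, p.2) = shiftIntegral T (fun _ => c) F p := by
  have hper : Function.Periodic (fun x : ℝ => (c : ℂ) * F (p.1 + x, p.2)) T := fun x => by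
    have := hF.per _ (biStrip_add_real hp x)
    simp only at this
    simp only [← this]
    push_cast; congr 3; ring
  have h1 := hper.intervalIntegral_add_eq τ 0
  have h2 := intervalIntegral.integral_comp_add_left (a := 0) (b := T)
    (fun x : ℝ => (c : ℂ) * F (p.1 + x, p.2)) τ
  rw [add_zero, h1, zero_add] at h2
  simp only [shiftIntegral]
  rw [← h2]
  refine intervalIntegral.integral_congr fun r _ => ?_
  push_cast; congr 3; ring

theorem mean_mean (hT : 0 < T) (hF : Admissible b T F) (hp : p ∈ biStrip b) :
    shiftIntegral T (fun _ => T⁻¹) (shiftIntegral T (fun _ => T⁻¹) F) p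
      = shiftIntegral T (fun _ => T⁻¹) F p := by
  have : shiftIntegral T (fun _ => T⁻¹) (shiftIntegral T (fun _ => T⁻¹) F) p
      = ∫ _ in (0 : ℝ)..T, ((T⁻¹ : ℝ) : ℂ) * shiftIntegral T (fun _ => T⁻¹) F p := by
    rw [shiftIntegral]
    refine intervalIntegral.integral_congr fun r _ => ?_
    simp only [shiftIntegral_const_shift hF _ hp r]
  rw [this, intervalIntegral.integral_const, sub_zero, Complex.real_smul, ← mul_assoc,
    ← Complex.ofReal_mul, mul_inv_cancel₀ hT.ne', Complex.ofReal_one, one_mul]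

theorem integral_primKernel (T : ℝ) : ∫ τ in (0 : ℝ)..T, primKernel T τ = 0 := by
  simp only [primKernel]
  rw [intervalIntegral.integral_sub (by apply Continuous.intervalIntegrable; fun_prop)
    (by apply Continuous.intervalIntegrable; fun_prop), intervalIntegral.integral_div, integral_id]
  simp
  field_simp
  ring

/-- By Fubini the mean can be taken first. It is invariant under real shifts, so it factors out and
leaves the integral of the kernel, which is zero. -/
theorem mean_prim (hT : 0 < T) (hF : Admissible b T F) (hp : p ∈ biStrip b) :
    shiftIntegral T (fun _ => T⁻¹) (shiftIntegral T (primKernel T) F) p = 0 := by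
  have hc : Continuous (fun q : ℝ × ℝ => F (p.1 + (q.1 + q.2 : ℝ), p.2)) :=
    (continuousOn_shift_slice hF.holo.continuousOn hp).comp (continuous_fst.add continuous_snd)
  have h1 : shiftIntegral T (fun _ => T⁻¹) (shiftIntegral T (primKernel T) F) p
      = ∫ x in (0 : ℝ)..T, ∫ y in (0 : ℝ)..T,
        ((T⁻¹ : ℝ) : ℂ) * (primKernel T y * F (p.1 + (x + y : ℝ), p.2)) := by
    simp only [shiftIntegral, ← intervalIntegral.integral_const_mul]
    refine intervalIntegral.integral_congr fun x _ => ?_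
    refine intervalIntegral.integral_congr fun y _ => ?_
    push_cast; simp only [add_assoc]
  rw [h1, intervalIntegral_swap_of_continuousOn hT.le hT.le]
  · have h2 : ∀ y : ℝ, ∫ x in (0 : ℝ)..T,
        ((T⁻¹ : ℝ) : ℂ) * (primKernel T y * F (p.1 + (x + y : ℝ), p.2))
        = primKernel T y * shiftIntegral T (fun _ => T⁻¹) F p := fun y => by
      rw [← shiftIntegral_const_shift hF _ hp y]
      simp only [shiftIntegral, ← intervalIntegral.integral_const_mul]
      refine intervalIntegral.integral_congr fun x _ => ?_
      push_cast
      have : p.1 + ((x : ℂ) + y) = p.1 + y + x := by ring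
      simp only [this]; ring
    simp only [h2]
    rw [intervalIntegral.integral_mul_const, intervalIntegral.integral_ofReal,
      integral_primKernel T]
    simp
  · have := (Complex.continuous_ofReal.comp (continuous_primKernel T)).comp
      (continuous_snd (X := ℝ) (Y := ℝ))
    exact (continuous_const.mul (this.mul hc)).continuousOn

theorem mean_charIntegral (hT : 0 ≤ T) (hF : Admissible b T F) (hp : p ∈ biStrip b) :
    shiftIntegral T (fun _ => T⁻¹) (charIntegral F) p
      = charIntegral (shiftIntegral T (fun _ => T⁻¹) F) p := by
  have h1 : shiftIntegral T (fun _ => T⁻¹) (charIntegral F) p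
      = ∫ x in (0 : ℝ)..T, ∫ r in (0 : ℝ)..1,
        p.2 * (((T⁻¹ : ℝ) : ℂ) * F (p.1 - (1 - r) * p.2 + x, r * p.2)) := by
    simp only [shiftIntegral, charIntegral, ← intervalIntegral.integral_const_mul]
    refine intervalIntegral.integral_congr fun x _ => ?_
    refine intervalIntegral.integral_congr fun r _ => ?_
    have : p.1 - (1 - (r : ℂ)) * p.2 + x = p.1 + x - (1 - r) * p.2 := by ring
    simp only [this]; ring
  rw [h1, intervalIntegral_swap_of_continuousOn hT zero_le_one]
  · simp only [shiftIntegral, charIntegral, ← intervalIntegral.integral_const_mul]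
  · refine ContinuousOn.mul continuousOn_const (ContinuousOn.mul continuousOn_const ?_)
    refine hF.holo.continuousOn.comp
      (f := fun q : ℝ × ℝ => ((p.1 - (1 - q.2) * p.2 + q.1, q.2 * p.2) : ℂ × ℂ)) (by fun_prop) ?_
    intro q hq
    exact biStrip_add_real (biStrip_char hp hq.2) _

end Mean

section Derivative

variable {b T : ℝ} {F G : ℂ × ℂ → ℂ} {p : ℂ × ℂ}

theorem differentiableOn_fstDeriv (hF : DifferentiableOn ℂ F (biStrip b)) :
    DifferentiableOn ℂ (fstDeriv F) (biStrip b) :=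
  differentiableOn_fderiv_apply (isOpen_biStrip b) hF _

theorem fstDeriv_congr (h : ∀ q ∈ biStrip b, F q = G q) (hp : p ∈ biStrip b) :
    fstDeriv F p = fstDeriv G p := by
  have : F =ᶠ[𝓝 p] G := by
    filter_upwards [(isOpen_biStrip b).mem_nhds hp] with q hq using h q hq
  rw [fstDeriv, this.fderiv_eq, fstDeriv]

theorem fderiv_apply_eq_of_hasDerivAt (hF : DifferentiableAt ℂ F p) {v : ℂ × ℂ} {c : ℂ}
    (h : HasDerivAt (fun z : ℂ => F (p.1 + z * v.1, p.2 + z * v.2)) c 0) : fderiv ℂ F p v = c := by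
  have h1 : HasDerivAt (fun z : ℂ => ((p.1 + z * v.1, p.2 + z * v.2) : ℂ × ℂ)) v 0 := by
    simpa using (((hasDerivAt_id (0 : ℂ)).mul_const v.1).const_add p.1).prodMk
      (((hasDerivAt_id (0 : ℂ)).mul_const v.2).const_add p.2)
  have h2 : HasFDerivAt F (fderiv ℂ F p) (p.1 + 0 * v.1, p.2 + 0 * v.2) := by
    simpa using hF.hasFDerivAt
  exact (h2.comp_hasDerivAt (0 : ℂ) h1).unique h

theorem hasDerivAt_fst (hF : DifferentiableOn ℂ F (biStrip b)) (hp : p ∈ biStrip b) :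
    HasDerivAt (fun t => F (t, p.2)) (fstDeriv F p) p.1 :=
  ((hF.differentiableAt ((isOpen_biStrip b).mem_nhds hp)).hasFDerivAt).comp_hasDerivAt p.1
    ((hasDerivAt_id p.1).prodMk (hasDerivAt_const p.1 p.2))

theorem fstDeriv_eq_of_hasDerivAt (hF : DifferentiableOn ℂ F (biStrip b)) (hp : p ∈ biStrip b)
    {c : ℂ} (h : HasDerivAt (fun t => F (t, p.2)) c p.1) : fstDeriv F p = c :=
  (hasDerivAt_fst hF hp).unique h

theorem hasDerivAt_shift (hF : DifferentiableOn ℂ F (biStrip b)) (hp : p ∈ biStrip b) (τ : ℝ) :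
    HasDerivAt (fun τ : ℝ => F (p.1 + τ, p.2)) (fstDeriv F (p.1 + τ, p.2)) τ := by
  have h1 := hasDerivAt_fst hF (biStrip_add_real hp τ)
  have h2 : HasDerivAt (fun τ : ℝ => p.1 + (τ : ℂ)) 1 τ :=
    Complex.ofRealCLM.hasDerivAt.const_add p.1
  exact (HasDerivAt.comp (h₂ := fun t => F (t, p.2)) τ h1 h2).congr_deriv (mul_one _)

theorem fstDeriv_shiftIntegral (hT : 0 ≤ T) {k : ℝ → ℝ} (hk : Continuous k)
    (hF : DifferentiableOn ℂ F (biStrip b)) (hp : p ∈ biStrip b) :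
    fstDeriv (shiftIntegral T k F) p = shiftIntegral T k (fstDeriv F) p := by
  have h := fderiv_intervalIntegral_apply (isOpen_biStrip b) hT
    (F := fun (q : ℂ × ℂ) (τ : ℝ) => (k τ : ℂ) * F (q.1 + τ, q.2))
    (ContinuousOn.mul (by fun_prop) (continuousOn_biStrip_shift hF.continuousOn _))
    (fun r _ => (differentiableOn_biStrip_shift hF r).const_mul _) hp (1, 0)
  refine h.trans (intervalIntegral.integral_congr fun τ _ => ?_)
  refine fstDeriv_eq_of_hasDerivAt ((differentiableOn_biStrip_shift hF τ).const_mul _) hp ?_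
  have h1 := hasDerivAt_fst hF (biStrip_add_real hp τ)
  exact (h1.comp_add_const p.1 (τ : ℂ)).const_mul _

theorem fstDeriv_charIntegral (hF : DifferentiableOn ℂ F (biStrip b)) (hp : p ∈ biStrip b) :
    fstDeriv (charIntegral F) p = charIntegral (fstDeriv F) p := by
  have hd := differentiableOn_intervalIntegral (isOpen_biStrip b) zero_le_one
    (F := fun (q : ℂ × ℂ) (r : ℝ) => F (q.1 - (1 - r) * q.2, r * q.2))
    (continuousOn_biStrip_char hF.continuousOn) (fun r hr => differentiableOn_biStrip_char hF hr)
  have h := fderiv_intervalIntegral_apply (isOpen_biStrip b) zero_le_one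
    (F := fun (q : ℂ × ℂ) (r : ℝ) => F (q.1 - (1 - r) * q.2, r * q.2))
    (continuousOn_biStrip_char hF.continuousOn) (fun r hr => differentiableOn_biStrip_char hF hr)
    hp (1, 0)
  have hd2 : DifferentiableOn ℂ (fun p : ℂ × ℂ => p.2) (biStrip b) := by fun_prop
  refine fstDeriv_eq_of_hasDerivAt (hd2.mul hd) hp ?_
  have h1 := (hasDerivAt_fst hd hp).const_mul p.2
  refine h1.congr_deriv ?_
  rw [charIntegral]
  congr 1
  refine h.trans (intervalIntegral.integral_congr fun r hr => ?_)
  rw [uIcc_of_le zero_le_one] at hr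
  refine fstDeriv_eq_of_hasDerivAt (differentiableOn_biStrip_char hF hr) hp ?_
  exact (hasDerivAt_fst hF (biStrip_char hp hr)).comp_sub_const p.1 _

theorem mean_fstDeriv (hF : Admissible b T F) (hp : p ∈ biStrip b) (c : ℝ) :
    shiftIntegral T (fun _ => c) (fstDeriv F) p = 0 := by
  have hc := continuousOn_shift_slice (differentiableOn_fstDeriv hF.holo).continuousOn hp
  have := intervalIntegral.integral_eq_sub_of_hasDerivAt (a := 0) (b := T)
    (fun τ _ => hasDerivAt_shift hF.holo hp τ) (hc.intervalIntegrable _ _)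
  rw [shiftIntegral, intervalIntegral.integral_const_mul, this, hF.per p hp]
  simp

/-- Integration by parts: the kernel runs from -1/2 to 1/2, so by periodicity the boundary terms add
up to F, and its slope 1/T produces the mean. -/
theorem prim_fstDeriv (hT : 0 < T) (hF : Admissible b T F) (hp : p ∈ biStrip b) :
    shiftIntegral T (primKernel T) (fstDeriv F) p
      = F p - shiftIntegral T (fun _ => T⁻¹) F p := by
  have hc' := continuousOn_shift_slice (differentiableOn_fstDeriv hF.holo).continuousOn hp
  have hc := continuousOn_shift_slice hF.holo.continuousOn hp
  have hk : Continuous fun τ => (primKernel T τ : ℂ) :=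
    Complex.continuous_ofReal.comp (continuous_primKernel T)
  have hd : ∀ τ : ℝ, HasDerivAt (fun τ : ℝ => (primKernel T τ : ℂ) * F (p.1 + τ, p.2))
      (((T⁻¹ : ℝ) : ℂ) * F (p.1 + τ, p.2) + primKernel T τ * fstDeriv F (p.1 + τ, p.2)) τ := by
    intro τ
    have h0 : HasDerivAt (primKernel T) T⁻¹ τ := by
      exact (((hasDerivAt_id τ).div_const T).sub_const (1 / 2)).congr_deriv (by simp)
    exact (h0.ofReal_comp).mul (hasDerivAt_shift hF.holo hp τ)
  have := intervalIntegral.integral_eq_sub_of_hasDerivAt (a := 0) (b := T) (fun τ _ => hd τ)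
    (((continuous_const.mul hc).add (hk.mul hc')).intervalIntegrable _ _)
  have i1 : IntervalIntegrable (fun τ : ℝ => ((T⁻¹ : ℝ) : ℂ) * F (p.1 + τ, p.2)) volume 0 T :=
    (continuous_const.mul hc).intervalIntegrable _ _
  have i2 : IntervalIntegrable (fun τ : ℝ => (primKernel T τ : ℂ) * fstDeriv F (p.1 + τ, p.2))
      volume 0 T := (hk.mul hc').intervalIntegrable _ _
  rw [intervalIntegral.integral_add i1 i2, hF.per p hp] at this
  rw [shiftIntegral, shiftIntegral, eq_sub_iff_add_eq, add_comm, this]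
  have h1 : primKernel T T = 1 / 2 := by rw [primKernel, div_self hT.ne']; norm_num
  have h2 : primKernel T 0 = -(1 / 2) := by simp [primKernel]
  rw [h1, h2]
  push_cast
  rw [add_zero]
  ring

/-- `charIntegral F` is a primitive of `F` along the characteristics. -/
theorem fderiv_charIntegral_one_one (hF : Admissible b T F) (hp : p ∈ biStrip b) :
    fderiv ℂ (charIntegral F) p (1, 1) = F p := by
  refine fderiv_apply_eq_of_hasDerivAt
    (hF.charIntegral.holo.differentiableAt ((isOpen_biStrip b).mem_nhds hp)) ?_
  -- The characteristic through p is (ψ + σ, σ). In the variable σ the integral is a one-variable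
  -- primitive based at σ = 0, a point that lies in the domain because |Im ψ| < b.
  set ψ := p.1 - p.2 with hψ
  set S : Set ℂ := {σ | (ψ + σ, σ) ∈ biStrip b} with hS
  have hSo : IsOpen S := (isOpen_biStrip b).preimage (by fun_prop)
  have hstar : StarConvex ℝ 0 S := by
    rw [starConvex_zero_iff]
    intro σ hσ r hr0 hr1
    have hp' : |p.1.im| + |p.2.im| < b := hp
    have h1 : |ψ.im| < b := by
      have := abs_sub p.1.im p.2.im
      simp only [hψ, Complex.sub_im]; linarith
    have h2 : |(ψ + σ).im| + |σ.im| < b := hσ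
    show |(ψ + r • σ).im| + |(r • σ).im| < b
    simp only [Complex.add_im, Complex.smul_im, smul_eq_mul] at *
    have e1 : ψ.im + r * σ.im = (1 - r) * ψ.im + r * (ψ.im + σ.im) := by ring
    have h3 : |ψ.im + r * σ.im| ≤ (1 - r) * |ψ.im| + r * |ψ.im + σ.im| := by
      rw [e1]
      refine (abs_add_le _ _).trans ?_
      rw [abs_mul, abs_mul, abs_of_nonneg hr0, abs_of_nonneg (by linarith : 0 ≤ 1 - r)]
    rw [abs_mul, abs_of_nonneg hr0]
    rcases eq_or_lt_of_le hr0 with h | h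
    · subst h; simp at h3 ⊢; linarith
    · nlinarith
  have hh : DifferentiableOn ℂ (fun σ => F (ψ + σ, σ)) S :=
    hF.holo.comp (f := fun σ : ℂ => ((ψ + σ, σ) : ℂ × ℂ)) (by fun_prop) (fun σ hσ => hσ)
  have hpS : p.2 ∈ S := by
    show (ψ + p.2, p.2) ∈ biStrip b
    rw [hψ, sub_add_cancel]; exact hp
  have h1 := hasDerivAt_mul_integral_smul hSo hstar hh hpS
  have h2 : HasDerivAt (fun z : ℂ => p.2 + z * 1) 1 0 := by
    simpa using (hasDerivAt_id (0 : ℂ)).const_add p.2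
  have h3 := HasDerivAt.comp (0 : ℂ) (h₂ := fun s => s * ∫ r in (0 : ℝ)..1, F (ψ + r * s, r * s))
    (h := fun z : ℂ => p.2 + z * 1) (by simpa using h1) h2
  have h4 : F (ψ + p.2, p.2) * 1 = F p := by rw [hψ, sub_add_cancel, mul_one]
  rw [h4] at h3
  refine h3.congr_of_eventuallyEq (Eventually.of_forall fun z => ?_)
  simp only [charIntegral, Function.comp, mul_one]
  congr 1
  refine intervalIntegral.integral_congr fun r _ => ?_
  simp only [hψ]
  congr 2; ring

end Derivative

/-! ### From the fixed point to the Borel-transformed differential equation. -/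

/-- `U` is the Borel transform of the formal solution with the constant term removed: it solves the
Borel-transformed equation `(∂ₜ + ∂ₛ) ∂ₜ U + 2 a U + U ∗ U = 0` with `∂ₜ U (t, 0) = g t`. -/
structure IsBorelSolution (b T a κ ρ : ℝ) (g : ℂ → ℂ) (U : ℂ × ℂ → ℂ) : Prop where
  adm : Admissible b T U
  bound : ∀ p ∈ biStrip b, ‖U p‖ ≤ ρ * Real.exp (κ * ‖p.2‖)
  init : ∀ t : ℂ, |t.im| < b → fstDeriv U (t, 0) = g t
  pde : ∀ p ∈ biStrip b, fderiv ℂ (fstDeriv U) p (1, 1) = -borelForce a U p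

theorem abs_im_sub_lt {b : ℝ} {p : ℂ × ℂ} (hp : p ∈ biStrip b) : |(p.1 - p.2).im| < b := by
  have h1 : |p.1.im| + |p.2.im| < b := hp
  have := abs_sub p.1.im p.2.im
  simp only [Complex.sub_im]; linarith

theorem abs_im_fst_lt {b : ℝ} {p : ℂ × ℂ} (hp : p ∈ biStrip b) : |p.1.im| < b := by
  have h1 : |p.1.im| + |p.2.im| < b := hp
  linarith [abs_nonneg p.2.im]

theorem mk_zero_mem_biStrip {b : ℝ} {t : ℂ} (ht : |t.im| < b) : (t, 0) ∈ biStrip b := by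
  simpa [mem_biStrip] using ht

theorem expWeight_zero (s : ℂ) : expWeight 0 s = 1 := by simp [expWeight]

section Existence

variable {b T a : ℝ} {g : ℂ → ℂ}

theorem admissible_comp_sub (hd : DifferentiableOn ℂ g {z | |z.im| < b})
    (hper : ∀ z : ℂ, |z.im| < b → g (z + T) = g z)
    (hconj : ∀ z : ℂ, |z.im| < b → g (starRingEnd ℂ z) = starRingEnd ℂ (g z)) :
    Admissible b T (fun p => g (p.1 - p.2)) := by
  refine ⟨hd.comp (by fun_prop) (fun p hp => abs_im_sub_lt hp), fun p hp => ?_, fun p hp => ?_⟩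
  · rw [← hper _ (abs_im_sub_lt hp)]
    congr 1; ring
  · rw [← hconj _ (abs_im_sub_lt hp), map_sub]

theorem admissible_comp_fst (hd : DifferentiableOn ℂ g {z | |z.im| < b})
    (hper : ∀ z : ℂ, |z.im| < b → g (z + T) = g z)
    (hconj : ∀ z : ℂ, |z.im| < b → g (starRingEnd ℂ z) = starRingEnd ℂ (g z)) :
    Admissible b T (fun p => g p.1) :=
  ⟨hd.comp (by fun_prop) (fun p hp => abs_im_fst_lt hp), fun p hp => hper _ (abs_im_fst_lt hp),
    fun p hp => hconj _ (abs_im_fst_lt hp)⟩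

/-- The mean of g(z + ·) is holomorphic in z and vanishes for real z by periodicity, hence it
vanishes on the whole strip. -/
theorem mean_comp_sub (hb : 0 < b) (hT : 0 < T) (hd : DifferentiableOn ℂ g {z | |z.im| < b})
    (hper : ∀ z : ℂ, |z.im| < b → g (z + T) = g z)
    (hconj : ∀ z : ℂ, |z.im| < b → g (starRingEnd ℂ z) = starRingEnd ℂ (g z))
    (hmean : ∫ τ in (0 : ℝ)..T, g τ = 0) {p : ℂ × ℂ} (hp : p ∈ biStrip b) :
    shiftIntegral T (fun _ => T⁻¹) (fun p => g (p.1 - p.2)) p = 0 := by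
  have hA := admissible_comp_fst hd hper hconj
  have hM := hA.shiftIntegral (k := fun _ => T⁻¹) hT.le continuous_const
  have hdm : DifferentiableOn ℂ
      (fun z => shiftIntegral T (fun _ => T⁻¹) (fun p => g p.1) (z, 0)) {z | |z.im| < b} :=
    hM.holo.comp (f := fun z : ℂ => ((z, 0) : ℂ × ℂ)) (by fun_prop)
      (fun z hz => mk_zero_mem_biStrip hz)
  have h0 : ((0 : ℝ) : ℂ) ∈ {z : ℂ | |z.im| < b} := by simpa using hb
  have hz := eqOn_of_eq_on_reals (isOpen_strip b) (isPreconnected_strip b) hdm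
    (differentiableOn_const 0) h0 (fun y _ => by
      have h1 := shiftIntegral_const_shift hA T⁻¹ (mk_zero_mem_biStrip h0) y
      simp only [Complex.ofReal_zero, zero_add] at h1
      rw [h1]
      simp only [shiftIntegral, zero_add]
      rw [intervalIntegral.integral_const_mul, hmean, mul_zero]) (abs_im_sub_lt hp)
  simp only at hz
  rw [← hz]
  simp only [shiftIntegral]
  refine intervalIntegral.integral_congr fun τ _ => ?_
  congr 2; ring

/-- The fixed-point equation was obtained by inverting ∂ₜ, which loses information unless means
vanish. Averaging that equation recovers the zero mean of 2aU + U∗U; afterwards ∂ₜ undoes the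
primitive exactly. -/
theorem exists_isBorelSolution (ha : 0 < a) (hb : 0 < b) (hT : 0 < T)
    (hd : DifferentiableOn ℂ g {z | |z.im| < b})
    (hper : ∀ z : ℂ, |z.im| < b → g (z + T) = g z)
    (hconj : ∀ z : ℂ, |z.im| < b → g (starRingEnd ℂ z) = starRingEnd ℂ (g z))
    (hmean : ∫ τ in (0 : ℝ)..T, g τ = 0) {M : ℝ} (hM : ∀ z : ℂ, |z.im| < b → ‖g z‖ ≤ M) :
    ∃ κ > 0, ∃ ρ > 0, ∃ U, IsBorelSolution b T a κ ρ g U := by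
  have hg' := admissible_comp_sub hd hper hconj
  have hU₀ := hg'.shiftIntegral hT.le (continuous_primKernel T)
  have hM0 : 0 ≤ M := (norm_nonneg _).trans (hM 0 (by simpa using hb))
  obtain ⟨κ, hκ, ρ, hρ, U, hU, hUb, hfix⟩ := exists_borelMap_fixedPoint (A := 1 / 2 * T * M) ha hT
    hU₀ (by positivity) (fun p hp => by
      -- At κ = 0 the weight is identically 1, so the weighted estimate is a plain sup bound.
      have := norm_shiftIntegral_le (b := b) (T := T) (κ := 0) (A := M) (k := primKernel T) hT.le
        (fun τ hτ => abs_primKernel_le hT hτ) (F := fun p => g (p.1 - p.2))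
        (fun q hq => by rw [expWeight_zero, mul_one]; exact hM _ (abs_im_sub_lt hq)) hp
      rwa [expWeight_zero, mul_one] at this)
  have hC := hU.sndConv hU
  have hF := hU.borelForce (a := a)
  have hD := hF.shiftIntegral hT.le (continuous_primKernel T)
  have hMC := hC.shiftIntegral (k := fun _ => T⁻¹) hT.le continuous_const
  have hkc : Continuous fun _ : ℝ => T⁻¹ := continuous_const
  have hcI : ∀ {F : ℂ × ℂ → ℂ}, (∀ q ∈ biStrip b, F q = 0) → ∀ p ∈ biStrip b,
      charIntegral F p = 0 := fun {F} hF p hp => by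
    rw [charIntegral_congr (G := fun _ => 0) hF hp]; simp [charIntegral]
  -- the mean of the nonlinearity vanishes
  have hmeanU : ∀ p ∈ biStrip b, shiftIntegral T (fun _ => T⁻¹) U p
      = -((((2 * a)⁻¹ : ℝ) : ℂ) * shiftIntegral T (fun _ => T⁻¹) (sndConv U U) p) := by
    intro p hp
    rw [shiftIntegral_congr (fun q hq => (hfix q hq).symm) hp]
    have e1 := shiftIntegral_sub (T := T) hkc
      (hU₀.sub hD.charIntegral).holo.continuousOn
      (hMC.const_mul (2 * a)⁻¹).holo.continuousOn hp
    have e2 := shiftIntegral_sub (T := T) hkc hU₀.holo.continuousOn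
      hD.charIntegral.holo.continuousOn hp
    refine e1.trans ?_
    rw [e2, mean_prim hT hg' hp, mean_charIntegral hT.le hD hp,
      hcI (fun q hq => mean_prim hT hF hq) p hp, shiftIntegral_const_mul, mean_mean hT hC hp]
    ring
  have hmeanF : ∀ p ∈ biStrip b, shiftIntegral T (fun _ => T⁻¹) (borelForce a U) p = 0 := by
    intro p hp
    have e1 := shiftIntegral_add (T := T) hkc (hU.const_mul (2 * a)).holo.continuousOn
      hC.holo.continuousOn hp
    refine e1.trans ?_
    rw [shiftIntegral_const_mul, hmeanU p hp]
    push_cast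
    have : (a : ℂ) ≠ 0 := by exact_mod_cast ha.ne'
    field_simp
    ring
  -- Differentiating the fixed-point equation in t: on g(t-s) and on the nonlinearity, both of mean
  -- zero, ∂ₜ cancels the primitive, and the mean term has zero derivative.
  have hN : ∀ p ∈ biStrip b, fstDeriv U p = g (p.1 - p.2) - charIntegral (borelForce a U) p := by
    intro p hp
    rw [fstDeriv_congr (fun q hq => (hfix q hq).symm) hp]
    refine fstDeriv_eq_of_hasDerivAt (Admissible.borelMap hT.le hU₀ hU).holo hp ?_
    have h1 := hasDerivAt_fst hU₀.holo hp
    have h2 := hasDerivAt_fst hD.charIntegral.holo hp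
    have h3 := (hasDerivAt_fst hMC.holo hp).const_mul (((2 * a)⁻¹ : ℝ) : ℂ)
    refine ((h1.sub h2).sub h3).congr_deriv ?_
    rw [fstDeriv_shiftIntegral hT.le (continuous_primKernel T) hg'.holo hp,
      prim_fstDeriv hT hg' hp, mean_comp_sub hb hT hd hper hconj hmean hp,
      fstDeriv_shiftIntegral hT.le hkc hC.holo hp, mean_fstDeriv hC hp,
      fstDeriv_charIntegral hD.holo hp]
    rw [charIntegral_congr (G := borelForce a U) (fun q hq => ?_) hp]
    · ring
    · rw [fstDeriv_shiftIntegral hT.le (continuous_primKernel T) hF.holo hq, prim_fstDeriv hT hF hq,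
        hmeanF q hq, sub_zero]
  refine ⟨κ, hκ, ρ, hρ, U, hU, hUb, fun t ht => ?_, fun p hp => ?_⟩
  · rw [hN _ (mk_zero_mem_biStrip ht)]
    simp [charIntegral]
  -- The derivative in direction (1,1) kills g(t-s), which is constant on characteristics, and
  -- inverts the characteristic integral.
  · have hev : fstDeriv U =ᶠ[𝓝 p] fun p => g (p.1 - p.2) - charIntegral (borelForce a U) p := by
      filter_upwards [(isOpen_biStrip b).mem_nhds hp] with q hq using hN q hq
    have d1 := hg'.holo.differentiableAt ((isOpen_biStrip b).mem_nhds hp)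
    have d2 := hF.charIntegral.holo.differentiableAt ((isOpen_biStrip b).mem_nhds hp)
    rw [hev.fderiv_eq, fderiv_fun_sub d1 d2, sub_apply,
      fderiv_charIntegral_one_one hF hp, fderiv_apply_eq_of_hasDerivAt d1 (c := 0), zero_sub]
    simp only [mul_one, add_sub_add_right_eq_sub]
    exact hasDerivAt_const _ _

end Existence

/-! ### Laplace integrals. -/

/-- The Laplace integral `∫₀^∞ e^{-p r} u(r) dr`. -/
noncomputable def laplaceInt (p : ℂ) (u : ℝ → ℂ) : ℂ :=
  ∫ r : ℝ in Ioi 0, Complex.exp (-(p * r)) * u r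

section Laplace

variable {κ C D : ℝ} {p : ℂ} {u v u' : ℝ → ℂ}

theorem norm_exp_mul_le (hu : ∀ r : ℝ, 0 ≤ r → ‖u r‖ ≤ C * Real.exp (κ * r)) {r : ℝ} (hr : 0 ≤ r) :
    ‖Complex.exp (-(p * r)) * u r‖ ≤ C * Real.exp (-(p.re - κ) * r) := by
  rw [norm_mul, Complex.norm_exp]
  have h1 : (-(p * r)).re = -p.re * r := by simp
  rw [h1]
  calc Real.exp (-p.re * r) * ‖u r‖ ≤ Real.exp (-p.re * r) * (C * Real.exp (κ * r)) := by
        gcongr; exact hu r hr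
    _ = C * (Real.exp (-p.re * r) * Real.exp (κ * r)) := by ring
    _ = _ := by rw [← Real.exp_add]; ring_nf

theorem integrableOn_laplace (hp : κ < p.re) (hc : Continuous u)
    (hu : ∀ r : ℝ, 0 ≤ r → ‖u r‖ ≤ C * Real.exp (κ * r)) :
    IntegrableOn (fun r : ℝ => Complex.exp (-(p * r)) * u r) (Ioi 0) := by
  have h1 : IntegrableOn (fun r : ℝ => C * Real.exp (-(p.re - κ) * r)) (Ioi 0) :=
    (exp_neg_integrableOn_Ioi 0 (by linarith)).const_mul C
  refine Integrable.mono' h1 (by fun_prop) ?_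
  refine (ae_restrict_iff' measurableSet_Ioi).2 (Eventually.of_forall fun r hr => ?_)
  exact norm_exp_mul_le hu (le_of_lt hr)

theorem norm_laplaceInt_le (hp : κ < p.re)
    (hu : ∀ r : ℝ, 0 ≤ r → ‖u r‖ ≤ C * Real.exp (κ * r)) :
    ‖laplaceInt p u‖ ≤ C / (p.re - κ) := by
  have h1 : IntegrableOn (fun r : ℝ => C * Real.exp (-(p.re - κ) * r)) (Ioi 0) :=
    (exp_neg_integrableOn_Ioi 0 (by linarith)).const_mul C
  refine (norm_integral_le_of_norm_le h1 ?_).trans_eq ?_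
  · refine (ae_restrict_iff' measurableSet_Ioi).2 (Eventually.of_forall fun r hr => ?_)
    exact norm_exp_mul_le hu (le_of_lt hr)
  · have hne : p.re - κ ≠ 0 := by linarith
    rw [integral_const_mul, integral_exp_mul_Ioi (by linarith : -(p.re - κ) < 0) 0]
    simp only [mul_zero, Real.exp_zero]
    rw [neg_div_neg_eq, mul_one_div]

/-- Integration by parts. The boundary term at 0 is where the initial value g of ∂ₜU, and later each
term of the asymptotic expansion, comes from. -/
theorem mul_laplaceInt (hp : κ < p.re) (hd : ∀ r, HasDerivAt u (u' r) r) (hc' : Continuous u')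
    (hu : ∀ r : ℝ, 0 ≤ r → ‖u r‖ ≤ C * Real.exp (κ * r))
    (hu' : ∀ r : ℝ, 0 ≤ r → ‖u' r‖ ≤ D * Real.exp (κ * r)) :
    p * laplaceInt p u = u 0 + laplaceInt p u' := by
  have hc : Continuous u := continuous_iff_continuousAt.2 fun r => (hd r).continuousAt
  have i1 := integrableOn_laplace hp hc hu
  have i2 := integrableOn_laplace hp hc' hu'
  have hderiv : ∀ r : ℝ, HasDerivAt (fun r : ℝ => -(Complex.exp (-(p * r)) * u r))
      (p * (Complex.exp (-(p * r)) * u r) - Complex.exp (-(p * r)) * u' r) r := by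
    intro r
    have h1 : HasDerivAt (fun r : ℝ => -(p * (r : ℂ))) (-p) r := by
      exact (((Complex.ofRealCLM.hasDerivAt (x := r)).const_mul p).neg).congr_deriv (by simp)
    exact ((h1.cexp.mul (hd r)).neg).congr_deriv (by ring)
  have hlim : Tendsto (fun r : ℝ => -(Complex.exp (-(p * r)) * u r)) atTop (𝓝 0) := by
    rw [← neg_zero]
    refine Tendsto.neg ?_
    refine squeeze_zero_norm' (a := fun r : ℝ => C * Real.exp (-(p.re - κ) * r)) ?_ ?_
    · filter_upwards [eventually_ge_atTop 0] with r hr using norm_exp_mul_le hu hr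
    · have h2 : Tendsto (fun r : ℝ => -(p.re - κ) * r) atTop atBot :=
        tendsto_id.const_mul_atTop_of_neg (by linarith)
      simpa using (Real.tendsto_exp_atBot.comp h2).const_mul C
  have := integral_Ioi_of_hasDerivAt_of_tendsto' (a := 0) (fun r _ => hderiv r)
    ((i1.const_mul p).sub i2) hlim
  rw [integral_sub (i1.const_mul p) i2, integral_const_mul] at this
  simp only [laplaceInt]
  simp only [Complex.ofReal_zero, mul_zero, neg_zero, Complex.exp_zero, one_mul, zero_sub,
    neg_neg] at this
  linear_combination this

theorem laplaceInt_conv (hp : κ < p.re) (hcu : Continuous u) (hcv : Continuous v)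
    (hu : ∀ r : ℝ, 0 ≤ r → ‖u r‖ ≤ C * Real.exp (κ * r))
    (hv : ∀ r : ℝ, 0 ≤ r → ‖v r‖ ≤ D * Real.exp (κ * r)) :
    laplaceInt p (fun r => ∫ x in (0 : ℝ)..r, u x * v (r - x)) = laplaceInt p u * laplaceInt p v := by
  have h := integral_posConvolution (μ := volume) (ν := volume) (integrableOn_laplace hp hcu hu)
    (integrableOn_laplace hp hcv hv) (ContinuousLinearMap.mul ℝ ℂ)
  simp only [ContinuousLinearMap.mul_apply'] at h
  rw [laplaceInt, laplaceInt, laplaceInt, ← h]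
  refine setIntegral_congr_fun measurableSet_Ioi fun r _ => ?_
  rw [← intervalIntegral.integral_const_mul]
  refine intervalIntegral.integral_congr fun x _ => ?_
  have : Complex.exp (-(p * r)) = Complex.exp (-(p * x)) * Complex.exp (-(p * (r - x : ℝ))) := by
    rw [← Complex.exp_add]; congr 1; push_cast; ring
  simp only [this]; ring

theorem laplaceInt_add (hp : κ < p.re) (hcu : Continuous u) (hcv : Continuous v)
    (hu : ∀ r : ℝ, 0 ≤ r → ‖u r‖ ≤ C * Real.exp (κ * r))
    (hv : ∀ r : ℝ, 0 ≤ r → ‖v r‖ ≤ D * Real.exp (κ * r)) :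
    laplaceInt p (fun r => u r + v r) = laplaceInt p u + laplaceInt p v := by
  simp only [laplaceInt]
  rw [← integral_add (integrableOn_laplace hp hcu hu) (integrableOn_laplace hp hcv hv)]
  simp only [mul_add]

theorem laplaceInt_const_mul (c : ℂ) : laplaceInt p (fun r => c * u r) = c * laplaceInt p u := by
  simp only [laplaceInt]
  rw [← integral_const_mul]
  congr 1; ext r; ring

/-- Differentiation of a Laplace integral with respect to a parameter. -/
theorem hasDerivAt_laplaceInt_param {V V' : ℝ → ℝ → ℂ} (hp : κ < p.re)
    (hV : ∀ t, Continuous (V t)) (hV' : ∀ t, Continuous (V' t))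
    (hd : ∀ t r, HasDerivAt (fun t => V t r) (V' t r) t)
    (hu : ∀ t r : ℝ, 0 ≤ r → ‖V t r‖ ≤ C * Real.exp (κ * r))
    (hu' : ∀ t r : ℝ, 0 ≤ r → ‖V' t r‖ ≤ D * Real.exp (κ * r)) (t : ℝ) :
    HasDerivAt (fun t => laplaceInt p (V t)) (laplaceInt p (V' t)) t := by
  refine (hasDerivAt_integral_of_dominated_loc_of_deriv_le (s := univ)
    (bound := fun r : ℝ => D * Real.exp (-(p.re - κ) * r))
    (F := fun t r => Complex.exp (-(p * r)) * V t r)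
    (F' := fun t r => Complex.exp (-(p * r)) * V' t r) univ_mem
    (Eventually.of_forall fun t => ?_) (integrableOn_laplace hp (hV t) (hu t)) ?_ ?_
    ((exp_neg_integrableOn_Ioi 0 (by linarith)).const_mul D) ?_).2
  · exact (integrableOn_laplace hp (hV t) (hu t)).aestronglyMeasurable
  · exact (integrableOn_laplace hp (hV' t) (hu' t)).aestronglyMeasurable
  · refine (ae_restrict_iff' measurableSet_Ioi).2 (Eventually.of_forall fun r hr t _ => ?_)
    exact norm_exp_mul_le (hu' t) (le_of_lt hr)
  · exact Eventually.of_forall fun r t _ => (hd t r).const_mul _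

/-- A Laplace integral is holomorphic in the spectral parameter. -/
theorem differentiableAt_laplaceInt (hp : κ < p.re) (hc : Continuous u)
    (hu : ∀ r : ℝ, 0 ≤ r → ‖u r‖ ≤ C * Real.exp (κ * r)) :
    DifferentiableAt ℂ (fun p => laplaceInt p u) p := by
  -- Differentiating in p brings down a factor r. It is absorbed by enlarging the growth rate from κ
  -- to η, still below Re p.
  obtain ⟨η, hη1, hη2⟩ := exists_between hp
  set ξ := (κ + η) / 2 with hξ
  have hC : 0 ≤ C := by
    have := (norm_nonneg _).trans (hu 0 le_rfl)
    simpa using this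
  have hu1 : ∀ r : ℝ, 0 ≤ r → ‖(-(r : ℂ)) * u r‖ ≤ (C * (η - κ)⁻¹) * Real.exp (η * r) := by
    intro r hr
    have hpos : 0 < η - κ := by linarith
    have h1 : (η - κ) * r ≤ Real.exp ((η - κ) * r) :=
      (by linarith : (η - κ) * r ≤ (η - κ) * r + 1).trans (Real.add_one_le_exp _)
    have h2 : r ≤ (η - κ)⁻¹ * Real.exp ((η - κ) * r) := by
      rw [inv_mul_eq_div, le_div_iff₀ hpos]; linarith
    rw [norm_mul, norm_neg, Complex.norm_real, Real.norm_of_nonneg hr]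
    calc r * ‖u r‖ ≤ ((η - κ)⁻¹ * Real.exp ((η - κ) * r)) * (C * Real.exp (κ * r)) :=
          mul_le_mul h2 (hu r hr) (norm_nonneg _) (by positivity)
      _ = (C * (η - κ)⁻¹) * (Real.exp ((η - κ) * r) * Real.exp (κ * r)) := by ring
      _ = _ := by rw [← Real.exp_add]; ring_nf
  have hc1 : Continuous fun r : ℝ => (-(r : ℂ)) * u r := by fun_prop
  have hmem : {q : ℂ | (η + p.re) / 2 < q.re} ∈ 𝓝 p :=
    (isOpen_lt continuous_const Complex.continuous_re).mem_nhds (by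
      show (η + p.re) / 2 < p.re
      linarith)
  refine (hasDerivAt_integral_of_dominated_loc_of_deriv_le
    (bound := fun r : ℝ => (C * (η - κ)⁻¹) * Real.exp (-((η + p.re) / 2 - η) * r))
    (F := fun q r => Complex.exp (-(q * r)) * u r)
    (F' := fun q r => Complex.exp (-(q * r)) * ((-(r : ℂ)) * u r)) hmem
    (Eventually.of_forall fun q => ?_) (integrableOn_laplace hp hc hu) ?_ ?_
    ((exp_neg_integrableOn_Ioi 0 (by linarith)).const_mul _) ?_).2.differentiableAt
  · exact Continuous.aestronglyMeasurable (by fun_prop)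
  · exact Continuous.aestronglyMeasurable (by fun_prop)
  · refine (ae_restrict_iff' measurableSet_Ioi).2 (Eventually.of_forall fun r hr q hq => ?_)
    refine (norm_exp_mul_le hu1 (le_of_lt hr)).trans ?_
    have hq' : (η + p.re) / 2 < q.re := hq
    have hr' : 0 < r := hr
    have : 0 < η - κ := by linarith
    gcongr
  · refine Eventually.of_forall fun r q _ => ?_
    have h1 : HasDerivAt (fun q : ℂ => -(q * (r : ℂ))) (-(r : ℂ)) q := by
      exact (((hasDerivAt_id q).mul_const (r : ℂ)).neg).congr_deriv (by simp)
    exact (h1.cexp.mul_const (u r)).congr_deriv (by ring)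

end Laplace

/-! ### Cauchy estimates, and the Borel sum as a solution. -/

section Cauchy

variable {b κ C : ℝ} {F : ℂ × ℂ → ℂ} {p : ℂ × ℂ}

theorem biStrip_mono {b c : ℝ} (h : b ≤ c) : biStrip b ⊆ biStrip c := fun p hp => by
  have : |p.1.im| + |p.2.im| < b := hp
  show |p.1.im| + |p.2.im| < c
  linarith

theorem real_mem_biStrip (hb : 0 < b) (t s : ℝ) : ((t : ℂ), (s : ℂ)) ∈ biStrip b := by
  simpa [mem_biStrip] using hb

theorem ball_subset_biStrip (hp : p ∈ biStrip (b / 2)) : ball p (b / 4) ⊆ biStrip b := by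
  intro q hq
  rw [mem_ball, Prod.dist_eq, max_lt_iff, dist_eq_norm, dist_eq_norm] at hq
  have h1 : |p.1.im| + |p.2.im| < b / 2 := hp
  have h2 := (Complex.abs_im_le_norm _).trans_lt hq.1
  have h3 := (Complex.abs_im_le_norm _).trans_lt hq.2
  rw [Complex.sub_im] at h2 h3
  have h4 := abs_sub_abs_le_abs_sub q.1.im p.1.im
  have h5 := abs_sub_abs_le_abs_sub q.2.im p.2.im
  show |q.1.im| + |q.2.im| < b
  linarith

/-- Cauchy estimate for functions of exponential type in the second variable. -/
theorem norm_fderiv_le_exp (hb : 0 < b) (hκ : 0 ≤ κ) (hC : 0 ≤ C)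
    (hF : DifferentiableOn ℂ F (biStrip b))
    (hFb : ∀ p ∈ biStrip b, ‖F p‖ ≤ C * Real.exp (κ * ‖p.2‖)) (hp : p ∈ biStrip (b / 2))
    (v : ℂ × ℂ) (hv : ‖v‖ ≤ 1) :
    ‖fderiv ℂ F p v‖ ≤ 8 * C * Real.exp (κ * (b / 4)) / b * Real.exp (κ * ‖p.2‖) := by
  have h1 := norm_fderiv_le_of_norm_le_ball (M := C * Real.exp (κ * (‖p.2‖ + b / 4)))
    (by positivity : 0 < b / 4) (hF.mono (ball_subset_biStrip hp)) (fun q hq => by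
      refine (hFb q (ball_subset_biStrip hp hq)).trans ?_
      rw [mem_ball, Prod.dist_eq, max_lt_iff, dist_eq_norm, dist_eq_norm] at hq
      have h2 : ‖q.2‖ ≤ ‖p.2‖ + b / 4 := by
        have := norm_sub_norm_le q.2 p.2
        linarith [hq.2]
      gcongr)
  calc ‖fderiv ℂ F p v‖ ≤ ‖fderiv ℂ F p‖ * ‖v‖ := ContinuousLinearMap.le_opNorm _ _
    _ ≤ ‖fderiv ℂ F p‖ * 1 := by gcongr
    _ ≤ _ := by
      rw [mul_one]
      refine h1.trans_eq ?_
      rw [mul_add, Real.exp_add]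
      field_simp
      ring

theorem norm_fstDeriv_le_exp (hb : 0 < b) (hκ : 0 ≤ κ) (hC : 0 ≤ C)
    (hF : DifferentiableOn ℂ F (biStrip b))
    (hFb : ∀ p ∈ biStrip b, ‖F p‖ ≤ C * Real.exp (κ * ‖p.2‖)) (hp : p ∈ biStrip (b / 2)) :
    ‖fstDeriv F p‖ ≤ 8 * C * Real.exp (κ * (b / 4)) / b * Real.exp (κ * ‖p.2‖) :=
  norm_fderiv_le_exp hb hκ hC hF hFb hp (1, 0) (by simp [Prod.norm_def])

end Cauchy

/-- The restriction of a function on `biStrip b` to a real time and a real half-axis. -/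
def realSlice (F : ℂ × ℂ → ℂ) (σ t r : ℝ) : ℂ := F ((t : ℂ), ((σ * r : ℝ) : ℂ))

section Slice

variable {b κ C : ℝ} {F U : ℂ × ℂ → ℂ}

theorem continuous_realSlice (hb : 0 < b) (hF : DifferentiableOn ℂ F (biStrip b)) (σ t : ℝ) :
    Continuous (realSlice F σ t) :=
  continuousOn_univ.1 (hF.continuousOn.comp (s := univ)
    (f := fun r : ℝ => (((t : ℂ), ((σ * r : ℝ) : ℂ)) : ℂ × ℂ)) (by fun_prop)
    (fun _ _ => real_mem_biStrip hb _ _))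

theorem norm_realSlice_le (hb : 0 < b)
    (hFb : ∀ p ∈ biStrip b, ‖F p‖ ≤ C * Real.exp (κ * ‖p.2‖)) {σ : ℝ} (hσ : |σ| = 1) (t r : ℝ)
    (hr : 0 ≤ r) : ‖realSlice F σ t r‖ ≤ C * Real.exp (κ * r) := by
  have := hFb _ (real_mem_biStrip hb t (σ * r))
  simpa [realSlice, hσ, abs_of_nonneg hr] using this

theorem hasDerivAt_realSlice_time (hb : 0 < b) (hF : DifferentiableOn ℂ F (biStrip b))
    (σ t r : ℝ) : HasDerivAt (fun t => realSlice F σ t r) (realSlice (fstDeriv F) σ t r) t := by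
  have h1 := hasDerivAt_fst hF (real_mem_biStrip hb t (σ * r))
  exact h1.comp_ofReal

theorem hasDerivAt_realSlice (hb : 0 < b) (hF : DifferentiableOn ℂ F (biStrip b))
    (σ t r : ℝ) : HasDerivAt (realSlice F σ t)
      (σ * realSlice (fun p => fderiv ℂ F p (0, 1)) σ t r) r := by
  have h1 := (hF.differentiableAt
    ((isOpen_biStrip b).mem_nhds (real_mem_biStrip hb t (σ * r)))).hasFDerivAt
  have h2 : HasDerivAt (fun s : ℂ => F (t, s))
      (fderiv ℂ F ((t : ℂ), ((σ * r : ℝ) : ℂ)) (0, 1)) ((σ * r : ℝ) : ℂ) :=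
    h1.comp_hasDerivAt _ ((hasDerivAt_const _ (t : ℂ)).prodMk (hasDerivAt_id _))
  have h3 : HasDerivAt (fun r : ℝ => σ * r) σ r := by simpa using (hasDerivAt_id r).const_mul σ
  exact (h2.comp_ofReal.scomp r h3).congr_deriv (by rw [Complex.real_smul]; rfl)

/-- The factor σ is the Jacobian of the parametrisation s = σr of the half-axis. -/
theorem realSlice_sndConv {σ : ℝ} (t r : ℝ) :
    realSlice (sndConv U U) σ t r
      = σ * ∫ x in (0 : ℝ)..r, realSlice U σ t x * realSlice U σ t (r - x) := by
  have h := intervalIntegral.smul_integral_comp_mul_left (a := 0) (b := 1)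
    (fun x : ℝ => realSlice U σ t x * realSlice U σ t (r - x)) r
  rw [mul_zero, mul_one] at h
  rw [← h, Complex.real_smul]
  simp only [realSlice, sndConv]
  push_cast
  rw [mul_assoc]
  congr 2
  refine intervalIntegral.integral_congr fun x _ => ?_
  have e1 : (x : ℂ) * (σ * r) = σ * (r * x) := by ring
  have e2 : (1 - x : ℂ) * (σ * r) = σ * (r - r * x) := by ring
  simp only [e1, e2]

end Slice

/-- The Borel sum of a solution of the Borel-transformed equation, on the side given by the
sign `σ`. -/
noncomputable def borelSum (a : ℝ) (U : ℂ × ℂ → ℂ) (σ : ℝ) (ε : ℂ) (t : ℝ) : ℂ :=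
  a + σ * laplaceInt (σ / ε) (realSlice U σ t)

section Solution

variable {b T a κ ρ : ℝ} {g : ℂ → ℂ} {U : ℂ × ℂ → ℂ}

/-- Each Cauchy estimate halves the width and keeps the exponential rate κ. The convolution is
bounded through the differential equation, since a direct estimate from the bound on U would leave a
factor |s|. -/
theorem IsBorelSolution.bounds (hb : 0 < b) (hκ : 0 ≤ κ) (hρ : 0 ≤ ρ)
    (h : IsBorelSolution b T a κ ρ g U) :
    ∃ D, (∀ p ∈ biStrip (b / 4), ‖fstDeriv U p‖ ≤ D * Real.exp (κ * ‖p.2‖)) ∧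
      (∀ p ∈ biStrip (b / 4), ‖fstDeriv (fstDeriv U) p‖ ≤ D * Real.exp (κ * ‖p.2‖)) ∧
      (∀ p ∈ biStrip (b / 4), ‖fderiv ℂ (fstDeriv U) p (0, 1)‖ ≤ D * Real.exp (κ * ‖p.2‖)) ∧
      (∀ p ∈ biStrip (b / 4), ‖sndConv U U p‖ ≤ D * Real.exp (κ * ‖p.2‖)) := by
  set C₁ := 8 * ρ * Real.exp (κ * (b / 4)) / b with hC₁
  have hC₁0 : 0 ≤ C₁ := by positivity
  set C₂ := 8 * C₁ * Real.exp (κ * (b / 2 / 4)) / (b / 2) with hC₂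
  have hC₂0 : 0 ≤ C₂ := by positivity
  have h1 : ∀ p ∈ biStrip (b / 2), ‖fstDeriv U p‖ ≤ C₁ * Real.exp (κ * ‖p.2‖) :=
    fun p hp => norm_fstDeriv_le_exp hb hκ hρ h.adm.holo h.bound hp
  have hN := (differentiableOn_fstDeriv h.adm.holo).mono (biStrip_mono (by linarith : b / 2 ≤ b))
  have h2 : ∀ v : ℂ × ℂ, ‖v‖ ≤ 1 → ∀ p ∈ biStrip (b / 4),
      ‖fderiv ℂ (fstDeriv U) p v‖ ≤ C₂ * Real.exp (κ * ‖p.2‖) := fun v hv p hp =>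
    norm_fderiv_le_exp (by positivity) hκ hC₁0 hN h1
      (biStrip_mono (by linarith : b / 4 ≤ b / 2 / 2) hp) v hv
  have h10 : ‖((1, 0) : ℂ × ℂ)‖ ≤ 1 := by simp [Prod.norm_def]
  have h01 : ‖((0, 1) : ℂ × ℂ)‖ ≤ 1 := by simp [Prod.norm_def]
  have h11 : ‖((1, 1) : ℂ × ℂ)‖ ≤ 1 := by simp [Prod.norm_def]
  have hmono : ∀ {c : ℝ}, c ≤ C₁ + C₂ + |2 * a| * ρ → ∀ s : ℂ,
      c * Real.exp (κ * ‖s‖) ≤ (C₁ + C₂ + |2 * a| * ρ) * Real.exp (κ * ‖s‖) := fun hc s => by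
    gcongr
  have haρ : 0 ≤ |2 * a| * ρ := by positivity
  refine ⟨C₁ + C₂ + |2 * a| * ρ, fun p hp => ?_, fun p hp => ?_, fun p hp => ?_, fun p hp => ?_⟩
  · exact (h1 p (biStrip_mono (by linarith) hp)).trans (hmono (by linarith) _)
  · exact (h2 (1, 0) h10 p hp).trans (hmono (by linarith) _)
  · exact (h2 (0, 1) h01 p hp).trans (hmono (by linarith) _)
  · have hp' : p ∈ biStrip b := biStrip_mono (by linarith) hp
    have e1 := h.pde p hp'
    have e2 : sndConv U U p = -(fderiv ℂ (fstDeriv U) p (1, 1)) - ((2 * a : ℝ) : ℂ) * U p := by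
      rw [e1, borelForce]; ring
    rw [e2]
    have e3 : ‖((2 * a : ℝ) : ℂ) * U p‖ ≤ |2 * a| * (ρ * Real.exp (κ * ‖p.2‖)) := by
      rw [norm_mul, Complex.norm_real, Real.norm_eq_abs]
      exact mul_le_mul_of_nonneg_left (h.bound p hp') (abs_nonneg _)
    have e4 := h2 (1, 1) h11 p hp
    refine (norm_sub_le _ _).trans ?_
    rw [norm_neg]
    refine (add_le_add e4 e3).trans ?_
    have := Real.exp_pos (κ * ‖p.2‖)
    have : 0 ≤ C₁ * Real.exp (κ * ‖p.2‖) := by positivity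
    nlinarith

/-- The Borel sum satisfies the equation. -/
theorem IsBorelSolution.hasDerivAt_borelSum (hb : 0 < b) (hκ : 0 ≤ κ) (hρ : 0 ≤ ρ)
    (h : IsBorelSolution b T a κ ρ g U) {σ : ℝ} (hσ : |σ| = 1) {ε : ℂ}
    (hε : κ < ((σ : ℂ) / ε).re) :
    ∃ y : ℝ → ℂ, (∀ t, HasDerivAt (borelSum a U σ ε) (y t) t) ∧
      ∀ t : ℝ, HasDerivAt y (g t + a ^ 2 - y t / ε - borelSum a U σ ε t ^ 2) t := by
  obtain ⟨D, hD1, hD2, hD3, hD4⟩ := h.bounds hb hκ hρ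
  have hb4 : 0 < b / 4 := by positivity
  set p : ℂ := σ / ε with hp
  have hU := h.adm.holo
  have hN := differentiableOn_fstDeriv hU
  have hNN := differentiableOn_fstDeriv hN
  have hNs := differentiableOn_fderiv_apply (isOpen_biStrip b) hN (0, 1)
  have hCv := (h.adm.sndConv h.adm).holo
  have bU := fun t r hr => norm_realSlice_le hb h.bound hσ t r hr
  have bN := fun t r hr => norm_realSlice_le hb4 hD1 hσ t r hr
  have bNN := fun t r hr => norm_realSlice_le hb4 hD2 hσ t r hr
  have bNs := fun t r hr => norm_realSlice_le hb4 hD3 hσ t r hr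
  have bC := fun t r hr => norm_realSlice_le hb4 hD4 hσ t r hr
  have cU := continuous_realSlice hb hU σ
  have cN := continuous_realSlice hb hN σ
  have cNN := continuous_realSlice hb hNN σ
  have cNs := continuous_realSlice hb hNs σ
  have cC := continuous_realSlice hb hCv σ
  refine ⟨fun t => σ * laplaceInt p (realSlice (fstDeriv U) σ t), fun t => ?_, fun t => ?_⟩
  · exact ((hasDerivAt_laplaceInt_param hε cU cN (fun t r => hasDerivAt_realSlice_time hb hU σ t r)
      bU bN t).const_mul (σ : ℂ)).const_add (a : ℂ)
  · have h1 := (hasDerivAt_laplaceInt_param hε cN cNN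
      (fun t r => hasDerivAt_realSlice_time hb hN σ t r) bN bNN t).const_mul (σ : ℂ)
    refine h1.congr_deriv ?_
    -- integration by parts
    have hparts := mul_laplaceInt hε (fun r => hasDerivAt_realSlice hb hN σ t r)
      (continuous_const.mul (cNs t)) (bN t) (D := D) (fun r hr => by
        rw [norm_mul, Complex.norm_real, Real.norm_eq_abs, hσ, one_mul]
        exact bNs t r hr)
    have hzero : realSlice (fstDeriv U) σ t 0 = g t := by
      simp only [realSlice, mul_zero, Complex.ofReal_zero]
      exact h.init t (by simpa using hb)
    -- The differential equation is solved for ∂ₛ∂ₜU, the term left over by the integration by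
    -- parts.
    have hpde : ∀ r, realSlice (fun p => fderiv ℂ (fstDeriv U) p (0, 1)) σ t r
        = (-((2 * a : ℝ) : ℂ)) * realSlice U σ t r + ((-1 : ℂ) * realSlice (sndConv U U) σ t r
          + (-1 : ℂ) * realSlice (fstDeriv (fstDeriv U)) σ t r) := fun r => by
      have e1 := h.pde _ (real_mem_biStrip hb t (σ * r))
      have e2 : ((1, 1) : ℂ × ℂ) = (1, 0) + (0, 1) := by simp
      rw [e2, map_add, borelForce] at e1
      simp only [realSlice]
      have e3 : fstDeriv (fstDeriv U) ((t : ℂ), ((σ * r : ℝ) : ℂ))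
        = fderiv ℂ (fstDeriv U) ((t : ℂ), ((σ * r : ℝ) : ℂ)) (1, 0) := rfl
      rw [e3]
      linear_combination e1
    have hneg : ∀ {u : ℝ → ℂ} {C : ℝ}, (∀ r : ℝ, 0 ≤ r → ‖u r‖ ≤ C * Real.exp (κ * r)) →
        ∀ r : ℝ, 0 ≤ r → ‖(-1 : ℂ) * u r‖ ≤ C * Real.exp (κ * r) := fun hu r hr => by
      simpa using hu r hr
    have hlap : laplaceInt p (realSlice (fun p => fderiv ℂ (fstDeriv U) p (0, 1)) σ t)
        = -((2 * a : ℝ) : ℂ) * laplaceInt p (realSlice U σ t)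
          + (-(laplaceInt p (realSlice (sndConv U U) σ t))
          - laplaceInt p (realSlice (fstDeriv (fstDeriv U)) σ t)) := by
      have c1 : Continuous fun r => -((2 * a : ℝ) : ℂ) * realSlice U σ t r :=
        continuous_const.mul (cU t)
      have c2 : Continuous fun r => (-1 : ℂ) * realSlice (sndConv U U) σ t r :=
        continuous_const.mul (cC t)
      have c3 : Continuous fun r => (-1 : ℂ) * realSlice (fstDeriv (fstDeriv U)) σ t r :=
        continuous_const.mul (cNN t)
      have c4 : Continuous fun r => (-1 : ℂ) * realSlice (sndConv U U) σ t r
          + (-1 : ℂ) * realSlice (fstDeriv (fstDeriv U)) σ t r := c2.add c3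
      rw [funext hpde, laplaceInt_add (C := |2 * a| * ρ) (D := D + D) hε c1 c4 (fun r hr => ?_)
        (fun r hr => ?_), laplaceInt_add hε c2 c3 (hneg (bC t)) (hneg (bNN t)), laplaceInt_const_mul,
        laplaceInt_const_mul, laplaceInt_const_mul]
      · ring
      · rw [norm_mul, norm_neg, Complex.norm_real, Real.norm_eq_abs, mul_assoc]
        exact mul_le_mul_of_nonneg_left (bU t r hr) (abs_nonneg _)
      · refine (norm_add_le _ _).trans ?_
        rw [add_mul]
        exact add_le_add (hneg (bC t) r hr) (hneg (bNN t) r hr)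
    have hconv : laplaceInt p (realSlice (sndConv U U) σ t)
        = σ * (laplaceInt p (realSlice U σ t) * laplaceInt p (realSlice U σ t)) := by
      rw [← laplaceInt_conv hε (cU t) (cU t) (bU t) (bU t), ← laplaceInt_const_mul]
      congr 1
      ext r
      exact realSlice_sndConv t r
    rw [laplaceInt_const_mul, hlap, hconv, hzero] at hparts
    simp only [borelSum]
    rw [← hp]
    have hpe : (σ : ℂ) * laplaceInt p (realSlice (fstDeriv U) σ t) / ε
        = p * laplaceInt p (realSlice (fstDeriv U) σ t) := by rw [hp]; ring
    rw [hpe, hparts]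
    push_cast
    ring

end Solution

/-! ### Taylor coefficients at s = 0 and the formal solution. -/

section OneVariable

variable {S : Set ℂ} {b : ℝ} {u v h : ℂ → ℂ}

theorem starConvex_strip (b : ℝ) : StarConvex ℝ 0 {z : ℂ | |z.im| < b} := by
  rw [starConvex_zero_iff]
  intro z hz r hr0 hr1
  have : |z.im| < b := hz
  show |(r • z).im| < b
  simp only [Complex.smul_im, smul_eq_mul, abs_mul, abs_of_nonneg hr0]
  nlinarith [abs_nonneg z.im]

theorem DifferentiableOn.iteratedDeriv_of_isOpen (hS : IsOpen S) (hu : DifferentiableOn ℂ u S)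
    (k : ℕ) : DifferentiableOn ℂ (iteratedDeriv k u) S := by
  induction k with
  | zero => simpa using hu
  | succ k ih => rw [iteratedDeriv_succ]; exact ih.deriv hS

theorem DifferentiableOn.contDiffAt_of_isOpen (hS : IsOpen S) (hu : DifferentiableOn ℂ u S) {z : ℂ}
    (hz : z ∈ S) (k : ℕ) : ContDiffAt ℂ k u z :=
  (hu.analyticAt (hS.mem_nhds hz)).contDiffAt

/-- The iterated derivatives at the origin of a Laplace-type convolution. -/
theorem iteratedDeriv_conv (hS : IsOpen S) (hstar : StarConvex ℝ 0 S) (h0 : (0 : ℂ) ∈ S)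
    (hu : DifferentiableOn ℂ u S) (k : ℕ) : ∀ {v : ℂ → ℂ}, DifferentiableOn ℂ v S →
    iteratedDeriv k (fun s => s * ∫ r in (0 : ℝ)..1, u (r * s) * v ((1 - r) * s)) 0
      = ∑ i ∈ Finset.range k, iteratedDeriv i u 0 * iteratedDeriv (k - 1 - i) v 0 := by
  induction k with
  | zero => intro v _; simp
  | succ k ih =>
    intro v hv
    -- The rule (u∗v)' = v(0)u + u∗v' keeps u and replaces v by v', so the induction has to be
    -- uniform in v.
    have hd : deriv (fun s => s * ∫ r in (0 : ℝ)..1, u (r * s) * v ((1 - r) * s)) =ᶠ[𝓝 0]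
        fun s => u s * v 0 + s * ∫ r in (0 : ℝ)..1, u (r * s) * deriv v ((1 - r) * s) := by
      filter_upwards [hS.mem_nhds h0] with s hs
      exact (hasDerivAt_mul_integral_mul hS hstar hu hv hs).deriv
    have hv' := hv.deriv hS
    have hC : DifferentiableOn ℂ
        (fun s => s * ∫ r in (0 : ℝ)..1, u (r * s) * deriv v ((1 - r) * s)) S := fun s hs =>
      (hasDerivAt_mul_integral_mul hS hstar hu hv' hs).differentiableAt.differentiableWithinAt
    rw [iteratedDeriv_succ', hd.iteratedDeriv_eq k, iteratedDeriv_fun_add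
      ((hu.mul_const (v 0)).contDiffAt_of_isOpen hS h0 k) (hC.contDiffAt_of_isOpen hS h0 k),
      ih hv', Finset.sum_range_succ]
    have e1 : iteratedDeriv k (fun s => u s * v 0) 0 = iteratedDeriv k u 0 * v 0 :=
      iteratedDeriv_mul_const_field _ _
    rw [e1, add_comm]
    congr 1
    · refine Finset.sum_congr rfl fun i hi => ?_
      rw [Finset.mem_range] at hi
      rw [← iteratedDeriv_succ']
      congr 2; omega
    · simp

theorem deriv_conj_of_conj (hS : IsOpen S) (hSc : ∀ z ∈ S, starRingEnd ℂ z ∈ S)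
    (hh : DifferentiableOn ℂ h S) (hc : ∀ z ∈ S, h (starRingEnd ℂ z) = starRingEnd ℂ (h z)) :
    ∀ z ∈ S, deriv h (starRingEnd ℂ z) = starRingEnd ℂ (deriv h z) := by
  intro z hz
  have h1 := ((hh.differentiableAt (hS.mem_nhds hz)).hasDerivAt).conj_conj
  refine (h1.congr_of_eventuallyEq ?_).deriv
  filter_upwards [hS.mem_nhds (hSc z hz)] with w hw
  have := hc w hw
  simp [this]

theorem iteratedDeriv_conj_of_conj (hS : IsOpen S) (hSc : ∀ z ∈ S, starRingEnd ℂ z ∈ S)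
    (hh : DifferentiableOn ℂ h S) (hc : ∀ z ∈ S, h (starRingEnd ℂ z) = starRingEnd ℂ (h z)) (k : ℕ) :
    ∀ z ∈ S, iteratedDeriv k h (starRingEnd ℂ z) = starRingEnd ℂ (iteratedDeriv k h z) := by
  induction k with
  | zero => simpa using hc
  | succ k ih =>
    rw [iteratedDeriv_succ]
    exact deriv_conj_of_conj hS hSc (hh.iteratedDeriv_of_isOpen hS k) ih

/-- Discs of the fixed radius b/2 fit around every real point, so differentiation changes the
constant but not the exponential rate; Laplace integrals of all derivatives therefore converge in
the same region. -/
theorem norm_iteratedDeriv_le_exp {κ C : ℝ} (hb : 0 < b) (hκ : 0 ≤ κ) (hC : 0 ≤ C)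
    (hh : DifferentiableOn ℂ h {z | |z.im| < b})
    (hhb : ∀ z : ℂ, |z.im| < b → ‖h z‖ ≤ C * Real.exp (κ * ‖z‖)) (k : ℕ) (x : ℝ) :
    ‖iteratedDeriv k h x‖
      ≤ k.factorial * (C * Real.exp (κ * (b / 2))) / (b / 2) ^ k * Real.exp (κ * |x|) := by
  have hsub : closedBall (x : ℂ) (b / 2) ⊆ {z : ℂ | |z.im| < b} := fun z hz => by
    rw [mem_closedBall, dist_eq_norm] at hz
    have := (Complex.abs_im_le_norm (z - x)).trans hz
    simp only [Complex.sub_im, Complex.ofReal_im, sub_zero] at this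
    show |z.im| < b
    linarith
  have := Complex.norm_iteratedDeriv_le_of_forall_mem_sphere_norm_le (c := (x : ℂ)) (R := b / 2)
    (C := C * Real.exp (κ * (|x| + b / 2))) (f := h) k (by positivity)
    ((hh.mono hsub).diffContOnCl_ball le_rfl) (fun z hz => by
      refine (hhb z (hsub (sphere_subset_closedBall hz))).trans ?_
      rw [mem_sphere, dist_eq_norm] at hz
      have h2 : ‖z‖ ≤ |x| + b / 2 := by
        have := norm_sub_norm_le z x
        rw [Complex.norm_real, Real.norm_eq_abs] at this
        linarith
      gcongr)
  refine this.trans_eq ?_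
  rw [mul_add, Real.exp_add]
  ring

end OneVariable

/-- The Borel transform, as a primitive of `U` with constant term `a`. -/
noncomputable def borelTransform (a : ℝ) (U : ℂ × ℂ → ℂ) (t : ℝ) (s : ℂ) : ℂ :=
  a + s * ∫ r in (0 : ℝ)..1, U ((t : ℂ), r * s)

/-- The coefficients of the formal solution. -/
noncomputable def formalCoeff (a : ℝ) (U : ℂ × ℂ → ℂ) (k : ℕ) (t : ℝ) : ℝ :=
  (iteratedDeriv k (borelTransform a U t) 0).re

section Formal

variable {b T a κ ρ : ℝ} {g : ℂ → ℂ} {U F : ℂ × ℂ → ℂ}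

theorem iteratedDeriv_neg_add_sub {u v w : ℂ → ℂ} {x : ℂ} (α : ℂ) (k : ℕ) (hu : ContDiffAt ℂ k u x)
    (hv : ContDiffAt ℂ k v x) (hw : ContDiffAt ℂ k w x) :
    iteratedDeriv k (fun s => -(α * u s + v s) - w s) x
      = -(α * iteratedDeriv k u x + iteratedDeriv k v x) - iteratedDeriv k w x := by
  have h1 : ContDiffAt ℂ k (fun s => α * u s) x := contDiffAt_const.mul hu
  have h2 : ContDiffAt ℂ k (fun s => α * u s + v s) x := h1.add hv
  have h3 : ContDiffAt ℂ k (fun s => -(α * u s + v s)) x := h2.neg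
  rw [iteratedDeriv_fun_sub h3 hw, iteratedDeriv_fun_neg, iteratedDeriv_fun_add h1 hv,
    iteratedDeriv_const_mul_field]

theorem mk_real_mem_biStrip {t : ℝ} {s : ℂ} (hs : |s.im| < b) : ((t : ℂ), s) ∈ biStrip b := by
  simpa [mem_biStrip] using hs

theorem differentiableOn_timeSlice (hF : DifferentiableOn ℂ F (biStrip b)) (t : ℝ) :
    DifferentiableOn ℂ (fun s => F ((t : ℂ), s)) {s | |s.im| < b} :=
  hF.comp (f := fun s : ℂ => (((t : ℂ), s) : ℂ × ℂ)) (by fun_prop)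
    (fun _ hs => mk_real_mem_biStrip hs)

theorem Admissible.conj_timeSlice (hU : Admissible b T U) (t : ℝ) (s : ℂ) (hs : |s.im| < b) :
    U ((t : ℂ), starRingEnd ℂ s) = starRingEnd ℂ (U ((t : ℂ), s)) := by
  simpa using hU.conj _ (mk_real_mem_biStrip (t := t) hs)

theorem hasDerivAt_borelTransform (hU : DifferentiableOn ℂ U (biStrip b)) (t : ℝ)
    {s : ℂ} (hs : |s.im| < b) :
    HasDerivAt (borelTransform a U t) (U ((t : ℂ), s)) s :=
  (hasDerivAt_mul_integral_smul (isOpen_strip b) (starConvex_strip b)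
    (differentiableOn_timeSlice hU t) hs).const_add (a : ℂ)

theorem differentiableOn_borelTransform (hU : DifferentiableOn ℂ U (biStrip b))
    (t : ℝ) : DifferentiableOn ℂ (borelTransform a U t) {s | |s.im| < b} := fun _ hs =>
  (hasDerivAt_borelTransform hU t hs).differentiableAt.differentiableWithinAt

theorem zero_mem_strip (hb : 0 < b) : (0 : ℂ) ∈ {s : ℂ | |s.im| < b} := by simpa using hb

theorem iteratedDeriv_borelTransform_succ (hb : 0 < b) (hU : DifferentiableOn ℂ U (biStrip b))
    (t : ℝ) (k : ℕ) : iteratedDeriv (k + 1) (borelTransform a U t) 0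
      = iteratedDeriv k (fun s => U ((t : ℂ), s)) 0 := by
  rw [iteratedDeriv_succ']
  refine Filter.EventuallyEq.iteratedDeriv_eq k ?_
  filter_upwards [(isOpen_strip b).mem_nhds (zero_mem_strip hb)] with s hs
  exact (hasDerivAt_borelTransform hU t hs).deriv

theorem borelTransform_zero (t : ℝ) : borelTransform a U t 0 = a := by simp [borelTransform]

theorem formalCoeff_zero (t : ℝ) : formalCoeff a U 0 t = a := by
  simp [formalCoeff, borelTransform_zero]

theorem formalCoeff_succ (hb : 0 < b) (hU : DifferentiableOn ℂ U (biStrip b)) (k : ℕ) (t : ℝ) :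
    formalCoeff a U (k + 1) t = (iteratedDeriv k (fun s => U ((t : ℂ), s)) 0).re := by
  rw [formalCoeff, iteratedDeriv_borelTransform_succ hb hU]

/-- The real part in `formalCoeff` loses nothing: at real t the function U commutes with
conjugation, so its s-derivatives at 0 are real. -/
theorem ofReal_formalCoeff_succ (hb : 0 < b) (hU : Admissible b T U) (k : ℕ) (t : ℝ) :
    (formalCoeff a U (k + 1) t : ℂ) = iteratedDeriv k (fun s => U ((t : ℂ), s)) 0 := by
  rw [formalCoeff_succ hb hU.holo]
  have := iteratedDeriv_conj_of_conj (isOpen_strip b) (fun z hz => by simpa using hz)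
    (differentiableOn_timeSlice hU.holo t) (fun s hs => hU.conj_timeSlice t s hs) k 0
    (zero_mem_strip hb)
  rw [map_zero] at this
  exact Complex.conj_eq_iff_re.1 this.symm

theorem ofReal_formalCoeff (hb : 0 < b) (hU : Admissible b T U) (k : ℕ) (t : ℝ) :
    (formalCoeff a U k t : ℂ) = iteratedDeriv k (borelTransform a U t) 0 := by
  cases k with
  | zero => simp [formalCoeff_zero, borelTransform_zero]
  | succ k => rw [ofReal_formalCoeff_succ hb hU, iteratedDeriv_borelTransform_succ hb hU.holo]

theorem hasSum_borelTransform (hb : 0 < b) (hU : Admissible b T U) (t : ℝ) {s : ℂ} (hs : ‖s‖ < b) :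
    HasSum (fun k : ℕ => s ^ k / (k.factorial : ℂ) * (formalCoeff a U k t : ℂ))
      (borelTransform a U t s) := by
  have hsub : ball (0 : ℂ) b ⊆ {s : ℂ | |s.im| < b} := fun z hz => by
    rw [mem_ball_zero_iff] at hz
    exact (Complex.abs_im_le_norm z).trans_lt hz
  have := Complex.hasSum_taylorSeries_on_ball
    ((differentiableOn_borelTransform (a := a) hU.holo t).mono hsub)
    (mem_ball_zero_iff.2 hs)
  refine this.congr_fun fun k => ?_
  rw [ofReal_formalCoeff hb hU, sub_zero, smul_eq_mul, smul_eq_mul]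
  ring

/-- Integrating U along the segment from 0 to s costs a factor |s| ≤ e^{|s|}. This raises the rate
to κ + 1 and fixes the final choices R = 1/(κ+1) and K = a + ρ. -/
theorem norm_borelTransform_le (hκ : 0 ≤ κ) (hρ : 0 ≤ ρ) (ha : 0 ≤ a)
    (hUb : ∀ p ∈ biStrip b, ‖U p‖ ≤ ρ * Real.exp (κ * ‖p.2‖)) (t : ℝ) {s : ℂ} (hs : |s.im| < b) :
    ‖borelTransform a U t s‖ ≤ (a + ρ) * Real.exp ((κ + 1) * ‖s‖) := by
  have h1 : ‖∫ r in (0 : ℝ)..1, U ((t : ℂ), r * s)‖ ≤ ρ * Real.exp (κ * ‖s‖) := by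
    have := intervalIntegral.norm_integral_le_of_norm_le_const (a := 0) (b := 1)
      (f := fun r : ℝ => U ((t : ℂ), r * s)) (C := ρ * Real.exp (κ * ‖s‖)) fun r hr => ?_
    · simpa using this
    · rw [uIoc_of_le zero_le_one] at hr
      refine (hUb _ (biStrip_snd (mk_real_mem_biStrip hs) (Ioc_subset_Icc_self hr))).trans ?_
      have h2 : ‖(r : ℂ) * s‖ ≤ ‖s‖ := by
        rw [norm_mul, Complex.norm_real, Real.norm_of_nonneg hr.1.le]
        exact mul_le_of_le_one_left (norm_nonneg _) hr.2
      simp only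
      gcongr
  have h2 : ‖s‖ ≤ Real.exp ‖s‖ := by linarith [Real.add_one_le_exp ‖s‖]
  have h3 : 1 ≤ Real.exp ((κ + 1) * ‖s‖) := Real.one_le_exp (by positivity)
  calc ‖borelTransform a U t s‖ ≤ ‖(a : ℂ)‖ + ‖s * ∫ r in (0 : ℝ)..1, U ((t : ℂ), r * s)‖ :=
        norm_add_le _ _
    _ ≤ a * 1 + Real.exp ‖s‖ * (ρ * Real.exp (κ * ‖s‖)) := by
      rw [norm_mul, Complex.norm_real, Real.norm_of_nonneg ha, mul_one]
      gcongr
    _ = a * 1 + ρ * Real.exp ((κ + 1) * ‖s‖) := by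
      rw [mul_left_comm, ← Real.exp_add]; ring_nf
    _ ≤ a * Real.exp ((κ + 1) * ‖s‖) + ρ * Real.exp ((κ + 1) * ‖s‖) := by gcongr
    _ = _ := by ring

theorem Admissible.timeSlice_periodic (hb : 0 < b) (hU : Admissible b T U) (k : ℕ) :
    Function.Periodic (formalCoeff a U k) T := by
  intro t
  cases k with
  | zero => simp [formalCoeff_zero]
  | succ k =>
    rw [formalCoeff_succ hb hU.holo, formalCoeff_succ hb hU.holo]
    congr 1
    refine Filter.EventuallyEq.iteratedDeriv_eq k ?_
    filter_upwards [(isOpen_strip b).mem_nhds (zero_mem_strip hb)] with s hs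
    have := hU.per _ (mk_real_mem_biStrip (t := t) hs)
    push_cast
    exact this

theorem hasDerivAt_iteratedDeriv_time (hF : DifferentiableOn ℂ F (biStrip b)) {t : ℂ}
    (ht : |t.im| < b) (k : ℕ) :
    HasDerivAt (fun t : ℂ => iteratedDeriv k (fun s => F (t, s)) 0)
      (iteratedDeriv k (fun s => fstDeriv F (t, s)) 0) t :=
  hasDerivAt_iteratedDeriv_snd (isOpen_biStrip b) hF (mk_zero_mem_biStrip ht) k

theorem analyticOnNhd_formalCoeff (hb : 0 < b) (hU : DifferentiableOn ℂ U (biStrip b)) (k : ℕ) :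
    AnalyticOnNhd ℝ (formalCoeff a U k) univ := by
  intro t _
  cases k with
  | zero =>
    have : formalCoeff a U 0 = fun _ => a := funext fun t => formalCoeff_zero t
    rw [this]
    exact analyticAt_const
  | succ k =>
    have : formalCoeff a U (k + 1)
        = fun t : ℝ => (iteratedDeriv k (fun s => U ((t : ℂ), s)) 0).re :=
      funext fun t => formalCoeff_succ hb hU k t
    rw [this]
    have hd : DifferentiableOn ℂ (fun t : ℂ => iteratedDeriv k (fun s => U (t, s)) 0)
        {t | |t.im| < b} := fun t ht =>
      (hasDerivAt_iteratedDeriv_time hU ht k).differentiableAt.differentiableWithinAt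
    have ht : ((t : ℝ) : ℂ) ∈ {t : ℂ | |t.im| < b} := by simpa using hb
    exact AnalyticAt.re_ofReal (f := fun t : ℂ => iteratedDeriv k (fun s => U (t, s)) 0)
      (hd.analyticAt ((isOpen_strip b).mem_nhds ht))

theorem deriv_formalCoeff_succ (hb : 0 < b) (hU : DifferentiableOn ℂ U (biStrip b)) (k : ℕ)
    (t : ℝ) : deriv (formalCoeff a U (k + 1)) t
      = (iteratedDeriv k (fun s => fstDeriv U ((t : ℂ), s)) 0).re := by
  have : formalCoeff a U (k + 1)
      = fun t : ℝ => (iteratedDeriv k (fun s => U ((t : ℂ), s)) 0).re :=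
    funext fun t => formalCoeff_succ hb hU k t
  rw [this]
  exact (hasDerivAt_iteratedDeriv_time hU (by simpa using hb) k).real_of_complex.deriv

theorem deriv_deriv_formalCoeff_succ (hb : 0 < b) (hU : DifferentiableOn ℂ U (biStrip b)) (k : ℕ)
    (t : ℝ) : deriv (deriv (formalCoeff a U (k + 1))) t
      = (iteratedDeriv k (fun s => fstDeriv (fstDeriv U) ((t : ℂ), s)) 0).re := by
  have : deriv (formalCoeff a U (k + 1))
      = fun t : ℝ => (iteratedDeriv k (fun s => fstDeriv U ((t : ℂ), s)) 0).re :=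
    funext fun t => deriv_formalCoeff_succ hb hU k t
  rw [this]
  exact (hasDerivAt_iteratedDeriv_time (differentiableOn_fstDeriv hU)
    (by simpa using hb) k).real_of_complex.deriv

theorem IsBorelSolution.deriv_fstDeriv_timeSlice (h : IsBorelSolution b T a κ ρ g U) (t : ℝ)
    {s : ℂ} (hs : |s.im| < b) : deriv (fun s => fstDeriv U ((t : ℂ), s)) s
      = -(((2 * a : ℝ) : ℂ) * U ((t : ℂ), s) + sndConv U U ((t : ℂ), s))
        - fstDeriv (fstDeriv U) ((t : ℂ), s) := by
  have hp := mk_real_mem_biStrip (t := t) hs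
  have h1 := ((differentiableOn_fstDeriv h.adm.holo).differentiableAt
    ((isOpen_biStrip b).mem_nhds hp)).hasFDerivAt
  have h2 : HasDerivAt (fun s : ℂ => fstDeriv U ((t : ℂ), s))
      (fderiv ℂ (fstDeriv U) ((t : ℂ), s) (0, 1)) s :=
    h1.comp_hasDerivAt s ((hasDerivAt_const s (t : ℂ)).prodMk (hasDerivAt_id s))
  have e1 := h.pde _ hp
  have e2 : ((1, 1) : ℂ × ℂ) = (1, 0) + (0, 1) := by simp
  rw [e2, map_add, borelForce] at e1
  have e3 : fstDeriv (fstDeriv U) ((t : ℂ), s) = fderiv ℂ (fstDeriv U) ((t : ℂ), s) (1, 0) := rfl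
  rw [h2.deriv, e3]
  linear_combination e1

/-- For k = 0 this is the initial condition, with g + a² the full forcing. For larger k it is the
(k-1)-st s-derivative at 0 of the equation for U. -/
theorem IsBorelSolution.deriv_formalCoeff (hb : 0 < b) (h : IsBorelSolution b T a κ ρ g U)
    (k : ℕ) (t : ℝ) : deriv (formalCoeff a U (k + 1)) t =
    (if k = 0 then (g t).re + a ^ 2 else 0) - deriv (deriv (formalCoeff a U k)) t
      - ∑ j ∈ Finset.range (k + 1), formalCoeff a U j t * formalCoeff a U (k - j) t := by
  have hU := h.adm.holo
  have h0 := zero_mem_strip hb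
  rw [deriv_formalCoeff_succ hb hU]
  cases k with
  | zero =>
    have e1 : formalCoeff a U 0 = fun _ => a := funext fun t => formalCoeff_zero t
    have e2 := h.init (t : ℂ) (by simpa using hb)
    simp only [iteratedDeriv_zero, e2, e1]
    simp [formalCoeff_zero]
    ring
  | succ k =>
    have hev : deriv (fun s => fstDeriv U ((t : ℂ), s)) =ᶠ[𝓝 0] fun s =>
        -(((2 * a : ℝ) : ℂ) * U ((t : ℂ), s) + sndConv U U ((t : ℂ), s))
        - fstDeriv (fstDeriv U) ((t : ℂ), s) := by
      filter_upwards [(isOpen_strip b).mem_nhds h0] with s hs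
      exact h.deriv_fstDeriv_timeSlice t hs
    have dU := differentiableOn_timeSlice hU t
    have dC := differentiableOn_timeSlice (h.adm.sndConv h.adm).holo t
    have dN := differentiableOn_timeSlice (differentiableOn_fstDeriv (differentiableOn_fstDeriv hU)) t
    have cU := dU.contDiffAt_of_isOpen (isOpen_strip b) h0 k
    have cC := dC.contDiffAt_of_isOpen (isOpen_strip b) h0 k
    have cN := dN.contDiffAt_of_isOpen (isOpen_strip b) h0 k
    have hconv : iteratedDeriv k (fun s => sndConv U U ((t : ℂ), s)) 0
        = ∑ i ∈ Finset.range k, iteratedDeriv i (fun s => U ((t : ℂ), s)) 0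
          * iteratedDeriv (k - 1 - i) (fun s => U ((t : ℂ), s)) 0 := by
      simp only [sndConv]
      exact iteratedDeriv_conv (u := fun s => U ((t : ℂ), s)) (isOpen_strip b) (starConvex_strip b)
        h0 dU k (v := fun s => U ((t : ℂ), s)) dU
    have key := iteratedDeriv_neg_add_sub (((2 * a : ℝ) : ℂ)) k cU cC cN
    rw [deriv_deriv_formalCoeff_succ hb hU, iteratedDeriv_succ', hev.iteratedDeriv_eq k]
    generalize iteratedDeriv k (fun s => fstDeriv (fstDeriv U) ((t : ℂ), s)) 0 = n at key ⊢
    rw [key, hconv]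
    simp only [← ofReal_formalCoeff_succ (a := a) hb h.adm]
    -- The first and last terms of the Cauchy product both contain the constant coefficient a and
    -- match the linear term 2aU. The terms between them match U∗U.
    rw [Finset.sum_range_succ, Finset.sum_range_succ']
    simp only [formalCoeff_zero, Nat.sub_self, Nat.sub_zero]
    have e1 : ∑ i ∈ Finset.range k, formalCoeff a U (i + 1) t * formalCoeff a U (k + 1 - (i + 1)) t
        = ∑ i ∈ Finset.range k, formalCoeff a U (i + 1) t * formalCoeff a U (k - 1 - i + 1) t := by
      refine Finset.sum_congr rfl fun i hi => ?_
      rw [Finset.mem_range] at hi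
      congr 2; omega
    have e2 : (∑ i ∈ Finset.range k, (formalCoeff a U (i + 1) t : ℂ)
        * (formalCoeff a U (k - 1 - i + 1) t : ℂ))
        = ((∑ i ∈ Finset.range k, formalCoeff a U (i + 1) t * formalCoeff a U (k - 1 - i + 1) t : ℝ)
          : ℂ) := by push_cast; rfl
    rw [e1, e2, ← Complex.ofReal_mul, ← Complex.ofReal_add, ← Complex.ofReal_neg, Complex.sub_re,
      Complex.ofReal_re]
    simp
    ring

end Formal

/-! ### Laplace transforms along a half-axis and asymptotic expansion. -/

/-- The Laplace transform of `h` along the half-axis of direction `σ`, normalised so that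
constants are fixed. -/
noncomputable def borelLaplace (σ : ℝ) (ε : ℂ) (h : ℂ → ℂ) : ℂ :=
  σ / ε * laplaceInt (σ / ε) (fun r => h ((σ * r : ℝ) : ℂ))

section Laplace

variable {b κ C D σ : ℝ} {ε : ℂ} {h h' : ℂ → ℂ}

theorem continuous_comp_real_mul (hb : 0 < b) (hh : DifferentiableOn ℂ h {z | |z.im| < b}) (σ : ℝ) :
    Continuous fun r : ℝ => h ((σ * r : ℝ) : ℂ) :=
  continuousOn_univ.1 (hh.continuousOn.comp (s := univ)
    (f := fun r : ℝ => ((σ * r : ℝ) : ℂ)) (by fun_prop) (fun r _ => by simpa using hb))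

theorem norm_comp_real_mul_le (hσ : |σ| = 1)
    (hhb : ∀ x : ℝ, ‖h x‖ ≤ C * Real.exp (κ * |x|)) (r : ℝ) (hr : 0 ≤ r) :
    ‖h ((σ * r : ℝ) : ℂ)‖ ≤ C * Real.exp (κ * r) := by
  have := hhb (σ * r)
  rwa [abs_mul, hσ, one_mul, abs_of_nonneg hr] at this

theorem borelLaplace_eq_add (hb : 0 < b) (hσ : |σ| = 1) (hε : κ < ((σ : ℂ) / ε).re)
    (hd : ∀ z : ℂ, |z.im| < b → HasDerivAt h (h' z) z)
    (hd' : DifferentiableOn ℂ h' {z | |z.im| < b})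
    (hhb : ∀ x : ℝ, ‖h x‖ ≤ C * Real.exp (κ * |x|))
    (hhb' : ∀ x : ℝ, ‖h' x‖ ≤ D * Real.exp (κ * |x|)) :
    borelLaplace σ ε h = h 0 + σ * laplaceInt (σ / ε) (fun r => h' ((σ * r : ℝ) : ℂ)) := by
  have hder : ∀ r : ℝ, HasDerivAt (fun r : ℝ => h ((σ * r : ℝ) : ℂ))
      (σ * h' ((σ * r : ℝ) : ℂ)) r := fun r => by
    have h3 : HasDerivAt (fun r : ℝ => σ * r) σ r := by simpa using (hasDerivAt_id r).const_mul σ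
    have h4 := (hd ((σ * r : ℝ) : ℂ) (by simpa using hb)).comp_ofReal.scomp r h3
    rw [Complex.real_smul] at h4
    exact h4
  have hnσ : ‖(σ : ℂ)‖ = 1 := by simpa using hσ
  rw [borelLaplace, mul_laplaceInt hε hder
    (continuous_const.mul (continuous_comp_real_mul hb hd' σ))
    (norm_comp_real_mul_le hσ hhb) (D := D) (fun r hr => by
      rw [norm_mul, hnσ, one_mul]
      exact norm_comp_real_mul_le hσ hhb' r hr), laplaceInt_const_mul]
  simp

theorem iteratedDeriv_hasDerivAt (hh : DifferentiableOn ℂ h {z | |z.im| < b}) (k : ℕ) {z : ℂ}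
    (hz : |z.im| < b) : HasDerivAt (iteratedDeriv k h) (iteratedDeriv (k + 1) h z) z := by
  rw [iteratedDeriv_succ]
  exact ((hh.iteratedDeriv_of_isOpen (isOpen_strip b) k).differentiableAt
    ((isOpen_strip b).mem_nhds hz)).hasDerivAt

/-- Taylor's formula with a Laplace transform as remainder. -/
theorem borelLaplace_sub_sum (hb : 0 < b) (hκ : 0 ≤ κ) (hC : 0 ≤ C) (hσ : |σ| = 1)
    (hε : κ < ((σ : ℂ) / ε).re) (hh : DifferentiableOn ℂ h {z | |z.im| < b})
    (hhb : ∀ z : ℂ, |z.im| < b → ‖h z‖ ≤ C * Real.exp (κ * ‖z‖)) (N : ℕ) :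
    borelLaplace σ ε h - ∑ k ∈ Finset.range N, ε ^ k * iteratedDeriv k h 0
      = ε ^ N * borelLaplace σ ε (iteratedDeriv N h) := by
  -- At ε = 0 the quotient σ/ε is 0 by convention, which contradicts 0 ≤ κ < Re(σ/ε).
  have hε0 : ε ≠ 0 := by
    rintro rfl
    simp at hε
    linarith
  induction N with
  | zero => simp
  | succ N ih =>
    have h1 := borelLaplace_eq_add hb hσ hε (fun z hz => iteratedDeriv_hasDerivAt hh N hz)
      (hh.iteratedDeriv_of_isOpen (isOpen_strip b) (N + 1))
      (norm_iteratedDeriv_le_exp hb hκ hC hh hhb N)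
      (norm_iteratedDeriv_le_exp hb hκ hC hh hhb (N + 1))
    rw [Finset.sum_range_succ, ← sub_sub, ih, h1, borelLaplace]
    field_simp
    ring

theorem norm_borelLaplace_le (hσ : |σ| = 1) (hε : κ < ((σ : ℂ) / ε).re)
    (hhb : ∀ x : ℝ, ‖h x‖ ≤ C * Real.exp (κ * |x|)) :
    ‖borelLaplace σ ε h‖ ≤ ‖ε‖⁻¹ * (C / (((σ : ℂ) / ε).re - κ)) := by
  rw [borelLaplace, norm_mul]
  have : ‖(σ : ℂ) / ε‖ = ‖ε‖⁻¹ := by simp [hσ]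
  rw [this]
  gcongr
  exact norm_laplaceInt_le hε (norm_comp_real_mul_le hσ hhb)

end Laplace

/-! ### Borel summability of the solution. -/

section BorelSum

variable {b T a κ ρ σ : ℝ} {g : ℂ → ℂ} {U : ℂ × ℂ → ℂ} {ε : ℂ}

theorem IsBorelSolution.norm_borelTransform (hκ : 0 ≤ κ) (hρ : 0 ≤ ρ) (ha : 0 ≤ a)
    (h : IsBorelSolution b T a κ ρ g U) (t : ℝ) {s : ℂ} (hs : |s.im| < b) :
    ‖borelTransform a U t s‖ ≤ (a + ρ) * Real.exp ((κ + 1) * ‖s‖) :=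
  norm_borelTransform_le hκ hρ ha h.bound t hs

/-- The solution is the Laplace transform of the Borel transform. -/
theorem IsBorelSolution.borelSum_eq_borelLaplace (hb : 0 < b) (hκ : 0 ≤ κ) (hρ : 0 ≤ ρ)
    (ha : 0 ≤ a) (h : IsBorelSolution b T a κ ρ g U) (hσ : |σ| = 1)
    (hε : κ + 1 < ((σ : ℂ) / ε).re) (t : ℝ) :
    borelSum a U σ ε t = borelLaplace σ ε (borelTransform a U t) := by
  rw [borelLaplace_eq_add hb hσ hε (fun z hz => hasDerivAt_borelTransform h.adm.holo t hz)
    (differentiableOn_timeSlice h.adm.holo t) (C := a + ρ) (D := ρ), borelTransform_zero]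
  · rfl
  · intro x
    simpa using h.norm_borelTransform hκ hρ ha t (s := x) (by simpa using hb)
  · intro x
    have := h.bound _ (real_mem_biStrip hb t x)
    rw [Complex.norm_real, Real.norm_eq_abs] at this
    refine this.trans ?_
    gcongr
    linarith

/-- The remainder is ε^N times the normalised Laplace transform of the N-th s-derivative of the
Borel transform, so it suffices to bound that transform uniformly in ε and t. -/
theorem IsBorelSolution.norm_borelSum_sub_sum_le (hb : 0 < b) (hκ : 0 ≤ κ) (hρ : 0 ≤ ρ)
    (ha : 0 ≤ a) (h : IsBorelSolution b T a κ ρ g U) (N : ℕ) :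
    ∃ C : ℝ, ∀ (ε : ℝ) (t : ℝ), ε ≠ 0 → 2 * (κ + 1) ≤ |ε|⁻¹ →
      ‖borelSum a U (if 0 < ε then 1 else -1) ε t
        - ∑ k ∈ Finset.range N, (ε : ℂ) ^ k * (formalCoeff a U k t : ℂ)‖ ≤ C * |ε| ^ N := by
  set D : ℝ := N.factorial * ((a + ρ) * Real.exp ((κ + 1) * (b / 2))) / (b / 2) ^ N with hD
  -- The factor 2 bounds |ε|⁻¹/(|ε|⁻¹ - (κ+1)), by the condition 2(κ+1) ≤ |ε|⁻¹.
  refine ⟨2 * D, fun ε t hε0 hε => ?_⟩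
  obtain ⟨σ, hσeq⟩ : ∃ σ : ℝ, σ = if 0 < ε then 1 else -1 := ⟨_, rfl⟩
  have hσ : |σ| = 1 := by rw [hσeq]; split_ifs <;> simp
  have hre : ((σ : ℂ) / (ε : ℂ)).re = |ε|⁻¹ := by
    rw [← Complex.ofReal_div, Complex.ofReal_re, hσeq]
    split_ifs with hpos
    · rw [abs_of_pos hpos, one_div]
    · rw [abs_of_neg (lt_of_le_of_ne (not_lt.1 hpos) hε0), inv_neg, neg_div, one_div]
  have hlt : κ + 1 < ((σ : ℂ) / (ε : ℂ)).re := by rw [hre]; linarith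
  rw [← hσeq, h.borelSum_eq_borelLaplace hb hκ hρ ha hσ hlt]
  simp only [ofReal_formalCoeff hb h.adm]
  have hd := differentiableOn_borelTransform (a := a) h.adm.holo t
  have hn := fun (z : ℂ) (hz : |z.im| < b) => h.norm_borelTransform hκ hρ ha t hz
  rw [borelLaplace_sub_sum hb (by linarith) (by linarith) hσ hlt hd hn, norm_mul, norm_pow,
    Complex.norm_real, Real.norm_eq_abs, mul_comm]
  gcongr
  have h1 := norm_borelLaplace_le hσ hlt
    (norm_iteratedDeriv_le_exp hb (by linarith) (by linarith) hd hn N)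
  rw [hre, Complex.norm_real, Real.norm_eq_abs] at h1
  refine h1.trans ?_
  have hD0 : 0 ≤ D := by positivity
  have h2 : 0 < |ε|⁻¹ - (κ + 1) := by linarith
  rw [← mul_div_assoc, div_le_iff₀ h2]
  nlinarith [mul_nonneg hD0 (by linarith : 0 ≤ |ε|⁻¹ - 2 * (κ + 1))]

theorem borelLaplace_one (B : ℂ → ℂ) (ε : ℂ) :
    borelLaplace 1 ε B = 1 / ε * ∫ s : ℝ in Ioi 0, Complex.exp (-((s : ℂ) / ε)) * B s := by
  simp only [borelLaplace, laplaceInt, Complex.ofReal_one, one_mul]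
  congr 2
  ext r
  congr 3
  ring

theorem borelLaplace_neg_one (B : ℂ → ℂ) (ε : ℂ) :
    borelLaplace (-1) ε B = 1 / ε * -∫ s : ℝ in Iio 0, Complex.exp (-((s : ℂ) / ε)) * B s := by
  have := integral_comp_neg_Ioi (0 : ℝ) fun s : ℝ => Complex.exp (-((s : ℂ) / ε)) * B s
  rw [neg_zero, integral_Iic_eq_integral_Iio] at this
  rw [← this]
  simp only [borelLaplace, laplaceInt, Complex.ofReal_neg, Complex.ofReal_one, neg_mul, one_mul]
  rw [neg_div, neg_mul, mul_neg]
  congr 3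
  ext r
  congr 3
  ring

theorem IsBorelSolution.integrableOn (hb : 0 < b) (hκ : 0 ≤ κ) (hρ : 0 ≤ ρ)
    (ha : 0 ≤ a) (h : IsBorelSolution b T a κ ρ g U) (hσ : |σ| = 1)
    (hε : κ + 1 < ((σ : ℂ) / ε).re) (t : ℝ) :
    IntegrableOn (fun r : ℝ => Complex.exp (-(σ / ε * r)) * borelTransform a U t ((σ * r : ℝ) : ℂ))
      (Ioi 0) :=
  integrableOn_laplace hε
    (continuous_comp_real_mul hb (differentiableOn_borelTransform h.adm.holo t) σ)
    (norm_comp_real_mul_le hσ (C := a + ρ) fun x => by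
      simpa using h.norm_borelTransform hκ hρ ha t (s := x) (by simpa using hb))

/-- The direction of the half-axis along which the Laplace integral runs. -/
noncomputable def axisSign (ε : ℂ) : ℝ := if 0 < (ε⁻¹).re then 1 else -1

theorem abs_axisSign (ε : ℂ) : |axisSign ε| = 1 := by
  rw [axisSign]; split_ifs <;> simp

theorem axisSign_div_re (ε : ℂ) : ((axisSign ε : ℂ) / ε).re = |(ε⁻¹).re| := by
  rw [axisSign, div_eq_mul_inv, Complex.re_ofReal_mul]
  split_ifs with h
  · rw [abs_of_pos h, one_mul]
  · rw [abs_of_nonpos (not_lt.1 h), neg_one_mul]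

theorem axisSign_ofReal {ε : ℝ} : axisSign ε = if 0 < ε then 1 else -1 := by
  rw [axisSign, ← Complex.ofReal_inv, Complex.ofReal_re]
  simp only [inv_pos]

theorem isOpen_setOf_lt_inv_re {R : ℝ} (hR : 0 < R) (σ : ℝ) :
    IsOpen {ε : ℂ | R⁻¹ < σ * (ε⁻¹).re} := by
  rw [isOpen_iff_mem_nhds]
  intro ε hε
  have hε' : R⁻¹ < σ * (ε⁻¹).re := hε
  have hε0 : ε ≠ 0 := by
    rintro rfl
    simp at hε'
    linarith
  have hc : ContinuousAt (fun ε : ℂ => σ * (ε⁻¹).re) ε :=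
    continuousAt_const.mul (Complex.continuous_re.continuousAt.comp (continuousAt_inv₀ hε0))
  exact hc.eventually (lt_mem_nhds hε')

/-- Near each point of the two discs the sign σ is constant, so the sum is locally a single
holomorphic Laplace integral evaluated at σ/ε. -/
theorem IsBorelSolution.analyticOnNhd_borelSum (hb : 0 < b) (hκ : 0 ≤ κ)
    (h : IsBorelSolution b T a κ ρ g U) (t : ℝ) :
    AnalyticOnNhd ℂ (fun ε => borelSum a U (axisSign ε) ε t) (twoDiscs (1 / (κ + 1))) := by
  have hR : 0 < 1 / (κ + 1) := by positivity
  intro ε hε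
  have hε' : (1 / (κ + 1))⁻¹ < |(ε⁻¹).re| := hε
  set σ := axisSign ε with hσ
  have hdir : ∀ z : ℂ, ((σ : ℂ) / z).re = σ * (z⁻¹).re := fun z => by
    rw [div_eq_mul_inv, Complex.re_ofReal_mul]
  have hmem : ε ∈ {z : ℂ | (1 / (κ + 1))⁻¹ < σ * (z⁻¹).re} := by
    show (1 / (κ + 1))⁻¹ < σ * (ε⁻¹).re
    rwa [← hdir, axisSign_div_re]
  have hopen := isOpen_setOf_lt_inv_re hR σ
  have hnhds := hopen.mem_nhds hmem
  have hκR : (1 / (κ + 1))⁻¹ = κ + 1 := by simp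
  have hdiff : DifferentiableOn ℂ (fun ε => borelSum a U σ ε t)
      {z : ℂ | (1 / (κ + 1))⁻¹ < σ * (z⁻¹).re} := by
    intro z hz
    have hz' : (1 / (κ + 1))⁻¹ < σ * (z⁻¹).re := hz
    rw [hκR] at hz'
    have hz0 : z ≠ 0 := by
      rintro rfl
      simp at hz'
      linarith
    have h1 : DifferentiableAt ℂ (fun p => laplaceInt p (realSlice U σ t)) ((σ : ℂ) / z) :=
      differentiableAt_laplaceInt (κ := κ) (by rw [hdir]; linarith)
        (continuous_realSlice hb h.adm.holo σ t)
        (norm_realSlice_le hb h.bound (abs_axisSign ε) t)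
    have h2 : DifferentiableAt ℂ (fun z : ℂ => (σ : ℂ) / z) z :=
      (differentiableAt_const _).div differentiableAt_id hz0
    exact (((h1.comp z h2).const_mul (σ : ℂ)).const_add (a : ℂ)).differentiableWithinAt
  refine (hdiff.analyticAt hnhds).congr ?_
  filter_upwards [hnhds] with z hz
  have hz' : (1 / (κ + 1))⁻¹ < σ * (z⁻¹).re := hz
  have hpos : 0 < σ * (z⁻¹).re := (inv_pos.2 hR).trans hz'
  have : axisSign z = σ := by
    rw [hσ] at hpos ⊢
    rw [axisSign, axisSign] at *
    split_ifs at hpos ⊢ <;> first | rfl | linarith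
  rw [this]

/-- Borel summability of the solution. -/
theorem IsBorelSolution.isBorelSum (hb : 0 < b) (hκ : 0 ≤ κ) (hρ : 0 ≤ ρ)
    (ha : 0 ≤ a) (h : IsBorelSolution b T a κ ρ g U) (t : ℝ) :
    IsBorelSum (1 / (κ + 1)) b (a + ρ) (fun k => (formalCoeff a U k t : ℂ))
      (borelTransform a U t) (fun ε => borelSum a U (axisSign ε) ε t) := by
  have hκR : (1 / (κ + 1))⁻¹ = κ + 1 := by simp
  have hright : ∀ ε : ℂ, (1 / (κ + 1))⁻¹ < (ε⁻¹).re →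
      axisSign ε = 1 ∧ κ + 1 < (((1 : ℝ) : ℂ) / ε).re := fun ε hε => by
    rw [hκR] at hε
    refine ⟨by rw [axisSign, if_pos (by linarith)], ?_⟩
    simpa using hε
  have hleft : ∀ ε : ℂ, (ε⁻¹).re < -(1 / (κ + 1))⁻¹ →
      axisSign ε = -1 ∧ κ + 1 < (((-1 : ℝ) : ℂ) / ε).re := fun ε hε => by
    rw [hκR] at hε
    refine ⟨by rw [axisSign, if_neg (by linarith)], ?_⟩
    rw [div_eq_mul_inv, Complex.re_ofReal_mul]
    linarith
  refine ⟨fun s hs => hasSum_borelTransform hb h.adm t hs,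
    (differentiableOn_borelTransform h.adm.holo t).analyticOnNhd (isOpen_strip b), fun s hs => ?_,
    h.analyticOnNhd_borelSum hb hκ t, fun ε hε => ?_, fun ε hε => ?_, fun ε hε => ?_, fun ε hε => ?_⟩
  · have := h.norm_borelTransform hκ hρ ha t hs
    rwa [div_div_eq_mul_div, div_one, mul_comm ‖s‖]
  · have := h.integrableOn hb hκ hρ ha (by simp) (hright ε hε).2 t
    refine this.congr_fun (fun r _ => ?_) measurableSet_Ioi
    simp only [Complex.ofReal_one, one_mul]
    congr 3
    ring
  · simp only [(hright ε hε).1]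
    rw [h.borelSum_eq_borelLaplace hb hκ hρ ha (by simp) (hright ε hε).2, borelLaplace_one]
  · have := h.integrableOn hb hκ hρ ha (by simp) (hleft ε hε).2 t
    refine ((Measure.measurePreserving_neg (volume : Measure ℝ)).integrableOn_comp_preimage
      (Homeomorph.neg ℝ).measurableEmbedding).1 ?_
    have hpre : (Neg.neg ⁻¹' Iio (0 : ℝ)) = Ioi 0 := by ext; simp
    rw [hpre]
    refine this.congr_fun (fun r _ => ?_) measurableSet_Ioi
    simp only [Function.comp_apply, Complex.ofReal_neg, Complex.ofReal_one, neg_mul, one_mul]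
    congr 3
    ring
  · simp only [(hleft ε hε).1]
    rw [h.borelSum_eq_borelLaplace hb hκ hρ ha (by simp) (hleft ε hε).2, borelLaplace_neg_one]

end BorelSum

/-! ### Uniqueness of the periodic solution near a. -/

/-- The function e^{ct}F(t) is nonincreasing, and boundedness of F makes it tend to 0 as t → -∞, so
it is nowhere positive. -/
theorem eq_zero_of_deriv_le_neg_mul {F F' : ℝ → ℝ} {c M : ℝ} (hc : 0 < c)
    (hF : ∀ t, HasDerivAt F (F' t) t) (hle : ∀ t, F' t ≤ -c * F t) (h0 : ∀ t, 0 ≤ F t)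
    (hM : ∀ t, F t ≤ M) (t : ℝ) : F t = 0 := by
  have hexp : ∀ s : ℝ, HasDerivAt (fun s => Real.exp (c * s)) (Real.exp (c * s) * c) s := fun s => by
    have : HasDerivAt (fun s : ℝ => c * s) c s := by simpa using (hasDerivAt_id s).const_mul c
    exact this.exp
  have hG : ∀ s, HasDerivAt (fun s => Real.exp (c * s) * F s)
      (Real.exp (c * s) * c * F s + Real.exp (c * s) * F' s) s := fun s => (hexp s).mul (hF s)
  have hanti : Antitone fun s => Real.exp (c * s) * F s := by
    refine antitone_of_deriv_nonpos (fun s => (hG s).differentiableAt) fun s => ?_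
    rw [(hG s).deriv]
    have := mul_le_mul_of_nonneg_left (hle s) (Real.exp_pos (c * s)).le
    linarith
  have hlim : Tendsto (fun s => Real.exp (c * s) * M) atBot (𝓝 0) := by
    have : Tendsto (fun s : ℝ => c * s) atBot atBot := tendsto_id.const_mul_atBot hc
    simpa using (Real.tendsto_exp_atBot.comp this).mul_const M
  have h1 : Real.exp (c * t) * F t ≤ 0 := by
    refine ge_of_tendsto hlim ?_
    filter_upwards [eventually_le_atBot t] with s hs
    exact (hanti hs).trans (mul_le_mul_of_nonneg_left (hM s) (Real.exp_pos _).le)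
  refine le_antisymm ?_ (h0 t)
  by_contra! hpos
  exact absurd h1 (not_le.2 (mul_pos (Real.exp_pos _) hpos))

theorem exists_norm_le_of_continuous_of_periodic {y : ℝ → ℂ} {T : ℝ} (hc : Continuous y)
    (hT : T ≠ 0) (hp : Function.Periodic y T) : ∃ M, ∀ t, ‖y t‖ ≤ M := by
  obtain ⟨M, hM⟩ := (isBounded_iff_forall_norm_le).1 (hp.isBounded_of_continuous hT hc)
  exact ⟨M, fun t => hM _ (mem_range_self t)⟩

/-- Dissipation for the linearised equation: if `v' = - ε q (v - w)` and
`w' = - w / ε - ε q (v - w)`, then `‖v‖² + ‖w‖²` decreases along `ε⁻¹ t`. -/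
theorem dissipation_le {a ε : ℝ} (ha : 0 < a) (hε : 4 * a * ε ^ 2 ≤ 1) {q : ℂ}
    (hq : ‖q - 2 * a‖ ≤ a / 2) (v w : ℂ) :
    2 * inner ℝ v (-(ε ^ 2 * q * (v - w))) + 2 * inner ℝ w (-w - ε ^ 2 * q * (v - w))
      ≤ -(2 * a * ε ^ 2) * (‖v‖ ^ 2 + ‖w‖ ^ 2) := by
  have h1 := (Complex.abs_re_le_norm _).trans hq
  have h2 := (Complex.abs_im_le_norm _).trans hq
  have e2 : (2 * (a : ℂ)) = ((2 * a : ℝ) : ℂ) := by push_cast; rfl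
  have e3 : ((ε : ℂ) ^ 2) = ((ε ^ 2 : ℝ) : ℂ) := by push_cast; rfl
  rw [e2, Complex.sub_re, Complex.ofReal_re, abs_le] at h1
  rw [e2, Complex.sub_im, Complex.ofReal_im, sub_zero, abs_le] at h2
  rw [e3, Complex.inner, Complex.inner, ← Complex.normSq_eq_norm_sq, ← Complex.normSq_eq_norm_sq,
    Complex.normSq_apply, Complex.normSq_apply]
  obtain ⟨q1, q2⟩ := q
  obtain ⟨v1, v2⟩ := v
  obtain ⟨w1, w2⟩ := w
  simp only at h1 h2 ⊢
  simp only [Complex.mul_re, Complex.conj_re, Complex.conj_im, Complex.neg_re, Complex.neg_im,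
    Complex.mul_im, Complex.sub_re, Complex.sub_im, Complex.ofReal_re, Complex.ofReal_im]
  set e := ε ^ 2 with he
  have he0 : 0 ≤ e := sq_nonneg ε
  have hv : 0 ≤ v1 ^ 2 + v2 ^ 2 := by positivity
  have hw : 0 ≤ w1 ^ 2 + w2 ^ 2 := by positivity
  -- In these variables the mixed terms with Re q cancel, and only Im q couples v and w. With Re q
  -- between 3a/2 and 5a/2, the coefficient of |v|² becomes at most -3aε² + aε². That of |w|²
  -- becomes at most 6aε² - 2, which is at most -2aε² exactly when 4aε² ≤ 1.
  have k1 : q2 * (v2 * w1 - v1 * w2) ≤ a / 2 * ((v1 ^ 2 + v2 ^ 2 + (w1 ^ 2 + w2 ^ 2)) / 2) := by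
    have m1 : |v2 * w1 - v1 * w2| ≤ (v1 ^ 2 + v2 ^ 2 + (w1 ^ 2 + w2 ^ 2)) / 2 := by
      rw [abs_le]
      constructor <;> nlinarith [sq_nonneg (v2 - w1), sq_nonneg (v1 + w2), sq_nonneg (v2 + w1),
        sq_nonneg (v1 - w2)]
    have m2 : |q2| ≤ a / 2 := abs_le.2 h2
    calc _ ≤ |q2 * (v2 * w1 - v1 * w2)| := le_abs_self _
      _ = |q2| * |v2 * w1 - v1 * w2| := abs_mul _ _
      _ ≤ _ := by gcongr
  have k2 : (3 * a / 2) * (v1 ^ 2 + v2 ^ 2) ≤ q1 * (v1 ^ 2 + v2 ^ 2) :=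
    mul_le_mul_of_nonneg_right (by linarith [h1.1]) hv
  have k3 : q1 * (w1 ^ 2 + w2 ^ 2) ≤ (5 * a / 2) * (w1 ^ 2 + w2 ^ 2) :=
    mul_le_mul_of_nonneg_right (by linarith [h1.2]) hw
  have k4 : 0 ≤ (1 - 4 * a * e) * (w1 ^ 2 + w2 ^ 2) := mul_nonneg (by linarith) hw
  have k5 := mul_le_mul_of_nonneg_left (add_le_add (add_le_add (mul_le_mul_of_nonneg_left k1
    (by norm_num : (0 : ℝ) ≤ 2)) k3) (neg_le_neg k2)) he0
  nlinarith [k5, k4]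

/-- Two bounded solutions near `a` coincide. -/
theorem IsPeriodicSolution.eq_of_near {f : ℝ → ℝ} {ω S T a ε : ℝ} {x y : ℝ → ℂ} (ha : 0 < a)
    (hε0 : ε ≠ 0) (hε : 4 * a * ε ^ 2 ≤ 1) (hS : S ≠ 0) (hT : T ≠ 0)
    (hx : IsPeriodicSolution f ω S ε x) (hy : IsPeriodicSolution f ω T ε y)
    (hxa : ∀ t, ‖x t - (a : ℂ)‖ ≤ a / 4) (hya : ∀ t, ‖y t - (a : ℂ)‖ ≤ a / 4) : y = x := by
  have hεc : (ε : ℂ) ≠ 0 := by exact_mod_cast hε0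
  have hbd : ∀ {S : ℝ} {x : ℝ → ℂ}, S ≠ 0 → IsPeriodicSolution f ω S ε x →
      ∃ M, ∀ t, ‖x t‖ ≤ M ∧ ‖deriv x t‖ ≤ M := by
    intro S x hS hx
    obtain ⟨M, hM⟩ := exists_norm_le_of_continuous_of_periodic hx.differentiable.continuous hS
      hx.periodic
    have hper : Function.Periodic (deriv x) S := fun t => by
      rw [← deriv_comp_add_const, funext hx.periodic]
    obtain ⟨M', hM'⟩ := exists_norm_le_of_continuous_of_periodic hx.differentiable_deriv.continuous
      hS hper
    exact ⟨max M M', fun t => ⟨(hM t).trans (le_max_left _ _), (hM' t).trans (le_max_right _ _)⟩⟩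
  obtain ⟨M, hM⟩ := hbd hS hx
  obtain ⟨M', hM'⟩ := hbd hT hy
  set z : ℝ → ℂ := fun t => y t - x t with hz
  set w : ℝ → ℂ := fun t => ε * (deriv y t - deriv x t) with hw
  -- The combination z + εż is the slow variable: the damping term ż drops out of its derivative.
  -- The fast variable w = εż carries the damping.
  set v : ℝ → ℂ := fun t => z t + w t with hv
  have hzM : ∀ t, ‖z t‖ ≤ M' + M := fun t =>
    (norm_sub_le _ _).trans (add_le_add (hM' t).1 (hM t).1)
  have hwM : ∀ t, ‖w t‖ ≤ |ε| * (M' + M) := fun t => by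
    rw [hw, norm_mul, Complex.norm_real, Real.norm_eq_abs]
    gcongr
    exact (norm_sub_le _ _).trans (add_le_add (hM' t).2 (hM t).2)
  have hzd : ∀ t, HasDerivAt z (deriv y t - deriv x t) t := fun t =>
    (hy.differentiable t).hasDerivAt.sub (hx.differentiable t).hasDerivAt
  have hwd : ∀ t, HasDerivAt w (-(deriv y t - deriv x t) - ε * (y t + x t) * z t) t := fun t => by
    refine (((hy.differentiable_deriv t).hasDerivAt.sub
      (hx.differentiable_deriv t).hasDerivAt).const_mul (ε : ℂ)).congr_deriv ?_
    have e1 := hx.equation t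
    have e2 := hy.equation t
    simp only [hz]
    linear_combination e2 - e1
  have hvd : ∀ t, HasDerivAt v (-(ε * (y t + x t) * z t)) t := fun t =>
    ((hzd t).add (hwd t)).congr_deriv (by ring)
  have hlin : ∀ t : ℝ, HasDerivAt (fun t : ℝ => ε * t) ε t := fun t => by
    simpa using (hasDerivAt_id t).const_mul ε
  -- After rescaling time by ε only ε² occurs, so both signs of ε are treated at once.
  have hF : ∀ t, HasDerivAt (fun t => ‖v (ε * t)‖ ^ 2 + ‖w (ε * t)‖ ^ 2)
      (2 * inner ℝ (v (ε * t)) (-(ε ^ 2 * (y (ε * t) + x (ε * t)) * (v (ε * t) - w (ε * t))))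
        + 2 * inner ℝ (w (ε * t)) (-w (ε * t)
          - ε ^ 2 * (y (ε * t) + x (ε * t)) * (v (ε * t) - w (ε * t)))) t := fun t => by
    have hv1 := (hvd (ε * t)).scomp t (hlin t)
    have hw1 := (hwd (ε * t)).scomp t (hlin t)
    refine (hv1.norm_sq.add hw1.norm_sq).congr_deriv ?_
    simp only [Function.comp_apply]
    congr 3
    · rw [Complex.real_smul]; simp only [hv]; ring
    · rw [Complex.real_smul]; simp only [hv, hw]; ring
  have hq : ∀ t, ‖y t + x t - 2 * a‖ ≤ a / 2 := fun t => by
    have : y t + x t - 2 * a = (y t - a) + (x t - a) := by ring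
    rw [this]
    linarith [norm_add_le (y t - a) (x t - a), hxa t, hya t]
  have hzero := eq_zero_of_deriv_le_neg_mul (c := 2 * a * ε ^ 2)
    (M := ((M' + M) + |ε| * (M' + M)) ^ 2 + (|ε| * (M' + M)) ^ 2) (by positivity) hF
    (fun t => dissipation_le ha hε (hq _) _ _) (fun t => by positivity) (fun t => by
      gcongr
      · exact (norm_add_le _ _).trans (add_le_add (hzM _) (hwM _))
      · exact hwM _)
  funext t
  have h1 := hzero (t / ε)
  rw [mul_div_cancel₀ t hε0] at h1
  have h2 : ‖v t‖ ^ 2 = 0 := by nlinarith [sq_nonneg ‖v t‖, sq_nonneg ‖w t‖]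
  have h3 : ‖w t‖ ^ 2 = 0 := by nlinarith [sq_nonneg ‖v t‖, sq_nonneg ‖w t‖]
  have h4 : v t = 0 := by simpa using h2
  have h5 : w t = 0 := by simpa using h3
  have h6 : z t = 0 := by simpa [hv, h5] using h4
  exact sub_eq_zero.1 h6

/-! ### The Borel sum as a real periodic solution close to a. -/

section Solution

variable {b T a κ ρ σ : ℝ} {g : ℂ → ℂ} {U : ℂ × ℂ → ℂ} {ε : ℂ}

theorem IsBorelSolution.isPeriodicSolution (hb : 0 < b) (hκ : 0 ≤ κ) (hρ : 0 ≤ ρ)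
    (h : IsBorelSolution b T a κ ρ g U) {f : ℝ → ℝ} {ω : ℝ}
    (hf : ∀ t : ℝ, g t + a ^ 2 = f (ω * t)) (hσ : |σ| = 1) (hε : κ < ((σ : ℂ) / ε).re) :
    IsPeriodicSolution f ω T ε (borelSum a U σ ε) := by
  have hε0 : ε ≠ 0 := by
    rintro rfl
    simp at hε
    linarith
  obtain ⟨y, hy, hy'⟩ := h.hasDerivAt_borelSum hb hκ hρ hσ hε
  have hdy : deriv (borelSum a U σ ε) = y := funext fun t => (hy t).deriv
  refine ⟨fun t => (hy t).differentiableAt, ?_, fun t => ?_, fun t => ?_⟩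
  · rw [hdy]
    exact fun t => (hy' t).differentiableAt
  · rw [hdy, (hy' t).deriv, ← hf t]
    field_simp
    ring
  · have : realSlice U σ (t + T) = realSlice U σ t := funext fun r => by
      have := h.adm.per _ (real_mem_biStrip hb t (σ * r))
      simp only [realSlice]
      push_cast at this ⊢
      exact this
    rw [borelSum, borelSum, this]

theorem norm_borelSum_sub_le (hb : 0 < b) (h : IsBorelSolution b T a κ ρ g U) (hσ : |σ| = 1)
    (hε : κ < ((σ : ℂ) / ε).re) (t : ℝ) :
    ‖borelSum a U σ ε t - a‖ ≤ ρ / (((σ : ℂ) / ε).re - κ) := by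
  have : ‖(σ : ℂ)‖ = 1 := by simpa using hσ
  rw [borelSum, add_sub_cancel_left, norm_mul, this, one_mul]
  exact norm_laplaceInt_le hε (norm_realSlice_le hb h.bound hσ t)

theorem borelSum_im_eq_zero (hb : 0 < b) (hU : Admissible b T U) (σ ε t : ℝ) :
    (borelSum a U σ ε t).im = 0 := by
  rw [← Complex.conj_eq_iff_im, borelSum, map_add, map_mul, Complex.conj_ofReal, Complex.conj_ofReal,
    laplaceInt, ← integral_conj]
  congr 3
  ext r
  have h1 := hU.conj_timeSlice t ((σ * r : ℝ) : ℂ) (by simpa using hb)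
  rw [Complex.conj_ofReal] at h1
  rw [map_mul, ← Complex.exp_conj, realSlice, ← h1]
  simp

end Solution

/-! ### The forcing term and the final assembly. -/

section Forcing

variable {f : ℝ → ℝ} {ω : ℝ}

/-- The analysis uses the positive period 2π/|ω|, whereas the theorem speaks of 2π/ω, which may be
negative. -/
theorem Function.Periodic.of_div_abs {α : Type*} {F : ℝ → α} {P : ℝ}
    (h : Function.Periodic F (P / |ω|)) : Function.Periodic F (P / ω) := by
  rcases abs_choice ω with hω | hω
  · rwa [hω] at h
  · rw [hω, div_neg] at h
    simpa using h.neg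

theorem periodic_comp_mul_left (hω : ω ≠ 0) {P : ℝ} (hper : Function.Periodic f P) :
    Function.Periodic (fun t => f (ω * t)) (P / |ω|) := by
  have h1 : Function.Periodic (fun t => f (ω * t)) (P / ω) := fun t => by
    have : ω * (t + P / ω) = ω * t + P := by field_simp
    simp only [this, hper (ω * t)]
  rcases abs_choice ω with h | h
  · rwa [h]
  · rw [h, div_neg]
    exact h1.neg

theorem integral_comp_mul_left_eq_forcingMean (hω : ω ≠ 0)
    (hper : Function.Periodic f (2 * Real.pi)) :
    ∫ t in (0 : ℝ)..(2 * Real.pi / |ω|), f (ω * t) = 2 * Real.pi / |ω| * forcingMean f := by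
  rw [intervalIntegral.integral_comp_mul_left f hω, mul_zero, forcingMean, smul_eq_mul]
  have hπ := Real.pi_ne_zero
  rcases lt_or_gt_of_ne hω with h | h
  · have e1 : ω * (2 * Real.pi / |ω|) = -(2 * Real.pi) := by rw [abs_of_neg h]; field_simp
    have e2 := hper.intervalIntegral_add_eq (-(2 * Real.pi)) 0
    rw [neg_add_cancel, zero_add] at e2
    rw [e1, intervalIntegral.integral_symm, e2, abs_of_neg h]
    field_simp
  · have e1 : ω * (2 * Real.pi / |ω|) = 2 * Real.pi := by rw [abs_of_pos h]; field_simp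
    rw [e1, abs_of_pos h]
    field_simp

/-- The oscillating part of the forcing extends to a bounded holomorphic function on a strip, and
the Borel transform of the equation has a solution. -/
theorem exists_isBorelSolution_forcing (hω : ω ≠ 0) (hf : AnalyticOnNhd ℝ f univ)
    (hper : Function.Periodic f (2 * Real.pi)) (hmean : 0 < forcingMean f) :
    ∃ b > 0, ∃ κ > 0, ∃ ρ > 0, ∃ (g : ℂ → ℂ) (U : ℂ × ℂ → ℂ),
      (∀ t : ℝ, g t = ((f (ω * t) - forcingMean f : ℝ) : ℂ)) ∧
      IsBorelSolution b (2 * Real.pi / |ω|) (Real.sqrt (forcingMean f)) κ ρ g U := by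
  have hT : 0 < 2 * Real.pi / |ω| := div_pos (by positivity) (abs_pos.2 hω)
  have han : AnalyticOnNhd ℝ (fun t => f (ω * t) - forcingMean f) univ := fun t _ => by
    have h1 : AnalyticAt ℝ (fun t : ℝ => ω * t) t := analyticAt_const.mul analyticAt_id
    exact ((hf (ω * t) (mem_univ _)).comp h1).sub analyticAt_const
  obtain ⟨b, hb, g, hgd, hgr, hgp, hgc, M, hM⟩ := exists_periodic_holomorphic_extension han hT
    (fun t => by simp only [periodic_comp_mul_left hω hper t])
  have hint : ∫ τ in (0 : ℝ)..(2 * Real.pi / |ω|), g τ = 0 := by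
    simp only [hgr]
    rw [intervalIntegral.integral_ofReal, intervalIntegral.integral_sub,
      integral_comp_mul_left_eq_forcingMean hω hper]
    · simp
    · refine Continuous.intervalIntegrable ?_ _ _
      exact (continuousOn_univ.1 hf.continuousOn).comp (continuous_const.mul continuous_id)
    · exact intervalIntegrable_const
  obtain ⟨κ, hκ, ρ, hρ, U, hU⟩ := exists_isBorelSolution (Real.sqrt_pos.2 hmean) hb hT hgd hgp hgc
    hint hM
  exact ⟨b, hb, κ, hκ, ρ, hρ, g, U, hgr, hU⟩

end Forcing

section Response

variable {b a κ ρ ω : ℝ} {f : ℝ → ℝ} {g : ℂ → ℂ} {U : ℂ × ℂ → ℂ}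

theorem IsBorelSolution.isFormalPeriodicSolution (hb : 0 < b)
    (h : IsBorelSolution b (2 * Real.pi / |ω|) a κ ρ g U)
    (hf : ∀ t : ℝ, g t + (a : ℂ) ^ 2 = f (ω * t)) :
    IsFormalPeriodicSolution f ω a (formalCoeff a U) := by
  refine ⟨analyticOnNhd_formalCoeff hb h.adm.holo,
    fun k => (h.adm.timeSlice_periodic hb k).of_div_abs, formalCoeff_zero, fun k t => ?_⟩
  have : (g t).re + a ^ 2 = f (ω * t) := by
    have := congrArg Complex.re (hf t)
    rwa [Complex.add_re, Complex.ofReal_re, ← Complex.ofReal_pow, Complex.ofReal_re] at this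
  rw [h.deriv_formalCoeff hb, this]

theorem IsBorelSolution.isPeriodicSolution_axisSign (hb : 0 < b) (hκ : 0 ≤ κ) (hρ : 0 ≤ ρ)
    (h : IsBorelSolution b (2 * Real.pi / |ω|) a κ ρ g U)
    (hf : ∀ t : ℝ, g t + (a : ℂ) ^ 2 = f (ω * t)) {ε : ℂ} (hε : κ < |(ε⁻¹).re|) :
    IsPeriodicSolution f ω (2 * Real.pi / ω) ε (borelSum a U (axisSign ε) ε) := by
  have := h.isPeriodicSolution hb hκ hρ hf (abs_axisSign ε) (by rwa [axisSign_div_re])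
  exact ⟨this.1, this.2, this.3, this.4.of_div_abs⟩

theorem IsBorelSolution.isForcedResponse (hω : ω ≠ 0) (ha : 0 < a) (hb : 0 < b) (hκ : 0 ≤ κ)
    (hρ : 0 < ρ) (h : IsBorelSolution b (2 * Real.pi / |ω|) a κ ρ g U)
    (hf : ∀ t : ℝ, g t + (a : ℂ) ^ 2 = f (ω * t)) :
    IsForcedResponse f ω a (2 * (κ + 1) + 4 * ρ / a + 2 * (a + 1))⁻¹ (a / 4) (formalCoeff a U)
      (fun ε => borelSum a U (axisSign ε) ε) := by
  -- One summand for each demand on |ε|⁻¹: 2(κ+1) for the expansion, κ + 4ρ/a for the distance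
  -- ρ/(|ε|⁻¹ - κ) to a to be below a/4, and 2(a+1) for 4aε² ≤ 1. The choice δ = a/4 keeps the sum
  -- of two nearby solutions within a/2 of 2a.
  set E := 2 * (κ + 1) + 4 * ρ / a + 2 * (a + 1) with hE
  have hra : 0 < 4 * ρ / a := by positivity
  have hE0 : 0 < E := by positivity
  have hlt : ∀ ε : ℝ, 0 < |ε| → |ε| < E⁻¹ → E < |((ε : ℂ)⁻¹).re| := fun ε h0 h1 => by
    rw [← Complex.ofReal_inv, Complex.ofReal_re, abs_inv]
    exact (lt_inv_comm₀ h0 hE0).1 h1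
  have hsol : ∀ ε : ℝ, 0 < |ε| → |ε| < E⁻¹ →
      IsPeriodicSolution f ω (2 * Real.pi / ω) ε (borelSum a U (axisSign ε) ε) :=
    fun ε h0 h1 => h.isPeriodicSolution_axisSign hb hκ hρ.le hf (by linarith [hlt ε h0 h1])
  have hnear : ∀ ε : ℝ, 0 < |ε| → |ε| < E⁻¹ → ∀ t,
      ‖borelSum a U (axisSign ε) ε t - (a : ℂ)‖ < a / 4 := fun ε h0 h1 t => by
    have h2 := hlt ε h0 h1
    have h3 := norm_borelSum_sub_le hb h (abs_axisSign ε) (by rw [axisSign_div_re]; linarith) t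
    rw [axisSign_div_re] at h3
    have h4 : 4 * ρ / a < |((ε : ℂ)⁻¹).re| - κ := by linarith
    refine h3.trans_lt ?_
    rw [div_lt_iff₀ ha] at h4
    rw [div_lt_iff₀ (by linarith)]
    linarith
  refine ⟨hsol, fun ε _ _ t => borelSum_im_eq_zero hb h.adm _ _ _, hnear,
    fun ε h0 h1 T y hT hy hya => ?_, fun N => ?_⟩
  · refine IsPeriodicSolution.eq_of_near ha (abs_pos.1 h0) ?_ (by positivity) hT.ne' (hsol ε h0 h1) hy
      (fun t => (hnear ε h0 h1 t).le) (fun t => (hya t).le)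
    have h2 : |ε| * (2 * (a + 1)) ≤ 1 := by
      have h3 : |ε| * E ≤ 1 := by
        have := mul_le_mul_of_nonneg_right h1.le hE0.le
        rwa [inv_mul_cancel₀ hE0.ne'] at this
      refine (mul_le_mul_of_nonneg_left ?_ h0.le).trans h3
      linarith
    have h3 : (|ε| * (2 * (a + 1))) ^ 2 ≤ 1 := pow_le_one₀ (by positivity) h2
    rw [mul_pow, sq_abs] at h3
    refine le_trans ?_ h3
    rw [mul_comm]
    gcongr
    nlinarith [sq_nonneg a]
  · obtain ⟨C, hC⟩ := h.norm_borelSum_sub_sum_le hb hκ hρ.le ha.le N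
    refine ⟨C, fun ε h0 h1 t => ?_⟩
    simp only [axisSign_ofReal]
    refine hC ε t (abs_pos.1 h0) ?_
    have := (lt_inv_comm₀ h0 hE0).1 h1
    linarith

end Response

end

theorem theorem2 (f : ℝ → ℝ) (ω : ℝ) (hω : ω ≠ 0)
    (hf : AnalyticOnNhd ℝ f Set.univ) (hper : Function.Periodic f (2 * Real.pi))
    (hmean : 0 < forcingMean f) :
    ∃ (X : ℕ → ℝ → ℝ) (x : ℂ → ℝ → ℂ) (ε₀ δ : ℝ),
      0 < ε₀ ∧ 0 < δ ∧
      IsFormalPeriodicSolution f ω (Real.sqrt (forcingMean f)) X ∧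
      IsForcedResponse f ω (Real.sqrt (forcingMean f)) ε₀ δ X x ∧
      ∃ (R b K : ℝ) (B : ℝ → ℂ → ℂ),
        0 < R ∧ 0 < b ∧
        (∀ ε ∈ twoDiscs R, IsPeriodicSolution f ω (2 * Real.pi / ω) ε (x ε)) ∧
        ∀ t : ℝ, IsBorelSum R b K (fun k => (X k t : ℂ)) (B t) (fun ε => x ε t) := by
  obtain ⟨b, hb, κ, hκ, ρ, hρ, g, U, hg, h⟩ := exists_isBorelSolution_forcing hω hf hper hmean
  have ha : 0 < Real.sqrt (forcingMean f) := Real.sqrt_pos.2 hmean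
  have hga : ∀ t : ℝ, g t + (Real.sqrt (forcingMean f) : ℂ) ^ 2 = f (ω * t) := fun t => by
    rw [hg, ← Complex.ofReal_pow, Real.sq_sqrt hmean.le, ← Complex.ofReal_add, sub_add_cancel]
  refine ⟨_, _, _, _, by positivity, by positivity, h.isFormalPeriodicSolution hb hga,
    h.isForcedResponse hω ha hb hκ.le hρ hga, 1 / (κ + 1), b, Real.sqrt (forcingMean f) + ρ, _,
    by positivity, hb, fun ε hε => ?_, h.isBorelSum hb hκ.le hρ.le ha.le⟩
  have hε' : (1 / (κ + 1))⁻¹ < |(ε⁻¹).re| := hε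
  rw [one_div, inv_inv] at hε'
  -- The equation holds already for |Re ε⁻¹| > κ; the discs with R⁻¹ = κ + 1 are smaller because the
  -- Borel transform has the larger growth rate.
  exact h.isPeriodicSolution_axisSign hb hκ.le hρ.le hga (by linarith)
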